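/- **Setting.** Let $K$ be a non-archimedean local field of positive characteristic $p$, with ring of integers $\mathcal O$, prime element $\mathfrak p$ and residue field of $q=p^c$ elements, and let $dx$ be the Haar measure of $(K,+)$ with $|\mathcal O|=1$. Fix $1=\epsilon_0,\epsilon_1,\dots,\epsilon_{c-1}\in\mathcal O$ whose residues form a basis of the residue field over $\mathbb F_p$. For $0\le n<q$, $n=\sum_{i<c}a_ip^i$ with $0\le a_i<p$, put $u(n)=\big(\sum_{i<c} a_i\epsilon_i\big)\mathfrak p^{-1}$, and for $n=\sum_k b_kq^k$ with $0\le b_k<q$ put $u(n)=\sum_k u(b_k)\mathfrak p^{-k}$. Fix a continuous unitary character $\chi$ of $(K,+)$ which is trivial on $\mathcal O$, nontrivial on $\mathfrak p^{-1}\mathcal O$, and normalized by $\chi(\epsilon_i\epsilon_j\mathfrak p^{-m})=1$ for all $i,j$ and all $m\ge2$. Let $\hat f(\xi)=\int_K f(x)\chi(-\xi x)\,dx$ be the Fourier transform, extended from $L^1(K)\cap L^2(K)$ to $L^2(K)$. Let $T_kf(x)=f(x-u(k))$ for $k\in\mathbb N_0$, and $D^jf(x)=q^{j/2}f(\mathfrak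 p^{-j}x)$ for $j\in\mathbb Z$. For a closed subspace $V\subseteq L^2(K)$ invariant under all $T_k$, a range function is a measurable map $J$ from $\mathcal O$ to the closed subspaces of $\ell^2(\mathbb N_0)$ such that $f\in V$ if and only if $(\hat f(\xi+u(k)))_{k\ge0}\in J(\xi)$ for a.e. $\xi\in\mathcal O$. The multiplicity function of $V$ is $m_V(\xi)=\dim J(\xi)\in\mathbb N_0\cup\{\infty\}$ for $\xi\in\mathcal O$ (determined up to null sets), extended to $K$ by $m_V(\xi+u(k))=m_V(\xi)$. **Proposition 3.3.2.** Let $\psi_1,\dots,\psi_L\in L^2(K)$ be a semi-orthogonal Parseval multiwavelet: that is, $\sum_{l=1}^L\sum_{j\in\mathbb Z}\sum_{k\ge0}|\langle f,D^jT_k\psi_l\rangle|^2=\|f\|^2$ for every $f\in L^2(K)$, and the spaces $D^jW$, $j\in\mathbb Z$, are pairwise orthogonal, where $W=\overline{\mathrm{span}}\{T_k\psi_l: k\ge0,\ 1\le l\le L\}$. Let $V=\bigoplus_{j<0}D^jW$ (the closed orthogonal sum) be its space of negative dilates. Then $V$ has a multiplicity function $m_V$, and $$m_V(\xi)=\sum_{l=1}^L\sum_{j=1}^\infty\sum_{k\ge0}\big|\hat\psi_l\big(\mathfrak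 p^{-j}(\xi+u(k))\big)\big|^2\quad\text{for a.e. }\xi\in K.$$ Hence $\int_{\mathcal O}m_V(\xi)\,d\xi\le\frac{L}{q-1}$. Moreover, $$m_V(\xi)+L\ \ge\ \sum_{d=0}^{q-1}m_V\big(\mathfrak p(\xi+u(d))\big)\quad\text{for a.e. }\xi\in K.$$ -/

import Mathlib

open MeasureTheory
open scoped ENNReal ValuativeRel

noncomputable section

namespace LFWavelet

/-- The standing choices for wavelet analysis on a local field `K` of positive characteristic `p`
whose residue field has `p ^ c` elements. -/
structure Choices (K : Type*) [Field K] [ValuativeRel K] [TopologicalSpace K]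
    [IsNonarchimedeanLocalField K] (p c : ℕ) where
  /-- the prime element `𝔭` -/
  π : 𝒪[K]
  irreducible_π : Irreducible π
  /-- integers `ε 0 = 1, ε 1, …, ε (c - 1)` whose residues are a basis of the residue field
  over the prime field with `p` elements -/
  ε : Fin c → 𝒪[K]
  ε_zero : ∀ i : Fin c, (i : ℕ) = 0 → ε i = 1
  ε_basis : Function.Bijective
    (fun a : Fin c → Fin p => ∑ i, ((a i : ℕ) : 𝓀[K]) * IsLocalRing.residue 𝒪[K] (ε i))
  /-- the fixed additive character: trivial on the integers, nontrivial on `𝔭⁻¹ 𝒪` -/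
  χ : AddChar K Circle
  continuous_χ : Continuous χ
  χ_integer : ∀ x ∈ 𝒪[K], χ x = 1
  χ_nontrivial : ∃ x ∈ 𝒪[K], χ ((π : K)⁻¹ * x) ≠ 1
  /-- normalization of the character with respect to the `ε i`. (If the `ε i` span a subfield of
  `K`, it says `χ (ε i * 𝔭 ^ (-m)) = 1` for `m ≥ 2`.) -/
  χ_normalized : ∀ i j : Fin c, ∀ m : ℕ, 2 ≤ m →
    χ ((ε i : K) * (ε j : K) * ((π : K)⁻¹) ^ m) = 1

section Translations

variable {K : Type*} [Field K] [ValuativeRel K] [TopologicalSpace K]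
  [IsNonarchimedeanLocalField K] {p c : ℕ}

/-- The number `q` of elements of the residue field. -/
def resCard (K : Type*) [Field K] [ValuativeRel K] [TopologicalSpace K]
    [IsNonarchimedeanLocalField K] : ℕ := Nat.card 𝓀[K]

/-- `u n` for `n = ∑ aᵢ pⁱ < q`, `0 ≤ aᵢ < p`: the element `(∑ aᵢ εᵢ) 𝔭⁻¹`. -/
def Choices.uDigit (S : Choices K p c) (n : ℕ) : K :=
  (∑ i : Fin c, ((n / p ^ (i : ℕ) % p : ℕ) : K) * (S.ε i : K)) * (S.π : K)⁻¹

/-- `u n = ∑ₖ u(bₖ) 𝔭⁻ᵏ` for `n = ∑ₖ bₖ qᵏ`, `0 ≤ bₖ < q`. (The digits `bₖ` with `k ≥ n` vanish,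
because `n < qⁿ`.) -/
def Choices.u (S : Choices K p c) (n : ℕ) : K :=
  ∑ k ∈ Finset.range n, S.uDigit (n / resCard K ^ k % resCard K) * ((S.π : K)⁻¹) ^ k

lemma Choices.π_ne_zero (S : Choices K p c) : (S.π : K) ≠ 0 := by
  have := S.irreducible_π.ne_zero
  exact fun h => this (Subtype.ext h)

end Translations

variable {K : Type*} [Field K] [ValuativeRel K] [TopologicalSpace K]
  [IsNonarchimedeanLocalField K] [MeasurableSpace K] [BorelSpace K] {p c : ℕ}

/-- Multiplication by a nonzero element, as an isomorphism of topological additive groups. -/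
def mulEquiv {K : Type*} [Field K] [ValuativeRel K] [TopologicalSpace K]
    [IsNonarchimedeanLocalField K] (a : K) (ha : a ≠ 0) : K ≃ₜ+ K where
  toFun x := a * x
  invFun x := a⁻¹ * x
  left_inv x := by simp [ha]
  right_inv x := by simp [ha]
  map_add' := mul_add a
  continuous_toFun := continuous_const.mul continuous_id
  continuous_invFun := continuous_const.mul continuous_id

lemma memLp_comp_mul (μ : Measure K) [μ.IsAddHaarMeasure] [μ.Regular] {a : K} (ha : a ≠ 0)
    {f : K → ℂ} (hf : MemLp f 2 μ) : MemLp (fun x => f (a * x)) 2 μ := by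
  let e := mulEquiv a ha
  have : (μ.map e).IsAddHaarMeasure := e.isAddHaarMeasure_map μ
  have : (μ.map e).Regular := Measure.Regular.map e.toHomeomorph
  have h := Measure.isAddLeftInvariant_eq_smul_of_regular (μ.map e) μ
  have hm : MemLp f 2 (μ.map e) := by
    rw [h]
    exact hf.smul_measure (c := ((Measure.addHaarScalarFactor (μ.map e) μ : NNReal) : ℝ≥0∞))
      ENNReal.coe_ne_top
  exact hm.comp_of_map e.continuous.measurable.aemeasurable

lemma ae_comp_mul (μ : Measure K) [μ.IsAddHaarMeasure] [μ.Regular] {a : K} (ha : a ≠ 0)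
    {P : K → Prop} (hP : ∀ᵐ x ∂μ, P x) : ∀ᵐ x ∂μ, P (a * x) := by
  let e := mulEquiv a ha
  have : (μ.map e).IsAddHaarMeasure := e.isAddHaarMeasure_map μ
  have : (μ.map e).Regular := Measure.Regular.map e.toHomeomorph
  have h := Measure.isAddLeftInvariant_eq_smul_of_regular (μ.map e) μ
  have hm : ∀ᵐ x ∂(μ.map e), P x := by
    rw [h]
    exact Measure.ae_smul_measure hP _
  exact ae_of_ae_map e.continuous.measurable.aemeasurable hm

/-- The translation operator `T_k f (x) = f (x - u k)` on `L²(K)`. -/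
def translation (S : Choices K p c) (μ : Measure K) [μ.IsAddHaarMeasure] (k : ℕ) :
    Lp ℂ 2 μ →ₗ[ℂ] Lp ℂ 2 μ :=
  Lp.compMeasurePreservingₗ ℂ (fun x => x - S.u k) (measurePreserving_sub_right μ (S.u k))

/-- The dilation operator `D^j f (x) = q^{j/2} f (𝔭^{-j} x)` on `L²(K)`. -/
def dilation (S : Choices K p c) (μ : Measure K) [μ.IsAddHaarMeasure] [μ.Regular] (j : ℤ) :
    Lp ℂ 2 μ →ₗ[ℂ] Lp ℂ 2 μ where
  toFun f := (((resCard K : ℝ) ^ ((j : ℝ) / 2) : ℝ) : ℂ) •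
    (memLp_comp_mul μ (zpow_ne_zero (-j) S.π_ne_zero) (Lp.memLp f)).toLp
      (fun x => f ((S.π : K) ^ (-j) * x))
  map_add' f g := by
    have hz := zpow_ne_zero (-j) S.π_ne_zero
    rw [← smul_add]
    congr 1
    refine Eq.trans ?_ (MemLp.toLp_add (memLp_comp_mul μ hz (Lp.memLp f))
      (memLp_comp_mul μ hz (Lp.memLp g)))
    exact MemLp.toLp_congr _ _ (ae_comp_mul μ hz (Lp.coeFn_add f g))
  map_smul' r f := by
    have hz := zpow_ne_zero (-j) S.π_ne_zero
    rw [RingHom.id_apply, smul_comm]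
    congr 1
    refine Eq.trans ?_ (MemLp.toLp_const_smul r (memLp_comp_mul μ hz (Lp.memLp f)))
    exact MemLp.toLp_congr _ _ (ae_comp_mul μ hz (Lp.coeFn_smul r f))

/-- `g` is the Fourier transform of `f ∈ L²(K)`: the pair `(f, g)` lies in the closure in
`L² × L²` of the graph of `f ↦ (ξ ↦ ∫ χ(-ξ x) f(x) dx)` on `L¹ ∩ L²`. -/
def IsFourierL2 (S : Choices K p c) (μ : Measure K) (f g : Lp ℂ 2 μ) : Prop :=
  (f, g) ∈ closure {F : Lp ℂ 2 μ × Lp ℂ 2 μ |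
    Integrable F.1 μ ∧ F.2 =ᵐ[μ] Fourier.fourierIntegral S.χ μ F.1}

/-- The Fourier transform on `L²(K)`, i.e. the continuous extension from `L¹ ∩ L²`. -/
def fourierL2 (S : Choices K p c) (μ : Measure K) (f : Lp ℂ 2 μ) : Lp ℂ 2 μ :=
  Classical.epsilon (fun g => IsFourierL2 S μ f g)

/-- The affine system of `Ψ` is a Parseval frame of `L²(K)`. -/
def IsParsevalMultiwavelet (S : Choices K p c) (μ : Measure K) [μ.IsAddHaarMeasure] [μ.Regular]
    {L : ℕ} (Ψ : Fin L → Lp ℂ 2 μ) : Prop :=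
  ∀ f : Lp ℂ 2 μ, HasSum
    (fun i : Fin L × ℤ × ℕ =>
      ‖inner ℂ (dilation S μ i.2.1 (translation S μ i.2.2 (Ψ i.1))) f‖ ^ 2) (‖f‖ ^ 2)

/-- `W`, the closed linear span of the translates of the generators. -/
def waveletSpace (S : Choices K p c) (μ : Measure K) [μ.IsAddHaarMeasure]
    {L : ℕ} (Ψ : Fin L → Lp ℂ 2 μ) : Submodule ℂ (Lp ℂ 2 μ) :=
  (Submodule.span ℂ {g | ∃ (l : Fin L) (k : ℕ), g = translation S μ k (Ψ l)}).topologicalClosure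

/-- The spaces `D^j W`, `j ∈ ℤ`, are pairwise orthogonal. -/
def IsSemiOrthogonal (S : Choices K p c) (μ : Measure K) [μ.IsAddHaarMeasure] [μ.Regular]
    {L : ℕ} (Ψ : Fin L → Lp ℂ 2 μ) : Prop :=
  ∀ j j' : ℤ, j ≠ j' →
    (waveletSpace S μ Ψ).map (dilation S μ j) ⟂ (waveletSpace S μ Ψ).map (dilation S μ j')

/-- The space of negative dilates `V = ⨁_{j < 0} D^j W` (closed linear span). -/
def negDilateSpace (S : Choices K p c) (μ : Measure K) [μ.IsAddHaarMeasure] [μ.Regular]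
    {L : ℕ} (Ψ : Fin L → Lp ℂ 2 μ) : Submodule ℂ (Lp ℂ 2 μ) :=
  (⨆ (j : ℤ) (_ : j < 0), (waveletSpace S μ Ψ).map (dilation S μ j)).topologicalClosure

/-- The sequence space `ℓ²(ℕ₀)`, identified with `ℓ²(𝒵)` through `k ↦ u k`. -/
abbrev EllTwo : Type := lp (fun _ : ℕ => ℂ) 2

/-- `J` is a measurable range function of the space `V`: the space `V` consists of those
`f ∈ L²(K)` whose fibers `(f̂(ξ + u k))ₖ` lie in `J ξ` for almost every `ξ ∈ 𝒪`. -/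
structure IsRangeFunction (S : Choices K p c) (μ : Measure K) (V : Submodule ℂ (Lp ℂ 2 μ))
    (J : 𝒪[K] → ClosedSubmodule ℂ EllTwo) : Prop where
  measurable : ∀ a b : EllTwo,
    Measurable (fun ξ => inner ℂ a ((J ξ).toSubmodule.starProjection b))
  mem_iff : ∀ f : Lp ℂ 2 μ, f ∈ V ↔
    ∀ᵐ ξ ∂μ, ∀ hξ : ξ ∈ 𝒪[K], ∃ v ∈ J ⟨ξ, hξ⟩, ∀ k : ℕ, v k = fourierL2 S μ f (ξ + S.u k)

/-- `m` is the multiplicity function of `V`: it is the dimension of (a version of) the range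
function of `V` on `𝒪`, and is extended to `K` by periodicity under the translations `u k`. -/
def IsMultiplicityFunction (S : Choices K p c) (μ : Measure K) (V : Submodule ℂ (Lp ℂ 2 μ))
    (m : K → ℕ∞) : Prop :=
  (∃ J : 𝒪[K] → ClosedSubmodule ℂ EllTwo, IsRangeFunction S μ V J ∧
    ∀ ξ : 𝒪[K], m (ξ : K) = Cardinal.toENat (Module.rank ℂ (J ξ).toSubmodule)) ∧
  ∀ (ξ : K) (k : ℕ), m (ξ + S.u k) = m ξ

end LFWavelet

end

/-!
The argument runs through the spectral function `σ` of the space `V` of negative dilates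
(`Choices.spectral`): at `ξ + u k` with `ξ ∈ 𝒪` it is `‖P(ξ) e_k‖²`, where `P(ξ)` is the projection
of `ℓ²` onto `J(ξ)` and `e_k` is the standard basis. The dimension of `J(ξ)` is the trace of `P(ξ)`,
so the multiplicity function is the periodization `m(ξ) = ∑ₖ σ(ξ + u k)`
(`Choices.multiplicity_eq`). Everything follows from the formula `σ = ∑_{j ≥ 1} δ(𝔭⁻ʲ ·)`, where
`δ = ∑ₗ |ψ̂ₗ|²`; this is `IsRangeFunction.spectral_eq`.

By semi-orthogonality and the Parseval property, `Vᗮ` is the closed span of the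
`D^j T_k ψ_l` with `j ≥ 0`, and the distance of `f` to `V` is given by the sum of the squares of
its coefficients with `j ≥ 0`.
If `f̂ = 1_E` with `E` in a translate of `𝒪`, then for every `j ≥ 0` the sum over `k` is a Parseval
sum on a ball, and it equals `∑ₗ ∫_E |ψ̂ₗ(𝔭ʲ ξ)|² dξ`. The projection of `f` to `V` has squared norm
`∫_E σ`. Hence `σ + ∑_{j ≥ 0} δ(𝔭ʲ ·) = 1` (`IsRangeFunction.spectral_add_tsum`).

The formula for `σ` is the difference of this and the Calderón identity `∑_{j ∈ ℤ} δ(𝔭ʲ ·) = 1`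
(`IsRangeFunction.tsum_density_eq_one`). There `≤` follows by dilation from the identity above.
For `≥`, apply the Parseval property to functions with `f̂ = 1_E`, where `E` runs over a partition
of the units into small balls. The scales `j` for which the sum over `k` is only bounded by Bessel's
inequality contribute an amount that tends to `0` with the radius of the balls, because the dilates
of the set of units are disjoint.

Integration of the formula for `σ` over `K`, with `‖ψ_l‖ ≤ 1`, gives the bound on `∫ m`. Finally
`σ(𝔭 ξ) = σ(ξ) + δ(ξ)`, and the elements `𝔭(ξ + u d) + u k` with `d < q` are the elements
`𝔭(ξ + u k')`; hence `∑_d m(𝔭(ξ + u d)) = m(ξ) + ∑ₖ δ(ξ + u k)`, and the last sum is at most `L` by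
Bessel's inequality for the translates of each generator (`IsParsevalMultiwavelet.bracket_le_one`).

The Fourier transform on `L²(K)` is treated by means of the orthonormal basis of the functions
`χ(u k x) 1_{u l + 𝒪}(x)`, which it permutes. The range function of
`V` is the orthogonal complement of the fibers of the elements of nonnegative scale, and it is
measurable by the Gram–Schmidt process.
-/

noncomputable section

namespace LFWavelet

open ValuativeRel

/-! ### The translation set -/

section Arithmetic

variable {K : Type*} [Field K] [ValuativeRel K] [TopologicalSpace K]
  [IsNonarchimedeanLocalField K] {p c : ℕ}

lemma resCard_pos : 0 < resCard K := Nat.card_pos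

lemma one_lt_resCard : 1 < resCard K := Finite.one_lt_card

lemma resCard_eq (S : Choices K p c) : resCard K = p ^ c := by
  have h := Nat.card_congr (Equiv.ofBijective _ S.ε_basis)
  simp only [Nat.card_eq_fintype_card, Fintype.card_fun, Fintype.card_fin] at h
  rw [resCard, ← h]

lemma Choices.residue_eq_zero_iff (S : Choices K p c) (x : 𝒪[K]) :
    IsLocalRing.residue 𝒪[K] x = 0 ↔ (S.π : K)⁻¹ * x ∈ 𝒪[K] := by
  rw [IsLocalRing.residue_eq_zero_iff, S.irreducible_π.maximalIdeal_eq,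
    Ideal.mem_span_singleton]
  constructor
  · rintro ⟨y, rfl⟩
    simp [S.π_ne_zero]
  · intro h
    exact ⟨⟨_, h⟩, Subtype.ext (by simp [S.π_ne_zero])⟩

lemma Choices.inv_notMem (S : Choices K p c) : (S.π : K)⁻¹ ∉ 𝒪[K] := by
  intro h
  have := (S.residue_eq_zero_iff 1).2 (by simpa using h)
  simp at this

lemma Choices.π_mul_mem (S : Choices K p c) {x : K} (hx : x ∈ 𝒪[K]) : (S.π : K) * x ∈ 𝒪[K] :=
  mul_mem S.π.2 hx

lemma Choices.valuation_lt_one (S : Choices K p c) : valuation K (S.π : K) < 1 := by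
  have h := S.inv_notMem
  have hle : valuation K (S.π : K) ≤ 1 := S.π.2
  refine lt_of_le_of_ne hle fun h1 => h ?_
  change valuation K _ ≤ 1
  simp [h1]

lemma Choices.exists_pow_mul_mem (S : Choices K p c) (x : K) : ∃ n : ℕ, (S.π : K) ^ n * x ∈ 𝒪[K] := by
  by_cases hx : x = 0
  · exact ⟨0, by simp [hx, zero_mem]⟩
  · have hv : valuation K x ≠ 0 := by simpa using hx
    obtain ⟨n, hn⟩ := exists_pow_lt₀ S.valuation_lt_one (Units.mk0 _ hv)⁻¹
    refine ⟨n, ?_⟩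
    change valuation K _ ≤ 1
    rw [map_mul, map_pow]
    have := mul_le_mul_left hn.le (valuation K x)
    simpa [hv] using this

/-- The digit `∑ aᵢ εᵢ`, as an integer of `K`. -/
def Choices.digit (S : Choices K p c) (n : ℕ) : 𝒪[K] :=
  ∑ i : Fin c, ((n / p ^ (i : ℕ) % p : ℕ) : 𝒪[K]) * S.ε i

lemma Choices.uDigit_eq (S : Choices K p c) (n : ℕ) :
    S.uDigit n = (S.π : K)⁻¹ * (S.digit n : K) := by
  simp [Choices.uDigit, Choices.digit, mul_comm]

@[simp]
lemma Choices.uDigit_zero (S : Choices K p c) : S.uDigit 0 = 0 := by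
  simp [Choices.uDigit]

lemma Choices.u_eq_sum (S : Choices K p c) {n N : ℕ} (h : n ≤ N) :
    S.u n = ∑ k ∈ Finset.range N,
      S.uDigit (n / resCard K ^ k % resCard K) * ((S.π : K)⁻¹) ^ k := by
  refine Finset.sum_subset (Finset.range_mono h) fun k _ hk => ?_
  have hk' : n < resCard K ^ k :=
    (le_of_not_gt (by simpa using hk)).trans_lt (Nat.lt_pow_self one_lt_resCard)
  simp [Nat.div_eq_of_lt hk']

@[simp]
lemma Choices.u_zero (S : Choices K p c) : S.u 0 = 0 := by
  simp [Choices.u]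

/-- Splitting off the last digit of the index. -/
lemma Choices.u_add_mul (S : Choices K p c) {d : ℕ} (hd : d < resCard K) (k : ℕ) :
    S.u (d + resCard K * k) = S.uDigit d + (S.π : K)⁻¹ * S.u k := by
  have hk : k ≤ d + resCard K * k :=
    (Nat.le_mul_of_pos_left k resCard_pos).trans (Nat.le_add_left _ _)
  rw [S.u_eq_sum (Nat.le_succ (d + resCard K * k)), S.u_eq_sum hk, Finset.sum_range_succ',
    add_comm, Finset.mul_sum]
  congr 1
  · simp [Nat.add_mul_mod_self_left, Nat.mod_eq_of_lt hd]
  · refine Finset.sum_congr rfl fun i _ => ?_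
    have : (d + resCard K * k) / resCard K ^ (i + 1) = k / resCard K ^ i := by
      rw [pow_succ', ← Nat.div_div_eq_div_mul, Nat.add_mul_div_left _ _ resCard_pos,
        Nat.div_eq_of_lt hd, zero_add]
    rw [this]
    ring

lemma Choices.u_digit (S : Choices K p c) {d : ℕ} (hd : d < resCard K) :
    S.u d = S.uDigit d := by
  simpa using S.u_add_mul hd 0

lemma Choices.u_mul (S : Choices K p c) (k : ℕ) :
    S.u (resCard K * k) = (S.π : K)⁻¹ * S.u k := by
  simpa using S.u_add_mul resCard_pos k

lemma Choices.u_pow_mul (S : Choices K p c) (n k : ℕ) :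
    S.u (resCard K ^ n * k) = (S.π : K)⁻¹ ^ n * S.u k := by
  induction n with
  | zero => simp
  | succ n ih => rw [pow_succ', mul_assoc, u_mul, ih]; ring

/-- The digits represent each residue class exactly once. -/
lemma Choices.existsUnique_digit (S : Choices K p c) (x : 𝒪[K]) :
    ∃! d, d < resCard K ∧ IsLocalRing.residue 𝒪[K] (S.digit d) = IsLocalRing.residue 𝒪[K] x := by
  have key : ∀ d : Fin (p ^ c), IsLocalRing.residue 𝒪[K] (S.digit d) =
      (fun a : Fin c → Fin p => ∑ i, ((a i : ℕ) : 𝓀[K]) * IsLocalRing.residue 𝒪[K] (S.ε i))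
        (finFunctionFinEquiv.symm d) := by
    intro d
    simp only [Choices.digit, map_sum, map_mul, map_natCast]
    rfl
  rw [resCard_eq S]
  obtain ⟨a, ha, hu⟩ := (S.ε_basis.comp finFunctionFinEquiv.symm.bijective).existsUnique
    (IsLocalRing.residue 𝒪[K] x)
  refine ⟨a, ⟨a.2, (key a).trans ha⟩, ?_⟩
  rintro d ⟨hd, h⟩
  exact congrArg Fin.val (hu (⟨d, hd⟩ : Fin (p ^ c)) ((key ⟨d, hd⟩).symm.trans h))

lemma Choices.exists_sub_u_mem_aux (S : Choices K p c) (n : ℕ) :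
    ∀ x : K, (S.π : K) ^ n * x ∈ 𝒪[K] → ∃ k, x - S.u k ∈ 𝒪[K] := by
  induction n with
  | zero => exact fun x hx => ⟨0, by simpa using hx⟩
  | succ n ih =>
    intro x hx
    obtain ⟨k, hk⟩ := ih (S.π * x) (by rwa [← mul_assoc, ← pow_succ])
    obtain ⟨d, ⟨hd, h⟩, -⟩ := S.existsUnique_digit ⟨_, hk⟩
    refine ⟨d + resCard K * k, ?_⟩
    rw [← sub_eq_zero, ← map_sub, ← neg_eq_zero, ← map_neg, S.residue_eq_zero_iff] at h
    rw [S.u_add_mul hd, S.uDigit_eq]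
    convert h using 1
    have := S.π_ne_zero
    simp
    field_simp
    ring

lemma Choices.exists_sub_u_mem (S : Choices K p c) (x : K) : ∃ k, x - S.u k ∈ 𝒪[K] :=
  (S.exists_pow_mul_mem x).elim fun n hn => S.exists_sub_u_mem_aux n x hn

/-- The translates `u k + 𝒪` are pairwise distinct. -/
lemma Choices.u_eq_of_sub_mem (S : Choices K p c) (k : ℕ) :
    ∀ l, S.u k - S.u l ∈ 𝒪[K] → k = l := by
  induction k using Nat.strong_induction_on with
  | _ k ih =>
    have aux : ∀ k l, S.u k - S.u l ∈ 𝒪[K] →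
        S.u (k / resCard K) - S.u (l / resCard K) ∈ 𝒪[K] ∧
        (k / resCard K = l / resCard K → k = l) := by
      intro k l h
      have hk := S.u_add_mul (Nat.mod_lt k resCard_pos) (k / resCard K)
      have hl := S.u_add_mul (Nat.mod_lt l resCard_pos) (l / resCard K)
      rw [Nat.mod_add_div] at hk hl
      have hπ := S.π_ne_zero
      rw [S.uDigit_eq] at hk hl
      constructor
      · have h1 := add_mem (S.π_mul_mem h) (sub_mem (S.digit (l % resCard K)).2
          (S.digit (k % resCard K)).2)
        convert h1 using 1
        rw [hk, hl]
        field_simp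
        ring
      · intro e
        rw [← Nat.mod_add_div k (resCard K), ← Nat.mod_add_div l (resCard K), e]
        congr 1
        refine (S.existsUnique_digit (S.digit (l % resCard K))).unique
          ⟨Nat.mod_lt _ resCard_pos, ?_⟩ ⟨Nat.mod_lt _ resCard_pos, rfl⟩
        rw [← sub_eq_zero, ← map_sub, S.residue_eq_zero_iff]
        convert h using 1
        rw [hk, hl, e]
        push_cast
        ring
    have aux' : ∀ k l, S.u k - S.u l ∈ 𝒪[K] → S.u l - S.u k ∈ 𝒪[K] := fun k l h => by
      simpa using neg_mem h
    intro l h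
    rcases Nat.eq_zero_or_pos k with rfl | hk
    · clear ih
      induction l using Nat.strong_induction_on with
      | _ l ihl =>
        rcases Nat.eq_zero_or_pos l with rfl | hl
        · rfl
        · obtain ⟨h1, h2⟩ := aux _ _ h
          refine h2 ?_
          rw [Nat.zero_div] at h1 ⊢
          exact ihl _ (Nat.div_lt_self hl one_lt_resCard) h1
    · obtain ⟨h1, h2⟩ := aux _ _ h
      exact h2 (ih _ (Nat.div_lt_self hk one_lt_resCard) _ h1)

lemma Choices.u_injective (S : Choices K p c) : Function.Injective S.u := fun k l h =>
  S.u_eq_of_sub_mem k l (by simp [h, zero_mem])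

/-- The index of the translate `u k + 𝒪` which contains `x`. -/
def Choices.idx (S : Choices K p c) (x : K) : ℕ := (S.exists_sub_u_mem x).choose

lemma Choices.sub_u_idx_mem (S : Choices K p c) (x : K) : x - S.u (S.idx x) ∈ 𝒪[K] :=
  (S.exists_sub_u_mem x).choose_spec

lemma Choices.idx_eq_iff (S : Choices K p c) {x : K} {k : ℕ} : S.idx x = k ↔ x - S.u k ∈ 𝒪[K] := by
  constructor
  · rintro rfl
    exact S.sub_u_idx_mem x
  · intro h
    refine S.u_eq_of_sub_mem _ _ ?_
    simpa using sub_mem h (S.sub_u_idx_mem x)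

/-- The integral part of `x`, relative to the translates `u k`. -/
def Choices.frac (S : Choices K p c) (x : K) : 𝒪[K] := ⟨_, S.sub_u_idx_mem x⟩

lemma Choices.frac_add_u (S : Choices K p c) (x : K) : (S.frac x : K) + S.u (S.idx x) = x := by
  simp [Choices.frac]

lemma Choices.idx_add_u (S : Choices K p c) {x : K} (hx : x ∈ 𝒪[K]) (k : ℕ) :
    S.idx (x + S.u k) = k := by
  simpa [S.idx_eq_iff] using hx

lemma Choices.frac_of_add_u (S : Choices K p c) {x : K} (hx : x ∈ 𝒪[K]) (k : ℕ) :
    S.frac (x + S.u k) = ⟨x, hx⟩ :=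
  Subtype.ext (by simp [Choices.frac, S.idx_add_u hx])

/-- Digits are added without carry, because `p = 0` in `K`. -/
lemma Choices.exists_digit_add [CharP K p] [Fact p.Prime] (S : Choices K p c) (d e : ℕ) :
    ∃ f < resCard K, S.uDigit d + S.uDigit e = S.uDigit f := by
  have hp : 0 < p := (Fact.out : p.Prime).pos
  let a : Fin c → Fin p := fun i =>
    ⟨(d / p ^ (i : ℕ) % p + e / p ^ (i : ℕ) % p) % p, Nat.mod_lt _ hp⟩
  refine ⟨finFunctionFinEquiv a, (Fin.is_lt _).trans_eq (resCard_eq S).symm, ?_⟩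
  have key : ∀ i : Fin c, ((finFunctionFinEquiv a : ℕ) / p ^ (i : ℕ) % p : ℕ) = a i := fun i =>
    congrArg Fin.val (congrFun (finFunctionFinEquiv.symm_apply_apply a) i)
  have key' : ∀ n : ℕ, ((n % p : ℕ) : K) = n := fun n =>
    (CharP.cast_eq_iff_mod_eq K p).2 (Nat.mod_mod _ _)
  simp only [Choices.uDigit, ← add_mul, ← Finset.sum_add_distrib, key]
  simp [a, key']

lemma Choices.exists_u_add [CharP K p] [Fact p.Prime] (S : Choices K p c) (k : ℕ) :
    ∀ l, ∃ m, S.u k + S.u l = S.u m := by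
  induction k using Nat.strong_induction_on with
  | _ k ih =>
    intro l
    rcases Nat.eq_zero_or_pos k with rfl | hk
    · exact ⟨l, by simp⟩
    have hk' := S.u_add_mul (Nat.mod_lt k resCard_pos) (k / resCard K)
    have hl' := S.u_add_mul (Nat.mod_lt l resCard_pos) (l / resCard K)
    rw [Nat.mod_add_div] at hk' hl'
    obtain ⟨f, hf, e⟩ := S.exists_digit_add (k % resCard K) (l % resCard K)
    obtain ⟨m, hm⟩ := ih _ (Nat.div_lt_self hk (one_lt_resCard (K := K))) (l / resCard K)
    refine ⟨f + resCard K * m, ?_⟩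
    rw [S.u_add_mul hf, hk', hl', ← e, ← hm]
    ring

/-- The translates `u k` form a subgroup of `(K, +)`, because the characteristic is positive. -/
def Choices.lattice [CharP K p] [Fact p.Prime] (S : Choices K p c) : AddSubgroup K where
  carrier := Set.range S.u
  zero_mem' := ⟨0, S.u_zero⟩
  add_mem' := by
    rintro _ _ ⟨k, rfl⟩ ⟨l, rfl⟩
    obtain ⟨m, hm⟩ := S.exists_u_add k l
    exact ⟨m, hm.symm⟩
  neg_mem' := by
    rintro _ ⟨k, rfl⟩
    have hn : ∀ n : ℕ, ∃ m, n • S.u k = S.u m := by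
      intro n
      induction n with
      | zero => exact ⟨0, by simp⟩
      | succ n ih =>
        obtain ⟨m, hm⟩ := ih
        obtain ⟨m', hm'⟩ := S.exists_u_add m k
        exact ⟨m', by rw [succ_nsmul, hm, hm']⟩
    obtain ⟨m, hm⟩ := hn (p - 1)
    refine ⟨m, ?_⟩
    have h1 : 1 ≤ p := (Fact.out : p.Prime).one_lt.le
    rw [← hm, nsmul_eq_mul, Nat.cast_sub h1, CharP.cast_eq_zero K p]
    simp

/-- The enumeration of the lattice by the natural numbers. -/
def Choices.uEquiv [CharP K p] [Fact p.Prime] (S : Choices K p c) : ℕ ≃ S.lattice :=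
  Equiv.ofInjective S.u S.u_injective

@[simp]
lemma Choices.coe_uEquiv [CharP K p] [Fact p.Prime] (S : Choices K p c) (k : ℕ) :
    (S.uEquiv k : K) = S.u k := rfl

/-- The permutation of the indices which corresponds to `x ↦ -x` on the lattice. -/
def Choices.negIdx [CharP K p] [Fact p.Prime] (S : Choices K p c) : ℕ ≃ ℕ :=
  S.uEquiv.trans ((Equiv.neg _).trans S.uEquiv.symm)

@[simp]
lemma Choices.u_negIdx [CharP K p] [Fact p.Prime] (S : Choices K p c) (k : ℕ) :
    S.u (S.negIdx k) = -S.u k := by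
  rw [← S.coe_uEquiv]; simp [Choices.negIdx]

/-- The permutation of the indices which corresponds to adding `u m` on the lattice. -/
def Choices.addIdx [CharP K p] [Fact p.Prime] (S : Choices K p c) (m : ℕ) : ℕ ≃ ℕ :=
  S.uEquiv.trans ((Equiv.addRight (S.uEquiv m)).trans S.uEquiv.symm)

@[simp]
lemma Choices.u_addIdx [CharP K p] [Fact p.Prime] (S : Choices K p c) (m k : ℕ) :
    S.u (S.addIdx m k) = S.u k + S.u m := by
  rw [← S.coe_uEquiv]; simp [Choices.addIdx]

/-- The bijection `(d, k) ↦ d + q k`, which splits off the last digit of an index. -/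
def digitEquiv (K : Type*) [Field K] [ValuativeRel K] [TopologicalSpace K]
    [IsNonarchimedeanLocalField K] : Fin (resCard K) × ℕ ≃ ℕ where
  toFun x := x.1 + resCard K * x.2
  invFun n := (⟨n % resCard K, Nat.mod_lt _ resCard_pos⟩, n / resCard K)
  left_inv x := by
    ext
    · simp [Nat.mod_eq_of_lt x.1.2]
    · simp [Nat.add_mul_div_left _ _ (resCard_pos (K := K)), Nat.div_eq_of_lt x.1.2]
  right_inv n := Nat.mod_add_div (k := resCard K) _

/-! ### Annihilators with respect to the additive character -/

lemma Choices.u_mem_closure (S : Choices K p c) (n : ℕ) :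
    S.u n ∈ AddSubgroup.closure
      {x : K | ∃ (i : Fin c) (m : ℕ), x = (S.ε i : K) * (S.π : K)⁻¹ ^ (m + 1)} := by
  refine sum_mem fun k _ => ?_
  rw [Choices.uDigit, mul_assoc, Finset.sum_mul]
  refine sum_mem fun i _ => ?_
  rw [mul_assoc, ← nsmul_eq_mul]
  refine AddSubgroup.nsmul_mem _ (AddSubgroup.subset_closure ?_) _
  exact ⟨i, k, by ring⟩

/-- The pairing `(x, y) ↦ χ (x y)` is trivial on the translation set: a product of two elements
of it is a sum of terms `εᵢ εⱼ 𝔭⁻ᵐ` with `m ≥ 2`, and there `χ` is normalized. -/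
lemma Choices.χ_u_mul_u (S : Choices K p c) (k l : ℕ) : S.χ (S.u k * S.u l) = 1 := by
  generalize hx : S.u k = x
  generalize hy : S.u l = y
  have hx' := hx ▸ S.u_mem_closure k
  have hy' := hy ▸ S.u_mem_closure l
  clear hx hy
  induction hx', hy' using AddSubgroup.closure_induction₂ with
  | mem x y hx hy =>
    obtain ⟨i, m, rfl⟩ := hx
    obtain ⟨j, n, rfl⟩ := hy
    convert S.χ_normalized i j (m + n + 2) (by omega) using 2
    ring
  | zero_left => simp
  | zero_right => simp
  | add_left x y z _ _ _ h1 h2 => rw [add_mul, AddChar.map_add_eq_mul, h1, h2, one_mul]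
  | add_right x y z _ _ _ h1 h2 => rw [mul_add, AddChar.map_add_eq_mul, h1, h2, one_mul]
  | neg_left x y _ _ h => rw [neg_mul, AddChar.map_neg_eq_inv, h, inv_one]
  | neg_right x y _ _ h => rw [mul_neg, AddChar.map_neg_eq_inv, h, inv_one]

/-- `𝒪` is its own annihilator with respect to the pairing `(x, y) ↦ χ (x y)`. -/
lemma Choices.exists_χ_mul_ne_one (S : Choices K p c) {x : K} (hx : x ∉ 𝒪[K]) :
    ∃ y ∈ 𝒪[K], S.χ (x * y) ≠ 1 := by
  obtain ⟨z, hz, h⟩ := S.χ_nontrivial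
  have hx0 : x ≠ 0 := fun h => hx (h ▸ zero_mem _)
  refine ⟨x⁻¹ * ((S.π : K)⁻¹ * z), ?_, by rwa [mul_inv_cancel_left₀ hx0]⟩
  rw [← mul_assoc]
  refine mul_mem (s := 𝒪[K]) ?_ hz
  have h1 : x⁻¹ ∈ 𝒪[K] := by
    change valuation K _ ≤ 1
    rw [map_inv₀]
    exact inv_le_one_of_one_le₀ (le_of_lt (lt_of_not_ge hx))
  rw [mul_comm]
  refine (S.residue_eq_zero_iff ⟨x⁻¹, h1⟩).1 ?_
  by_contra hne
  rw [← ne_eq, IsLocalRing.residue_ne_zero_iff_isUnit] at hne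
  obtain ⟨y, hy⟩ := hne.exists_right_inv
  refine hx ?_
  have : x = y := by
    have := congrArg Subtype.val hy
    simp only [MulMemClass.coe_mul, OneMemClass.coe_one] at this
    field_simp at this
    exact this.symm
  rw [this]
  exact y.2

/-! ### Balls -/

/-- The ball `𝔭ⁿ 𝒪`. -/
def Choices.ball (S : Choices K p c) (n : ℤ) : AddSubgroup K where
  carrier := {x | (S.π : K) ^ (-n) * x ∈ 𝒪[K]}
  zero_mem' := by simp [zero_mem]
  add_mem' {a b} ha hb := by
    simp only [Set.mem_ofPred_eq, mul_add] at *
    exact add_mem ha hb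
  neg_mem' {a} ha := by
    simp only [Set.mem_ofPred_eq, mul_neg] at *
    exact neg_mem ha

lemma Choices.mem_ball (S : Choices K p c) {n : ℤ} {x : K} :
    x ∈ S.ball n ↔ (S.π : K) ^ (-n) * x ∈ 𝒪[K] := Iff.rfl

lemma Choices.mem_ball_zero (S : Choices K p c) {x : K} : x ∈ S.ball 0 ↔ x ∈ 𝒪[K] := by
  simp [mem_ball]

lemma Choices.zpow_mul_mem_ball (S : Choices K p c) {n j : ℤ} {x : K} :
    (S.π : K) ^ j * x ∈ S.ball n ↔ x ∈ S.ball (n - j) := by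
  rw [mem_ball, mem_ball, ← mul_assoc, ← zpow_add₀ S.π_ne_zero]
  ring_nf

lemma Choices.ball_anti (S : Choices K p c) : Antitone S.ball := by
  intro m n h x hx
  obtain ⟨k, rfl⟩ := Int.le.dest h
  rw [mem_ball] at *
  have : (S.π : K) ^ (-m) * x = (S.π : K) ^ k * ((S.π : K) ^ (-(m + k)) * x) := by
    rw [← mul_assoc, ← zpow_natCast, ← zpow_add₀ S.π_ne_zero]
    ring_nf
  rw [this]
  exact mul_mem (pow_mem S.π.2 k) hx

lemma isOpen_integers : IsOpen (𝒪[K] : Set K) := Valuation.isOpen_integer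

lemma Choices.isOpen_ball (S : Choices K p c) (n : ℤ) : IsOpen (S.ball n : Set K) :=
  isOpen_integers.preimage (continuous_const.mul continuous_id)

lemma Choices.exists_ball_subset (S : Choices K p c) {U : Set K} (hU : U ∈ nhds (0 : K)) :
    ∃ n : ℕ, (S.ball n : Set K) ⊆ U := by
  obtain ⟨γ, hγ, h⟩ := (IsValuativeTopology.hasBasis_nhds_zero' K).mem_iff.1 hU
  obtain ⟨n, hn⟩ := exists_pow_lt₀ S.valuation_lt_one (Units.mk0 γ hγ)
  refine ⟨n, fun x hx => h ?_⟩
  have hx' : (S.π : K) ^ (-(n : ℤ)) * x ∈ 𝒪[K] := hx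
  have : x = (S.π : K) ^ n * ((S.π : K) ^ (-(n : ℤ)) * x) := by
    rw [← mul_assoc, ← zpow_natCast, ← zpow_add₀ S.π_ne_zero]
    simp
  change valuation K x < γ
  rw [this, map_mul, map_pow]
  exact (mul_le_mul_right (show valuation K _ ≤ 1 from hx') _).trans_lt (by simpa using hn)

/-- The ball `𝔭ⁿ(u k + 𝒪)`. For fixed `n` these balls are a partition of `K`; those with `n ≥ 0`
form a countable basis of the topology. -/
def Choices.cell (S : Choices K p c) (n : ℤ) (k : ℕ) : Set K :=
  {x | (S.π : K) ^ (-n) * x - S.u k ∈ 𝒪[K]}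

lemma Choices.mem_cell (S : Choices K p c) {n : ℤ} {k : ℕ} {x : K} :
    x ∈ S.cell n k ↔ (S.π : K) ^ (-n) * x - S.u k ∈ 𝒪[K] := Iff.rfl

lemma Choices.mem_cell_iff_sub (S : Choices K p c) {n : ℤ} {k : ℕ} {x : K} :
    x ∈ S.cell n k ↔ x - (S.π : K) ^ n * S.u k ∈ S.ball n := by
  rw [mem_cell, mem_ball, mul_sub, ← mul_assoc, ← zpow_add₀ S.π_ne_zero]
  simp

lemma Choices.isOpen_cell (S : Choices K p c) (n : ℤ) (k : ℕ) : IsOpen (S.cell n k) :=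
  isOpen_integers.preimage ((continuous_const.mul continuous_id).sub continuous_const)

lemma Choices.mem_cell_idx (S : Choices K p c) (n : ℤ) (x : K) :
    x ∈ S.cell n (S.idx ((S.π : K) ^ (-n) * x)) := S.sub_u_idx_mem _

lemma Choices.mem_cell_iff (S : Choices K p c) {n : ℤ} {k : ℕ} {x : K} :
    x ∈ S.cell n k ↔ S.idx ((S.π : K) ^ (-n) * x) = k := S.idx_eq_iff.symm

lemma Choices.pairwise_disjoint_cell (S : Choices K p c) (n : ℤ) :
    Pairwise (Function.onFun Disjoint (S.cell n)) := by
  intro k l hkl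
  rw [Function.onFun, Set.disjoint_left]
  intro x hk hl
  rw [S.mem_cell_iff] at hk hl
  exact hkl (hk.symm.trans hl)

lemma Choices.iUnion_cell (S : Choices K p c) (n : ℤ) : ⋃ k, S.cell n k = Set.univ :=
  Set.eq_univ_of_forall fun x => Set.mem_iUnion.2 ⟨_, S.mem_cell_idx n x⟩

lemma Choices.cell_subset (S : Choices K p c) {m n : ℤ} (h : m ≤ n) {k l : ℕ} {x : K}
    (hx : x ∈ S.cell n k) (hx' : x ∈ S.cell m l) : S.cell n k ⊆ S.cell m l := by
  intro y hy
  rw [S.mem_cell_iff_sub] at *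
  have := S.ball_anti h (sub_mem hy hx)
  simpa using add_mem this hx'

lemma Choices.isTopologicalBasis_cell (S : Choices K p c) :
    TopologicalSpace.IsTopologicalBasis {s | ∃ (n k : ℕ), s = S.cell n k} := by
  refine TopologicalSpace.isTopologicalBasis_of_isOpen_of_nhds ?_ ?_
  · rintro _ ⟨n, k, rfl⟩
    exact S.isOpen_cell n k
  · intro a U ha hU
    have : (fun x => a + x) ⁻¹' U ∈ nhds (0 : K) :=
      (hU.preimage (continuous_const.add continuous_id)).mem_nhds (by simpa using ha)
    obtain ⟨n, hn⟩ := S.exists_ball_subset this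
    refine ⟨_, ⟨n, _, rfl⟩, S.mem_cell_idx n a, fun x hx => ?_⟩
    have h1 := sub_mem (S.mem_cell_iff_sub.1 hx) (S.mem_cell_iff_sub.1 (S.mem_cell_idx n a))
    simpa using hn h1

lemma Choices.secondCountable (S : Choices K p c) : SecondCountableTopology K := by
  refine S.isTopologicalBasis_cell.secondCountableTopology ?_
  have : {s | ∃ (n k : ℕ), s = S.cell n k} =
      Set.range (fun x : ℕ × ℕ => S.cell x.1 x.2) := by
    ext s
    simp [eq_comm]
  rw [this]
  exact Set.countable_range _

lemma Choices.add_u_mem_cell (S : Choices K p c) (k : ℕ) (x : K) :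
    x + S.u k ∈ S.cell 0 k ↔ x ∈ 𝒪[K] := by simp [S.mem_cell]

lemma Choices.cell_zero_zero (S : Choices K p c) : S.cell 0 0 = (𝒪[K] : Set K) := by
  ext x; simp [S.mem_cell]

/-- The ball `𝔭⁻¹𝒪` is the union of `q` translates of `𝒪`. -/
lemma Choices.cell_neg_one (S : Choices K p c) :
    S.cell (-1) 0 = ⋃ d : Fin (resCard K), S.cell 0 (d : ℕ) := by
  ext x
  have hx := S.mem_cell_idx 0 x
  simp only [Set.mem_iUnion]
  constructor
  · intro h
    refine ⟨⟨S.idx x, ?_⟩, by simpa using hx⟩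
    rw [S.mem_cell, S.u_zero, sub_zero, neg_neg, zpow_one] at h
    have h1 := S.u_add_mul (Nat.mod_lt (S.idx x) resCard_pos) (S.idx x / resCard K)
    rw [Nat.mod_add_div, S.uDigit_eq] at h1
    have h2 : S.u 0 - S.u (S.idx x / resCard K) ∈ 𝒪[K] := by
      have h3 := sub_mem (add_mem (S.π_mul_mem (S.sub_u_idx_mem x))
        (S.digit (S.idx x % resCard K)).2) h
      convert h3 using 1
      rw [h1, S.u_zero]
      have := S.π_ne_zero
      field_simp
      ring
    have h3 := (S.u_eq_of_sub_mem _ _ h2).symm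
    exact (Nat.div_eq_zero_iff_lt resCard_pos).1 h3
  · rintro ⟨d, hd⟩
    rw [S.mem_cell] at hd ⊢
    have h1 := add_mem (S.π_mul_mem hd) (S.digit (d : ℕ)).2
    convert h1 using 1
    rw [S.u_digit d.2, S.uDigit_eq]
    have := S.π_ne_zero
    simp
    field_simp
    ring

lemma resCard_cast_ne_zero : (resCard K : ℝ≥0∞) ≠ 0 := by simpa using (resCard_pos (K := K)).ne'

end Arithmetic

/-! ### Haar measure -/

section Measure

variable {K : Type*} [Field K] [ValuativeRel K] [TopologicalSpace K]
  [IsNonarchimedeanLocalField K] [MeasurableSpace K] [BorelSpace K] {p c : ℕ}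

lemma measurableSet_integers : MeasurableSet (𝒪[K] : Set K) := isOpen_integers.measurableSet

lemma Choices.measurableSet_cell (S : Choices K p c) (n : ℤ) (k : ℕ) :
    MeasurableSet (S.cell n k) := (S.isOpen_cell n k).measurableSet

variable (μ : Measure K) [μ.IsAddHaarMeasure]

lemma Choices.setLIntegral_cell (S : Choices K p c) (k : ℕ) (f : K → ℝ≥0∞) :
    ∫⁻ x in S.cell 0 k, f x ∂μ = ∫⁻ x in (𝒪[K] : Set K), f (x + S.u k) ∂μ := by
  rw [← lintegral_indicator (S.measurableSet_cell 0 k), ← lintegral_indicator measurableSet_integers,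
    ← lintegral_add_right_eq_self _ (S.u k)]
  refine lintegral_congr fun x => ?_
  classical exact if_congr (S.add_u_mem_cell k x) rfl rfl

lemma Choices.setIntegral_cell (S : Choices K p c) (k : ℕ) (f : K → ℂ) :
    ∫ x in S.cell 0 k, f x ∂μ = ∫ x in (𝒪[K] : Set K), f (x + S.u k) ∂μ := by
  rw [← integral_indicator (S.measurableSet_cell 0 k), ← integral_indicator measurableSet_integers,
    ← integral_add_right_eq_self _ (S.u k)]
  refine integral_congr_ae (Filter.Eventually.of_forall fun x => ?_)
  classical exact if_congr (S.add_u_mem_cell k x) rfl rfl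

lemma Choices.lintegral_eq_tsum (S : Choices K p c) (f : K → ℝ≥0∞) :
    ∫⁻ x, f x ∂μ = ∑' k, ∫⁻ x in (𝒪[K] : Set K), f (x + S.u k) ∂μ := by
  simp_rw [← S.setLIntegral_cell μ]
  rw [← lintegral_iUnion (S.measurableSet_cell 0) (S.pairwise_disjoint_cell 0), S.iUnion_cell,
    Measure.restrict_univ]

lemma Choices.ae_add_u (S : Choices K p c) {P : K → Prop} (h : ∀ᵐ x ∂μ, P x) :
    ∀ᵐ x ∂μ, ∀ k, P (x + S.u k) :=
  ae_all_iff.2 fun k => (measurePreserving_add_right μ (S.u k)).quasiMeasurePreserving.ae h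

omit [BorelSpace K] [μ.IsAddHaarMeasure] in
lemma Choices.ae_of_ae_cell (S : Choices K p c) {P : K → Prop}
    (h : ∀ k, ∀ᵐ x ∂μ.restrict (S.cell 0 k), P x) : ∀ᵐ x ∂μ, P x := by
  rw [← Measure.restrict_univ (μ := μ), ← S.iUnion_cell 0, ae_restrict_iUnion_iff]
  exact h

lemma Choices.ae_cell_iff (S : Choices K p c) {P : K → Prop} (k : ℕ) :
    (∀ᵐ x ∂μ.restrict (S.cell 0 k), P x) ↔
      ∀ᵐ x ∂μ.restrict (𝒪[K] : Set K), P (x + S.u k) := by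
  rw [ae_restrict_iff' (S.measurableSet_cell 0 k), ae_restrict_iff' measurableSet_integers]
  constructor
  · intro h
    filter_upwards [S.ae_add_u μ h] with x hx hx'
    exact hx k ((S.add_u_mem_cell k x).2 hx')
  · intro h
    filter_upwards [(measurePreserving_add_right μ (-S.u k)).quasiMeasurePreserving.ae h]
      with x hx hx'
    have h1 : x + -S.u k ∈ 𝒪[K] := by simpa [S.mem_cell, sub_eq_add_neg] using hx'
    simpa using hx h1

lemma Choices.lintegral_eq_setLIntegral_tsum (S : Choices K p c) {f : K → ℝ≥0∞}
    (hf : Measurable f) :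
    ∫⁻ x, f x ∂μ = ∫⁻ x in (𝒪[K] : Set K), ∑' k, f (x + S.u k) ∂μ := by
  rw [S.lintegral_eq_tsum μ, lintegral_tsum]
  exact fun k => (hf.comp (measurable_id.add_const _)).aemeasurable

variable {μ} in
lemma Choices.integrableOn_add_u (S : Choices K p c) {f : K → ℂ} (hf : Integrable f μ) (k : ℕ) :
    IntegrableOn (fun x => f (x + S.u k)) (𝒪[K] : Set K) μ :=
  (hf.comp_add_right (S.u k)).integrableOn

variable {μ} in
lemma Choices.tsum_lintegral_enorm_ne_top (S : Choices K p c) {f : K → ℂ} (hf : Integrable f μ) :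
    ∑' k, ∫⁻ x in (𝒪[K] : Set K), ‖f (x + S.u k)‖ₑ ∂μ ≠ ∞ := by
  rw [← S.lintegral_eq_tsum μ (fun x => ‖f x‖ₑ)]
  exact hf.2.ne

variable {μ} in
/-- Periodization of an integrable function. -/
lemma Choices.integral_eq_setIntegral_tsum (S : Choices K p c) {f : K → ℂ}
    (hf : Integrable f μ) :
    ∫ x, f x ∂μ = ∫ x in (𝒪[K] : Set K), ∑' k, f (x + S.u k) ∂μ := by
  rw [integral_tsum (fun k => (S.integrableOn_add_u hf k).1) (S.tsum_lintegral_enorm_ne_top hf)]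
  simp_rw [← S.setIntegral_cell μ]
  rw [← setIntegral_univ, ← S.iUnion_cell 0]
  exact (hasSum_integral_iUnion (S.measurableSet_cell 0) (S.pairwise_disjoint_cell 0)
    hf.integrableOn).tsum_eq.symm

variable {μ} in
lemma Choices.ae_summable_add_u (S : Choices K p c) {f : K → ℂ} (hf : Integrable f μ) :
    ∀ᵐ x ∂μ.restrict (𝒪[K] : Set K), Summable fun k => f (x + S.u k) := by
  have h := S.tsum_lintegral_enorm_ne_top hf
  have hm : ∀ k, AEMeasurable (fun x => ‖f (x + S.u k)‖ₑ) (μ.restrict (𝒪[K] : Set K)) :=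
    fun k => (S.integrableOn_add_u hf k).1.enorm
  rw [← lintegral_tsum hm] at h
  filter_upwards [ae_lt_top' (AEMeasurable.tsum hm) h] with x hx
  refine Summable.of_norm ?_
  simpa [enorm_eq_nnnorm, ENNReal.tsum_coe_ne_top_iff_summable, ← NNReal.summable_coe]
    using hx.ne

variable {μ} in
lemma Choices.integrableOn_tsum (S : Choices K p c) {f : K → ℂ} (hf : Integrable f μ) :
    IntegrableOn (fun x => ∑' k, f (x + S.u k)) (𝒪[K] : Set K) μ := by
  have hm : ∀ k, AEStronglyMeasurable (fun x => f (x + S.u k)) (μ.restrict (𝒪[K] : Set K)) :=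
    fun k => (S.integrableOn_add_u hf k).1
  refine ⟨?_, ?_⟩
  · have : AEStronglyMeasurable (fun x => ∑' k, f (x + S.u k)) (μ.restrict (𝒪[K] : Set K)) :=
      aestronglyMeasurable_of_tendsto_ae Filter.atTop
        (f := fun n x => ∑ k ∈ Finset.range n, f (x + S.u k))
        (fun n => Finset.aestronglyMeasurable_fun_sum _ fun k _ => hm k)
        (by
          filter_upwards [S.ae_summable_add_u hf] with x hx
          exact hx.hasSum.tendsto_sum_nat)
    exact this
  · refine lt_of_le_of_lt ?_ (S.tsum_lintegral_enorm_ne_top hf).lt_top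
    rw [← lintegral_tsum fun k => (hm k).enorm]
    exact lintegral_mono fun x => enorm_tsum_le_tsum_enorm

lemma Choices.measure_cell_zero (S : Choices K p c) (hμ : μ (𝒪[K] : Set K) = 1) (k : ℕ) :
    μ (S.cell 0 k) = 1 := by
  have := S.setLIntegral_cell μ k (fun _ => 1)
  simpa [hμ] using this

variable [μ.Regular]

/-- Multiplication by `𝔭` scales the Haar integral by `q`: the scaling factor is the measure of
`𝔭⁻¹𝒪`. -/
lemma Choices.lintegral_π_mul (S : Choices K p c) (hμ : μ (𝒪[K] : Set K) = 1) (f : K → ℝ≥0∞) :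
    ∫⁻ x, f (S.π * x) ∂μ = resCard K * ∫⁻ x, f x ∂μ := by
  let e := mulEquiv (S.π : K) S.π_ne_zero
  have : (μ.map e).IsAddHaarMeasure := e.isAddHaarMeasure_map μ
  have : (μ.map e).Regular := Measure.Regular.map e.toHomeomorph
  have h := Measure.isAddLeftInvariant_eq_smul_of_regular (μ.map e) μ
  set C := Measure.addHaarScalarFactor (μ.map e) μ
  have key : ∀ f : K → ℝ≥0∞, ∫⁻ x, f (S.π * x) ∂μ = C * ∫⁻ x, f x ∂μ := by
    intro f
    have h1 := lintegral_map_equiv (μ := μ) f e.toHomeomorph.toMeasurableEquiv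
    have h2 : μ.map e.toHomeomorph.toMeasurableEquiv = μ.map e := rfl
    rw [h2, h] at h1
    rw [lintegral_smul_measure] at h1
    exact h1.symm
  have hC : (C : ℝ≥0∞) = resCard K := by
    have h1 := key ((𝒪[K] : Set K).indicator 1)
    rw [lintegral_indicator_one measurableSet_integers, hμ, mul_one] at h1
    rw [← h1]
    have h2 : (fun x => (𝒪[K] : Set K).indicator (1 : K → ℝ≥0∞) (S.π * x)) =
        (S.cell (-1) 0).indicator 1 := by
      ext x
      classical exact if_congr (by simp [S.mem_cell]) rfl rfl
    rw [h2, lintegral_indicator_one (S.measurableSet_cell _ _), S.cell_neg_one,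
      measure_iUnion]
    · simp [S.measure_cell_zero μ hμ]
    · intro i j hij
      exact S.pairwise_disjoint_cell 0 (fun h => hij (Fin.ext h))
    · exact fun i => S.measurableSet_cell _ _
  rw [key, hC]

/-- Multiplication by `𝔭ʲ` scales the Haar integral by `qʲ`. -/
lemma Choices.lintegral_zpow_mul (S : Choices K p c) (hμ : μ (𝒪[K] : Set K) = 1) (j : ℤ)
    (f : K → ℝ≥0∞) :
    ∫⁻ x, f ((S.π : K) ^ j * x) ∂μ = (resCard K : ℝ≥0∞) ^ j * ∫⁻ x, f x ∂μ := by
  have hq := resCard_cast_ne_zero (K := K)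
  have hq' : (resCard K : ℝ≥0∞) ≠ ∞ := ENNReal.natCast_ne_top _
  have nat : ∀ (n : ℕ) (f : K → ℝ≥0∞),
      ∫⁻ x, f ((S.π : K) ^ n * x) ∂μ = (resCard K : ℝ≥0∞) ^ n * ∫⁻ x, f x ∂μ := by
    intro n
    induction n with
    | zero => simp
    | succ n ih =>
      intro f
      have := S.lintegral_π_mul μ hμ (fun x => f ((S.π : K) ^ n * x))
      rw [pow_succ' (resCard K : ℝ≥0∞), mul_assoc, ← ih, ← this]
      simp only [pow_succ, mul_assoc]
  obtain ⟨n, rfl | rfl⟩ := j.eq_nat_or_neg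
  · simpa using nat n f
  · have h := nat n (fun x => f ((S.π : K) ^ (-(n : ℤ)) * x))
    simp only [← mul_assoc, ← zpow_natCast, ← zpow_add₀ S.π_ne_zero] at h
    simp only [neg_add_cancel, zpow_zero, one_mul] at h
    rw [h, ← mul_assoc, ← ENNReal.zpow_add hq hq']
    simp

lemma Choices.map_zpow_mul (S : Choices K p c) (hμ : μ (𝒪[K] : Set K) = 1) (j : ℤ) :
    μ.map (mulEquiv ((S.π : K) ^ j) (zpow_ne_zero j S.π_ne_zero)).toHomeomorph.toMeasurableEquiv =
      (resCard K : ℝ≥0∞) ^ j • μ := by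
  ext s hs
  rw [← lintegral_indicator_one hs, lintegral_map_equiv, Measure.smul_apply,
    ← lintegral_indicator_one hs, smul_eq_mul, ← S.lintegral_zpow_mul μ hμ]
  rfl

lemma Choices.integral_zpow_mul (S : Choices K p c) (hμ : μ (𝒪[K] : Set K) = 1) (j : ℤ)
    (f : K → ℂ) :
    ∫ x, f ((S.π : K) ^ j * x) ∂μ = (resCard K : ℂ) ^ j * ∫ x, f x ∂μ := by
  have h := integral_map_equiv (μ := μ)
    (mulEquiv ((S.π : K) ^ j) (zpow_ne_zero j S.π_ne_zero)).toHomeomorph.toMeasurableEquiv f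
  rw [S.map_zpow_mul μ hμ, integral_smul_measure] at h
  refine h.symm.trans ?_
  have : ((resCard K : ℝ≥0∞) ^ j).toReal = (resCard K : ℝ) ^ j := by
    obtain ⟨n, rfl | rfl⟩ := j.eq_nat_or_neg
    · simp
    · simp [ENNReal.zpow_neg]
  rw [this, Complex.real_smul]
  simp

lemma Choices.measure_cell (S : Choices K p c) (hμ : μ (𝒪[K] : Set K) = 1) (n : ℤ) (k : ℕ) :
    μ (S.cell n k) = (resCard K : ℝ≥0∞) ^ (-n) := by
  have h := S.lintegral_zpow_mul μ hμ (-n) ((S.cell 0 k).indicator 1)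
  rw [lintegral_indicator_one (S.measurableSet_cell _ _), S.measure_cell_zero μ hμ, mul_one] at h
  rw [← h, ← lintegral_indicator_one (S.measurableSet_cell _ _)]
  classical exact lintegral_congr fun x => if_congr (by simp [S.mem_cell]) rfl rfl

end Measure

/-! ### Characters of the ring of integers -/

section Characters

variable {K : Type*} [Field K] [ValuativeRel K] [TopologicalSpace K]
  [IsNonarchimedeanLocalField K] {p c : ℕ} [Fact p.Prime] [CharP K p]

omit [Fact p.Prime] [CharP K p] in
lemma Choices.u_mem_ball_iff (S : Choices K p c) (n : ℕ) :
    ∀ m, S.u m ∈ S.ball (-n) ↔ m < resCard K ^ n := by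
  induction n with
  | zero =>
    intro m
    have h := S.u_eq_of_sub_mem m 0
    simp only [S.u_zero, sub_zero] at h
    simp only [Nat.cast_zero, neg_zero, S.mem_ball_zero, pow_zero, Nat.lt_one_iff]
    exact ⟨h, fun h => by simp [h, zero_mem]⟩
  | succ n ih =>
    intro m
    have h1 := S.u_add_mul (Nat.mod_lt m resCard_pos) (m / resCard K)
    rw [Nat.mod_add_div, S.uDigit_eq, ← mul_add] at h1
    have h2 : (S.digit (m % resCard K) : K) ∈ S.ball (-n) :=
      S.ball_anti (show (-n : ℤ) ≤ 0 by omega) (S.mem_ball_zero.2 (S.digit _).2)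
    rw [pow_succ, ← Nat.div_lt_iff_lt_mul resCard_pos, ← ih, h1, ← zpow_neg_one,
      S.zpow_mul_mem_ball]
    have : (-((n + 1 : ℕ) : ℤ) - -1) = -n := by push_cast; ring
    rw [this]
    exact ⟨fun h => by simpa using sub_mem h h2, fun h => add_mem h2 h⟩

/-- Orthogonality relations for the finite group `{u m | m < qⁿ} ≅ 𝔭⁻ⁿ𝒪 / 𝒪`. -/
lemma Choices.sum_χ (S : Choices K p c) (n : ℕ) {y : K} (hy : y ∈ 𝒪[K]) [Decidable (y ∈ S.ball n)] :
    ∑ m ∈ Finset.range (resCard K ^ n), (S.χ (S.u m * y) : ℂ) =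
      if y ∈ S.ball n then (resCard K : ℂ) ^ n else 0 := by
  split_ifs with h
  · rw [Finset.sum_congr rfl (g := fun _ => (1 : ℂ))]
    · simp
    · intro m hm
      have h1 := (S.u_mem_ball_iff n m).2 (Finset.mem_range.1 hm)
      rw [S.χ_integer, Circle.coe_one]
      rw [S.mem_ball] at h h1
      convert mul_mem h h1 using 1
      rw [neg_neg, zpow_neg]
      have := zpow_ne_zero (n : ℤ) S.π_ne_zero
      field_simp
  · obtain ⟨w, hw, hne⟩ := S.exists_χ_mul_ne_one (x := (S.π : K) ^ (-(n : ℤ)) * y) h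
    set z := (S.π : K) ^ (-(n : ℤ)) * w with hz
    set r := S.idx z
    have hχ : S.χ (S.u r * y) ≠ 1 := by
      have h1 : (S.π : K) ^ (-(n : ℤ)) * y * w = S.u r * y + (z - S.u r) * y := by
        rw [hz]; ring
      rw [h1, AddChar.map_add_eq_mul, S.χ_integer _ (mul_mem (S.sub_u_idx_mem z) hy),
        mul_one] at hne
      exact hne
    have hr : S.u r ∈ S.ball (-n) := by
      have h1 : z ∈ S.ball (-n) := by
        rw [hz, S.zpow_mul_mem_ball]
        simpa [S.mem_ball] using hw
      have h2 : z - S.u r ∈ S.ball (-n) :=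
        S.ball_anti (show (-n : ℤ) ≤ 0 by omega) (S.mem_ball_zero.2 (S.sub_u_idx_mem z))
      simpa using sub_mem h1 h2
    have hsum : ∑ m ∈ Finset.range (resCard K ^ n), (S.χ (S.u m * y) : ℂ) =
        (S.χ (S.u r * y) : ℂ) * ∑ m ∈ Finset.range (resCard K ^ n), (S.χ (S.u m * y) : ℂ) := by
      rw [Finset.mul_sum]
      symm
      refine Finset.sum_equiv (S.addIdx r) (fun m => ?_) (fun m _ => ?_)
      · simp only [Finset.mem_range, ← S.u_mem_ball_iff, S.u_addIdx]
        exact ⟨fun h => add_mem h hr, fun h => by simpa using sub_mem h hr⟩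
      · rw [S.u_addIdx, add_mul, AddChar.map_add_eq_mul, Circle.coe_mul, mul_comm]
    have h3 : ((S.χ (S.u r * y) : ℂ) - 1) *
        ∑ m ∈ Finset.range (resCard K ^ n), (S.χ (S.u m * y) : ℂ) = 0 := by
      rw [sub_mul, ← hsum]; ring
    rcases mul_eq_zero.1 h3 with h4 | h4
    · exact absurd (Circle.ext (by simpa [sub_eq_zero] using h4)) hχ
    · exact h4

variable [MeasurableSpace K] [BorelSpace K]

omit [Fact p.Prime] [CharP K p] in
lemma Choices.measurable_χ (S : Choices K p c) (a : K) :
    Measurable fun x => (S.χ (a * x) : ℂ) :=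
  ((show Continuous ((↑) : Circle → ℂ) by fun_prop).comp
    (S.continuous_χ.comp (continuous_const.mul continuous_id))).measurable

variable {μ : Measure K} [μ.IsAddHaarMeasure]

omit [Fact p.Prime] [CharP K p] [μ.IsAddHaarMeasure] in
lemma Choices.integrable_χ_mul (S : Choices K p c) (a : K) {ν : Measure K} {h : K → ℂ}
    (hh : Integrable h ν) : Integrable (fun x => (S.χ (a * x) : ℂ) * h x) ν :=
  hh.bdd_mul (c := 1) (S.measurable_χ a).aestronglyMeasurable
      (Filter.Eventually.of_forall fun _ => (Circle.norm_coe _).le)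

omit [Fact p.Prime] [CharP K p] in
lemma Choices.setIntegral_χ (S : Choices K p c) (hμ : μ (𝒪[K] : Set K) = 1) (a : K)
    [Decidable (a ∈ 𝒪[K])] :
    ∫ x in (𝒪[K] : Set K), (S.χ (a * x) : ℂ) ∂μ = if a ∈ 𝒪[K] then 1 else 0 := by
  split_ifs with h
  · rw [setIntegral_congr_fun (g := fun _ => (1 : ℂ)) measurableSet_integers]
    · simp [measureReal_def, hμ]
    · intro x hx
      simp [S.χ_integer _ (mul_mem h hx)]
  · obtain ⟨y, hy, hne⟩ := S.exists_χ_mul_ne_one h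
    have h1 : ∫ x in (𝒪[K] : Set K), (S.χ (a * x) : ℂ) ∂μ =
        (S.χ (a * y) : ℂ) * ∫ x in (𝒪[K] : Set K), (S.χ (a * x) : ℂ) ∂μ := by
      rw [← integral_const_mul, ← integral_indicator measurableSet_integers,
        ← integral_indicator measurableSet_integers, ← integral_add_right_eq_self _ y]
      refine integral_congr_ae (Filter.Eventually.of_forall fun x => ?_)
      have : x + y ∈ (𝒪[K] : Set K) ↔ x ∈ (𝒪[K] : Set K) :=
        ⟨fun h => by simpa using sub_mem (H := 𝒪[K]) h hy, fun h => add_mem (s := 𝒪[K]) h hy⟩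
      by_cases hx : x ∈ (𝒪[K] : Set K)
      · simp only [Set.indicator_of_mem hx, Set.indicator_of_mem (this.2 hx)]
        rw [mul_add, AddChar.map_add_eq_mul, Circle.coe_mul, mul_comm]
      · simp only [Set.indicator_of_notMem hx, Set.indicator_of_notMem (mt this.1 hx)]
    have h3 : ((S.χ (a * y) : ℂ) - 1) * ∫ x in (𝒪[K] : Set K), (S.χ (a * x) : ℂ) ∂μ = 0 := by
      rw [sub_mul, ← h1]; ring
    rcases mul_eq_zero.1 h3 with h4 | h4
    · exact absurd (Circle.ext (by simpa [sub_eq_zero] using h4)) hne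
    · exact h4

omit [μ.IsAddHaarMeasure] in
/-- Uniqueness of Fourier coefficients on `𝒪`: the indicator function of a ball is a finite linear
combination of the characters `χ(u m ·)`, and the balls generate the Borel sets. -/
lemma Choices.ae_eq_zero_of_forall_setIntegral (S : Choices K p c) {h : K → ℂ}
    (hh : IntegrableOn h (𝒪[K] : Set K) μ)
    (h0 : ∀ m, ∫ x in (𝒪[K] : Set K), (S.χ (S.u m * x) : ℂ) * h x ∂μ = 0) :
    ∀ᵐ x ∂μ.restrict (𝒪[K] : Set K), h x = 0 := by
  classical
  have hcell : ∀ n k : ℕ, ∫ x in S.cell n k, h x ∂μ.restrict (𝒪[K] : Set K) = 0 := by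
    intro n k
    rw [Measure.restrict_restrict (S.measurableSet_cell _ _)]
    by_cases hne : (S.cell n k ∩ (𝒪[K] : Set K)).Nonempty
    · obtain ⟨a, ha, ha'⟩ := hne
      have hmem : ∀ x, x ∈ S.cell n k ↔ x - a ∈ S.ball n := by
        intro x
        rw [S.mem_cell_iff_sub] at ha ⊢
        exact ⟨fun hx => by simpa using sub_mem hx ha, fun hx => by simpa using add_mem hx ha⟩
      have h1 : ∫ x in (𝒪[K] : Set K), (∑ m ∈ Finset.range (resCard K ^ n),
          (S.χ (S.u m * (x - a)) : ℂ)) * h x ∂μ = 0 := by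
        simp only [Finset.sum_mul]
        rw [integral_finsetSum]
        · refine Finset.sum_eq_zero fun m _ => ?_
          have h2 : ∀ x, (S.χ (S.u m * (x - a)) : ℂ) * h x =
              (S.χ (-(S.u m * a)) : ℂ) * ((S.χ (S.u m * x) : ℂ) * h x) := by
            intro x
            rw [mul_sub, sub_eq_add_neg, AddChar.map_add_eq_mul, Circle.coe_mul]
            ring
          simp only [h2]
          rw [integral_const_mul, h0, mul_zero]
        · intro m _
          have : Measurable fun x => (S.χ (S.u m * (x - a)) : ℂ) :=
            (S.measurable_χ (S.u m)).comp (measurable_id.sub_const a)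
          exact hh.bdd_mul (c := 1) this.aestronglyMeasurable
            (Filter.Eventually.of_forall fun _ => (Circle.norm_coe _).le)
      rw [setIntegral_congr_fun (g := (S.cell n k).indicator
        (fun x => (resCard K : ℂ) ^ n * h x)) measurableSet_integers] at h1
      · rw [setIntegral_indicator (S.measurableSet_cell _ _), integral_const_mul] at h1
        rw [Set.inter_comm]
        exact (mul_eq_zero.1 h1).resolve_left
          (pow_ne_zero _ (Nat.cast_ne_zero.2 resCard_pos.ne'))
      · intro x hx
        simp only
        rw [S.sum_χ n (sub_mem (H := 𝒪[K]) hx ha'), Set.indicator_apply, hmem]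
        split_ifs <;> simp
    · rw [Set.not_nonempty_iff_eq_empty.1 hne]
      simp
  have := S.secondCountable
  refine Integrable.ae_eq_zero_of_forall_setIntegral_eq_zero hh ?_
  intro s hs _
  refine MeasurableSpace.induction_on_inter (m := ‹MeasurableSpace K›)
    (C := fun s _ => ∫ x in s, h x ∂μ.restrict (𝒪[K] : Set K) = 0)
    (s := {s | ∃ (n k : ℕ), s = S.cell n k})
    (BorelSpace.measurable_eq.trans S.isTopologicalBasis_cell.borel_eq_generateFrom)
    ?_ (by simp) ?_ ?_ ?_ s hs
  · rintro _ ⟨n, k, rfl⟩ _ ⟨m, l, rfl⟩ ⟨x, hx, hx'⟩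
    rcases le_total m n with hmn | hmn
    · exact ⟨n, k, Set.inter_eq_left.2 (S.cell_subset (by exact_mod_cast hmn) hx hx')⟩
    · exact ⟨m, l, Set.inter_eq_right.2 (S.cell_subset (by exact_mod_cast hmn) hx' hx)⟩
  · rintro _ ⟨n, k, rfl⟩
    exact hcell n k
  · intro t ht h1
    rw [setIntegral_compl ht hh, h1, sub_zero]
    simpa using h0 0
  · intro f hd hm h1
    exact (hasSum_integral_iUnion hm hd hh.integrableOn).unique (by simp [h1])

/-- Uniqueness of Fourier coefficients on a translate of `𝒪`. -/
lemma Choices.ae_eq_zero_of_forall_setIntegral_cell (S : Choices K p c) {h : K → ℂ} (k : ℕ)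
    (hh : IntegrableOn h (S.cell 0 k) μ)
    (h0 : ∀ m, ∫ x in S.cell 0 k, (S.χ (S.u m * x) : ℂ) * h x ∂μ = 0) :
    ∀ᵐ x ∂μ.restrict (S.cell 0 k), h x = 0 := by
  rw [S.ae_cell_iff μ]
  refine S.ae_eq_zero_of_forall_setIntegral ?_ fun m => ?_
  · refine ⟨?_, ?_⟩
    · have h1 : Integrable (fun x => (S.cell 0 k).indicator h (x + S.u k)) μ :=
        (hh.integrable_indicator (S.measurableSet_cell 0 k)).comp_add_right (S.u k)
      refine h1.integrableOn.1.congr ?_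
      filter_upwards [ae_restrict_mem measurableSet_integers] with x hx
      exact Set.indicator_of_mem ((S.add_u_mem_cell k x).2 hx) h
    · have := S.setLIntegral_cell μ k fun x => ‖h x‖ₑ
      rw [HasFiniteIntegral, ← this]
      exact hh.2
  · rw [← h0 m, S.setIntegral_cell μ]
    simp only [mul_add, AddChar.map_add_eq_mul, S.χ_u_mul_u, mul_one]

end Characters

/-! ### The Gabor basis and the Plancherel theorem -/

section Plancherel

lemma enorm_sq_eq_lintegral {α : Type*} [MeasurableSpace α] {ν : Measure α} (f : Lp ℂ 2 ν) :
    ‖f‖ₑ ^ 2 = ∫⁻ x, ‖f x‖ₑ ^ 2 ∂ν := by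
  have h := eLpNorm_nnreal_pow_eq_lintegral (f := f) (μ := ν) (p := 2) two_ne_zero
  rw [Lp.enorm_def]
  simpa using h

variable {K : Type*} [Field K] [ValuativeRel K] [TopologicalSpace K]
  [IsNonarchimedeanLocalField K] {p c : ℕ} [MeasurableSpace K] [BorelSpace K]
  {μ : Measure K}

/-- The function `χ(u k x) 1_{u l + 𝒪}(x)`. -/
def Choices.gaborFun (S : Choices K p c) (k l : ℕ) : K → ℂ :=
  (S.cell 0 l).indicator fun x => (S.χ (S.u k * x) : ℂ)

variable [μ.IsAddHaarMeasure]

lemma Choices.memLp_indicator_of_norm_le_one (S : Choices K p c) (hμ : μ (𝒪[K] : Set K) = 1) (l : ℕ)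
    {f : K → ℂ} (hf : AEStronglyMeasurable f μ) (h1 : ∀ x, ‖f x‖ ≤ 1) (r : ℝ≥0∞) :
    MemLp ((S.cell 0 l).indicator f) r μ := by
  refine (memLp_indicator_const r (S.measurableSet_cell 0 l) (1 : ℂ)
    (Or.inr (by simp [S.measure_cell_zero μ hμ]))).of_le
    (hf.indicator (S.measurableSet_cell 0 l)) (Filter.Eventually.of_forall fun x => ?_)
  by_cases hx : x ∈ S.cell 0 l
  · simpa [hx] using h1 x
  · simp [hx]

lemma Choices.memLp_gaborFun (S : Choices K p c) (hμ : μ (𝒪[K] : Set K) = 1) (k l : ℕ)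
    (r : ℝ≥0∞) : MemLp (S.gaborFun k l) r μ :=
  S.memLp_indicator_of_norm_le_one hμ l (S.measurable_χ _).aestronglyMeasurable
    (fun _ => (Circle.norm_coe _).le) r

/-- The Gabor system `χ(u k x) 1_{u l + 𝒪}(x)` in `L²(K)`. -/
def Choices.gabor (S : Choices K p c) (hμ : μ (𝒪[K] : Set K) = 1) (i : ℕ × ℕ) : Lp ℂ 2 μ :=
  (S.memLp_gaborFun hμ i.1 i.2 2).toLp _

lemma Choices.coeFn_gabor (S : Choices K p c) (hμ : μ (𝒪[K] : Set K) = 1) (i : ℕ × ℕ) :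
    S.gabor hμ i =ᵐ[μ] S.gaborFun i.1 i.2 := MemLp.coeFn_toLp _

omit [MeasurableSpace K] [BorelSpace K] in
lemma Choices.conj_χ (S : Choices K p c) (x : K) :
    (starRingEnd ℂ) (S.χ x : ℂ) = (S.χ (-x) : ℂ) := by
  rw [AddChar.map_neg_eq_inv, Circle.coe_inv_eq_conj]

lemma Choices.inner_gabor (S : Choices K p c) (hμ : μ (𝒪[K] : Set K) = 1) (i : ℕ × ℕ)
    (f : Lp ℂ 2 μ) :
    inner ℂ (S.gabor hμ i) f = ∫ x in S.cell 0 i.2, (S.χ (-(S.u i.1 * x)) : ℂ) * f x ∂μ := by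
  rw [L2.inner_def, ← integral_indicator (S.measurableSet_cell _ _)]
  refine integral_congr_ae ?_
  filter_upwards [S.coeFn_gabor hμ i] with x hx
  rw [hx, Choices.gaborFun, RCLike.inner_apply]
  by_cases hx : x ∈ S.cell 0 i.2
  · simp only [Set.indicator_of_mem hx, S.conj_χ]
    rw [mul_comm]
  · simp [hx]

lemma Choices.integrableOn_cell (S : Choices K p c) (hμ : μ (𝒪[K] : Set K) = 1) (l : ℕ)
    (f : Lp ℂ 2 μ) : IntegrableOn f (S.cell 0 l) μ := by
  have : IsFiniteMeasure (μ.restrict (S.cell 0 l)) :=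
    isFiniteMeasure_restrict.2 (by simp [S.measure_cell_zero μ hμ])
  exact (MemLp.mono_measure Measure.restrict_le_self (Lp.memLp f)).integrable (by norm_num)

lemma Choices.setIntegral_cell_χ (S : Choices K p c) (hμ : μ (𝒪[K] : Set K) = 1) (a : K) (l : ℕ)
    [Decidable (a ∈ 𝒪[K])] :
    ∫ x in S.cell 0 l, (S.χ (a * x) : ℂ) ∂μ = if a ∈ 𝒪[K] then (S.χ (a * S.u l) : ℂ) else 0 := by
  rw [S.setIntegral_cell μ]
  simp only [mul_add, AddChar.map_add_eq_mul, Circle.coe_mul]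
  rw [integral_mul_const, S.setIntegral_χ hμ]
  split_ifs <;> simp

variable [Fact p.Prime] [CharP K p]

omit [Fact p.Prime] [CharP K p] in
lemma Choices.orthonormal_gabor (S : Choices K p c) (hμ : μ (𝒪[K] : Set K) = 1) :
    Orthonormal ℂ (S.gabor hμ) := by
  classical
  rw [orthonormal_iff_ite]
  rintro ⟨k, l⟩ ⟨k', l'⟩
  rw [S.inner_gabor]
  have h1 : ∀ᵐ x ∂μ.restrict (S.cell 0 l), (S.χ (-(S.u k * x)) : ℂ) * S.gabor hμ (k', l') x =
      (if l = l' then (1 : ℂ) else 0) * (S.χ ((S.u k' - S.u k) * x) : ℂ) := by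
    filter_upwards [ae_restrict_of_ae (S.coeFn_gabor hμ (k', l')),
      ae_restrict_mem (S.measurableSet_cell 0 l)] with x hx hxl
    rw [hx, Choices.gaborFun]
    split_ifs with h
    · subst h
      rw [Set.indicator_of_mem hxl, one_mul, ← Circle.coe_mul, ← AddChar.map_add_eq_mul]
      congr 2
      ring
    · have : x ∉ S.cell 0 l' := Set.disjoint_left.1 (S.pairwise_disjoint_cell 0 h) hxl
      simp [this]
  rw [integral_congr_ae h1, integral_const_mul, S.setIntegral_cell_χ hμ]
  by_cases hk : k = k'
  · subst hk
    simp [zero_mem]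
  · have : S.u k' - S.u k ∉ 𝒪[K] := fun h => hk (S.u_eq_of_sub_mem _ _ h).symm
    simp [this, hk]

lemma Choices.span_gabor_orthogonal (S : Choices K p c) (hμ : μ (𝒪[K] : Set K) = 1) :
    (Submodule.span ℂ (Set.range (S.gabor hμ)))ᗮ = ⊥ := by
  rw [Submodule.eq_bot_iff]
  intro f hf
  have h0 : ∀ i, inner ℂ (S.gabor hμ i) f = 0 := fun i =>
    Submodule.inner_right_of_mem_orthogonal (Submodule.subset_span (Set.mem_range_self i)) hf
  rw [Lp.eq_zero_iff_ae_eq_zero]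
  refine S.ae_of_ae_cell μ fun l => ?_
  refine S.ae_eq_zero_of_forall_setIntegral_cell l (S.integrableOn_cell hμ l f) fun m => ?_
  have := h0 (S.negIdx m, l)
  rw [S.inner_gabor] at this
  simpa using this

/-- The Gabor system is a Hilbert basis of `L²(K)`. -/
def Choices.gaborBasis (S : Choices K p c) (hμ : μ (𝒪[K] : Set K) = 1) :
    HilbertBasis (ℕ × ℕ) ℂ (Lp ℂ 2 μ) :=
  HilbertBasis.mkOfOrthogonalEqBot (S.orthonormal_gabor hμ) (S.span_gabor_orthogonal hμ)

@[simp]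
lemma Choices.gaborBasis_apply (S : Choices K p c) (hμ : μ (𝒪[K] : Set K) = 1) (i : ℕ × ℕ) :
    S.gaborBasis hμ i = S.gabor hμ i := by
  simp [Choices.gaborBasis]

/-- The permutation of the Gabor basis which the Fourier transform induces:
`χ(u k x) 1_{u l + 𝒪}(x)` is mapped to `χ(-u l ξ) 1_{u k + 𝒪}(ξ)`. -/
def Choices.gaborPerm (S : Choices K p c) : ℕ × ℕ ≃ ℕ × ℕ :=
  (Equiv.prodComm ℕ ℕ).trans (Equiv.prodCongr S.negIdx (Equiv.refl ℕ))

/-- The Gabor basis in the order in which it arises as the Fourier transform of itself. -/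
def Choices.gaborBasis' (S : Choices K p c) (hμ : μ (𝒪[K] : Set K) = 1) :
    HilbertBasis (ℕ × ℕ) ℂ (Lp ℂ 2 μ) :=
  HilbertBasis.mkOfOrthogonalEqBot
    ((S.orthonormal_gabor hμ).comp _ S.gaborPerm.injective)
    (by rw [S.gaborPerm.surjective.range_comp, S.span_gabor_orthogonal hμ])

/-- The Fourier transform as a unitary operator on `L²(K)`. It is defined by its values on the Gabor
basis, whose elements it permutes; `Choices.fourierL2_eq` identifies it with
the closure of the Fourier integral. -/
def Choices.fourier (S : Choices K p c) (hμ : μ (𝒪[K] : Set K) = 1) : Lp ℂ 2 μ ≃ₗᵢ[ℂ] Lp ℂ 2 μ :=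
  (S.gaborBasis hμ).repr.trans (S.gaborBasis' hμ).repr.symm

lemma Choices.fourier_gabor (S : Choices K p c) (hμ : μ (𝒪[K] : Set K) = 1) (k l : ℕ) :
    S.fourier hμ (S.gabor hμ (k, l)) = S.gabor hμ (S.negIdx l, k) := by
  classical
  rw [← S.gaborBasis_apply, Choices.fourier, LinearIsometryEquiv.trans_apply,
    HilbertBasis.repr_self, HilbertBasis.repr_symm_single]
  simp [Choices.gaborBasis', Choices.gaborPerm]

omit [MeasurableSpace K] [BorelSpace K] [Fact p.Prime] [CharP K p] in
lemma Choices.continuous_mul_pair :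
    Continuous fun x : K × K => (LinearMap.mul K K x.1) x.2 := continuous_mul

lemma Choices.fourierIntegral_gaborFun (S : Choices K p c) (hμ : μ (𝒪[K] : Set K) = 1)
    (k l : ℕ) (ξ : K) :
    Fourier.fourierIntegral S.χ μ (S.gaborFun k l) ξ = S.gaborFun (S.negIdx l) k ξ := by
  classical
  rw [Fourier.fourierIntegral_def]
  have h1 : ∀ x, S.χ (-(x * ξ)) • S.gaborFun k l x =
      (S.cell 0 l).indicator (fun x => (S.χ ((S.u k - ξ) * x) : ℂ)) x := by
    intro x
    rw [Circle.smul_def, smul_eq_mul, Choices.gaborFun, ← Set.indicator_const_mul]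
    by_cases hx : x ∈ S.cell 0 l
    · simp only [Set.indicator_of_mem hx]
      rw [← Circle.coe_mul, ← AddChar.map_add_eq_mul]
      congr 2
      ring
    · simp [hx]
  simp only [h1]
  rw [integral_indicator (S.measurableSet_cell _ _), S.setIntegral_cell_χ hμ, Choices.gaborFun,
    Set.indicator_apply]
  have h2 : S.u k - ξ ∈ 𝒪[K] ↔ ξ ∈ S.cell 0 k := by
    rw [S.mem_cell, ← neg_mem_iff]
    simp
  rw [if_congr h2 rfl rfl]
  split_ifs
  · rw [sub_mul, sub_eq_add_neg, AddChar.map_add_eq_mul, S.χ_u_mul_u, one_mul, S.u_negIdx]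
    congr 2
    ring
  · rfl

/-- On `L¹ ∩ L²` the unitary operator `fourier` is given by the Fourier integral. -/
lemma Choices.fourier_ae_eq (S : Choices K p c) (hμ : μ (𝒪[K] : Set K) = 1) (f : Lp ℂ 2 μ)
    (hf : Integrable f μ) :
    S.fourier hμ f =ᵐ[μ] Fourier.fourierIntegral S.χ μ f := by
  have := S.secondCountable
  set G := Fourier.fourierIntegral S.χ μ f with hG
  have hGc : Continuous G :=
    VectorFourier.fourierIntegral_continuous S.continuous_χ Choices.continuous_mul_pair hf
  refine S.ae_of_ae_cell μ fun l => ?_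
  have hGi : IntegrableOn G (S.cell 0 l) μ := by
    refine Measure.integrableOn_of_bounded (M := ∫ v, ‖f v‖ ∂μ)
      (by simp [S.measure_cell_zero μ hμ]) hGc.aestronglyMeasurable ?_
    exact Filter.Eventually.of_forall fun x =>
      VectorFourier.norm_fourierIntegral_le_integral_norm _ _ _ _ _
  have hi := S.integrableOn_cell hμ l (S.fourier hμ f)
  suffices h : ∀ᵐ x ∂μ.restrict (S.cell 0 l), S.fourier hμ f x - G x = 0 by
    filter_upwards [h] with x hx
    exact sub_eq_zero.1 hx
  refine S.ae_eq_zero_of_forall_setIntegral_cell l (hi.sub hGi) fun m => ?_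
  simp only [mul_sub]
  rw [integral_sub (S.integrable_χ_mul _ hi) (S.integrable_χ_mul _ hGi), sub_eq_zero]
  have h1 : ∫ x in S.cell 0 l, (S.χ (S.u m * x) : ℂ) * S.fourier hμ f x ∂μ =
      inner ℂ (S.gabor hμ (l, m)) f := by
    rw [← (S.fourier hμ).inner_map_map, S.fourier_gabor, S.inner_gabor]
    simp
  have h2 : ∫ x in S.cell 0 l, (S.χ (S.u m * x) : ℂ) * G x ∂μ =
      ∫ x, G x • S.gaborFun m l x ∂μ := by
    rw [← integral_indicator (S.measurableSet_cell _ _)]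
    refine integral_congr_ae (Filter.Eventually.of_forall fun x => ?_)
    by_cases hx : x ∈ S.cell 0 l
    · simp [Choices.gaborFun, hx, mul_comm]
    · simp [Choices.gaborFun, hx]
  have h3 := VectorFourier.integral_fourierIntegral_smul_eq_flip (L := LinearMap.mul K K)
    S.continuous_χ Choices.continuous_mul_pair hf
    (memLp_one_iff_integrable.1 (S.memLp_gaborFun hμ m l 1))
  have h4 : (LinearMap.mul K K).flip = LinearMap.mul K K := by
    ext
    simp
  rw [h4] at h3
  rw [h1, h2, hG]
  refine Eq.trans ?_ h3.symm
  rw [S.inner_gabor, ← integral_indicator (S.measurableSet_cell _ _)]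
  refine integral_congr_ae (Filter.Eventually.of_forall fun x => ?_)
  have h5 := S.fourierIntegral_gaborFun hμ m l x
  rw [Fourier.fourierIntegral] at h5
  simp only [h5, smul_eq_mul]
  by_cases hx : x ∈ S.cell 0 m
  · simp [Choices.gaborFun, hx, mul_comm]
  · simp [Choices.gaborFun, hx]

lemma Choices.dense_integrable (S : Choices K p c) (hμ : μ (𝒪[K] : Set K) = 1) :
    Dense {f : Lp ℂ 2 μ | Integrable f μ} := by
  have h := (S.gaborBasis hμ).dense_span
  rw [← Submodule.dense_iff_topologicalClosure_eq_top] at h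
  refine h.mono fun f hf => ?_
  induction hf using Submodule.span_induction with
  | mem f hf =>
    obtain ⟨i, rfl⟩ := hf
    rw [S.gaborBasis_apply]
    exact (memLp_one_iff_integrable.1 (S.memLp_gaborFun hμ i.1 i.2 1)).congr
      (S.coeFn_gabor hμ i).symm
  | zero => exact (integrable_zero K ℂ μ).congr (Lp.coeFn_zero ℂ 2 μ).symm
  | add f g _ _ hf hg => exact (Integrable.add hf hg).congr (Lp.coeFn_add f g).symm
  | smul r f _ hf => exact (Integrable.smul r hf).congr (Lp.coeFn_smul r f).symm

/-- The integrable functions are dense and the graph of the unitary operator is closed, so it is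
the closure of the graph of the Fourier integral. -/
lemma Choices.isFourierL2_iff (S : Choices K p c) (hμ : μ (𝒪[K] : Set K) = 1) (f g : Lp ℂ 2 μ) :
    IsFourierL2 S μ f g ↔ g = S.fourier hμ f := by
  have hset : {F : Lp ℂ 2 μ × Lp ℂ 2 μ |
      Integrable F.1 μ ∧ F.2 =ᵐ[μ] Fourier.fourierIntegral S.χ μ F.1} =
      (fun f => (f, S.fourier hμ f)) '' {f : Lp ℂ 2 μ | Integrable f μ} := by
    ext ⟨f, g⟩
    simp only [Set.mem_ofPred_eq, Set.mem_image, Prod.mk.injEq]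
    constructor
    · rintro ⟨h1, h2⟩
      exact ⟨f, h1, rfl, Lp.ext ((S.fourier_ae_eq hμ f h1).trans h2.symm)⟩
    · rintro ⟨f', h1, rfl, rfl⟩
      exact ⟨h1, S.fourier_ae_eq hμ _ h1⟩
  have hc : Continuous fun f => (f, S.fourier hμ f) :=
    continuous_id.prodMk (S.fourier hμ).continuous
  rw [IsFourierL2, hset]
  constructor
  · intro h
    have hcl : IsClosed {F : Lp ℂ 2 μ × Lp ℂ 2 μ | F.2 = S.fourier hμ F.1} :=
      isClosed_eq continuous_snd ((S.fourier hμ).continuous.comp continuous_fst)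
    exact closure_minimal (by rintro _ ⟨f, -, rfl⟩; rfl) hcl h
  · rintro rfl
    exact image_closure_subset_closure_image hc ⟨f, S.dense_integrable hμ f, rfl⟩

lemma Choices.fourierL2_eq (S : Choices K p c) (hμ : μ (𝒪[K] : Set K) = 1) (f : Lp ℂ 2 μ) :
    fourierL2 S μ f = S.fourier hμ f := by
  rw [← S.isFourierL2_iff hμ]
  exact Classical.epsilon_spec (p := fun g => IsFourierL2 S μ f g)
    ⟨_, (S.isFourierL2_iff hμ f _).2 rfl⟩

end Plancherel

/-! ### Translations and dilations in the Fourier domain -/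

section Operators

lemma enorm_sq_eq_ofReal {E : Type*} [NormedAddCommGroup E] (x : E) :
    ‖x‖ₑ ^ 2 = ENNReal.ofReal (‖x‖ ^ 2) := by
  rw [ENNReal.ofReal_pow (norm_nonneg _), ofReal_norm]

lemma tsum_enorm_sq_of_hasSum {ι E F : Type*} [NormedAddCommGroup E] [NormedAddCommGroup F]
    {a : ι → E} {f : F} (h : HasSum (fun i => ‖a i‖ ^ 2) (‖f‖ ^ 2)) :
    ∑' i, ‖a i‖ₑ ^ 2 = ‖f‖ₑ ^ 2 := by
  simp only [enorm_sq_eq_ofReal]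
  rw [← ENNReal.ofReal_tsum_of_nonneg (fun i => by positivity) h.summable, h.tsum_eq]

lemma tsum_enorm_inner_sq {ι E : Type*} [NormedAddCommGroup E]
    [InnerProductSpace ℂ E] (b : HilbertBasis ι ℂ E) (f : E) :
    ∑' i, ‖inner ℂ (b i) f‖ₑ ^ 2 = ‖f‖ₑ ^ 2 := by
  refine tsum_enorm_sq_of_hasSum ?_
  have h := lp.hasSum_norm (p := 2) (by norm_num) (b.repr f)
  simpa [b.repr_apply_apply] using h

variable {K : Type*} [Field K] [ValuativeRel K] [TopologicalSpace K]
  [IsNonarchimedeanLocalField K] {p c : ℕ} [MeasurableSpace K] [BorelSpace K]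
  {μ : Measure K} [μ.IsAddHaarMeasure]

lemma coeFn_translation (S : Choices K p c) (k : ℕ) (f : Lp ℂ 2 μ) :
    translation S μ k f =ᵐ[μ] fun x => f (x - S.u k) :=
  Lp.coeFn_compMeasurePreserving f _

lemma coeFn_dilation [μ.Regular] (S : Choices K p c) (j : ℤ) (f : Lp ℂ 2 μ) :
    dilation S μ j f =ᵐ[μ]
      fun x => (((resCard K : ℝ) ^ ((j : ℝ) / 2) : ℝ) : ℂ) * f ((S.π : K) ^ (-j) * x) := by
  refine (Lp.coeFn_smul _ _).trans ?_
  filter_upwards [MemLp.coeFn_toLp (memLp_comp_mul μ (zpow_ne_zero (-j) S.π_ne_zero) (Lp.memLp f))]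
    with x hx
  simp only [Pi.smul_apply, hx, smul_eq_mul]

omit [MeasurableSpace K] [BorelSpace K] in
lemma ofReal_resCard_zpow (j : ℤ) :
    ENNReal.ofReal ((resCard K : ℝ) ^ j) = (resCard K : ℝ≥0∞) ^ j := by
  have hq : (0 : ℝ) < resCard K := Nat.cast_pos.2 resCard_pos
  obtain ⟨n, rfl | rfl⟩ := j.eq_nat_or_neg
  · rw [zpow_natCast, zpow_natCast, ENNReal.ofReal_pow hq.le, ENNReal.ofReal_natCast]
  · rw [zpow_neg, ENNReal.zpow_neg, zpow_natCast, zpow_natCast,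
      ENNReal.ofReal_inv_of_pos (pow_pos hq n), ENNReal.ofReal_pow hq.le, ENNReal.ofReal_natCast]

omit [MeasurableSpace K] [BorelSpace K] in
lemma resCard_zpow_ne_top (j : ℤ) : (resCard K : ℝ≥0∞) ^ j ≠ ∞ := by
  rw [← ofReal_resCard_zpow]
  exact ENNReal.ofReal_ne_top

omit [MeasurableSpace K] [BorelSpace K] in
lemma resCard_zpow_mul_zpow_neg (j : ℤ) :
    (resCard K : ℝ≥0∞) ^ j * (resCard K : ℝ≥0∞) ^ (-j) = 1 := by
  rw [← ENNReal.zpow_add resCard_cast_ne_zero (ENNReal.natCast_ne_top _)]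
  simp

omit [MeasurableSpace K] [BorelSpace K] in
lemma enorm_rpow_half_sq (j : ℤ) :
    ‖(((resCard K : ℝ) ^ ((j : ℝ) / 2) : ℝ) : ℂ)‖ₑ ^ 2 = (resCard K : ℝ≥0∞) ^ j := by
  have hq : (0 : ℝ) < resCard K := Nat.cast_pos.2 resCard_pos
  rw [← ofReal_norm, Complex.norm_real, Real.norm_of_nonneg (by positivity),
    ← ENNReal.ofReal_pow (by positivity), ← Real.rpow_natCast, ← Real.rpow_mul hq.le]
  have : (j : ℝ) / 2 * (2 : ℕ) = j := by push_cast; ring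
  rw [this, Real.rpow_intCast, ofReal_resCard_zpow]

omit [MeasurableSpace K] [BorelSpace K] in
lemma rpow_half_mul_zpow (j : ℤ) :
    (((resCard K : ℝ) ^ ((j : ℝ) / 2) : ℝ) : ℂ) * (resCard K : ℂ) ^ (-j) =
      (((resCard K : ℝ) ^ (((-j : ℤ) : ℝ) / 2) : ℝ) : ℂ) := by
  have hq : (0 : ℝ) < resCard K := Nat.cast_pos.2 resCard_pos
  have h : (resCard K : ℝ) ^ ((j : ℝ) / 2) * (resCard K : ℝ) ^ (-j) =
      (resCard K : ℝ) ^ (((-j : ℤ) : ℝ) / 2) := by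
    rw [← Real.rpow_intCast, ← Real.rpow_add hq]
    congr 1
    push_cast
    ring
  rw [← h]
  push_cast
  rfl

lemma norm_dilation [μ.Regular] (S : Choices K p c) (hμ : μ (𝒪[K] : Set K) = 1) (j : ℤ)
    (f : Lp ℂ 2 μ) : ‖dilation S μ j f‖ = ‖f‖ := by
  have h : ‖dilation S μ j f‖ₑ ^ 2 = ‖f‖ₑ ^ 2 := by
    rw [enorm_sq_eq_lintegral, enorm_sq_eq_lintegral]
    have h1 : ∀ᵐ x ∂μ, ‖dilation S μ j f x‖ₑ ^ 2 =
        (resCard K : ℝ≥0∞) ^ j * ‖f ((S.π : K) ^ (-j) * x)‖ₑ ^ 2 := by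
      filter_upwards [coeFn_dilation S j f] with x hx
      rw [hx, enorm_mul, mul_pow, enorm_rpow_half_sq]
    rw [lintegral_congr_ae h1, lintegral_const_mul' _ _ (resCard_zpow_ne_top j),
      S.lintegral_zpow_mul μ hμ (-j) (fun x => ‖f x‖ₑ ^ 2), ← mul_assoc,
      resCard_zpow_mul_zpow_neg, one_mul]
  have h2 := (ENNReal.pow_right_strictMono two_ne_zero).injective h
  simpa using congrArg ENNReal.toReal h2

lemma continuous_dilation [μ.Regular] (S : Choices K p c) (hμ : μ (𝒪[K] : Set K) = 1) (j : ℤ) :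
    Continuous (dilation S μ j) :=
  (LinearIsometry.mk (dilation S μ j) (norm_dilation S hμ j)).continuous

variable [Fact p.Prime] [CharP K p]

/-- The local Fourier coefficients of `f̂` are those of `f`, with the roles of frequency and position
exchanged. -/
lemma Choices.setIntegral_fourier (S : Choices K p c) (hμ : μ (𝒪[K] : Set K) = 1) (f : Lp ℂ 2 μ)
    (m l : ℕ) :
    ∫ x in S.cell 0 l, (S.χ (S.u m * x) : ℂ) * S.fourier hμ f x ∂μ =
      ∫ x in S.cell 0 m, (S.χ (-(S.u l * x)) : ℂ) * f x ∂μ := by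
  have h : inner ℂ (S.gabor hμ (S.negIdx m, l)) (S.fourier hμ f) =
      inner ℂ (S.gabor hμ (l, m)) f := by
    rw [← (S.fourier hμ).inner_map_map (S.gabor hμ (l, m)) f, S.fourier_gabor]
  rw [S.inner_gabor, S.inner_gabor] at h
  simpa using h

lemma Choices.fourier_translation (S : Choices K p c) (hμ : μ (𝒪[K] : Set K) = 1) (k : ℕ)
    (f : Lp ℂ 2 μ) :
    S.fourier hμ (translation S μ k f) =ᵐ[μ]
      fun ξ => (S.χ (-(S.u k * ξ)) : ℂ) * S.fourier hμ f ξ := by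
  refine S.ae_of_ae_cell μ fun l => ?_
  have hi := S.integrableOn_cell hμ l (S.fourier hμ f)
  have hi' := S.integrableOn_cell hμ l (S.fourier hμ (translation S μ k f))
  have hi2 : IntegrableOn (fun ξ => (S.χ (-(S.u k * ξ)) : ℂ) * S.fourier hμ f ξ)
      (S.cell 0 l) μ := by
    have := S.integrable_χ_mul (-S.u k) hi
    simp only [neg_mul] at this
    exact this
  suffices h : ∀ᵐ ξ ∂μ.restrict (S.cell 0 l), S.fourier hμ (translation S μ k f) ξ -
      (S.χ (-(S.u k * ξ)) : ℂ) * S.fourier hμ f ξ = 0 by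
    filter_upwards [h] with x hx
    exact sub_eq_zero.1 hx
  refine S.ae_eq_zero_of_forall_setIntegral_cell l (hi'.sub hi2) fun m => ?_
  simp only [mul_sub]
  rw [integral_sub (S.integrable_χ_mul _ hi') (S.integrable_χ_mul _ hi2), sub_eq_zero,
    S.setIntegral_fourier]
  set m' := S.addIdx (S.negIdx k) m with hm'
  have hu : S.u m' = S.u m - S.u k := by simp [hm', sub_eq_add_neg]
  have h1 : ∀ ξ, (S.χ (S.u m * ξ) : ℂ) * ((S.χ (-(S.u k * ξ)) : ℂ) * S.fourier hμ f ξ) =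
      (S.χ (S.u m' * ξ) : ℂ) * S.fourier hμ f ξ := by
    intro ξ
    rw [← mul_assoc, ← Circle.coe_mul, ← AddChar.map_add_eq_mul, hu]
    congr 3
    ring
  simp only [h1]
  rw [S.setIntegral_fourier, S.setIntegral_cell μ, S.setIntegral_cell μ]
  refine integral_congr_ae (ae_restrict_of_ae ?_)
  filter_upwards [S.ae_add_u μ (coeFn_translation S k f)] with x hx
  rw [hx m, hu, ← add_sub_assoc]
  congr 2
  have h2 : -(S.u l * (x + S.u m - S.u k)) = -(S.u l * (x + S.u m)) + S.u l * S.u k := by ring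
  rw [h2, AddChar.map_add_eq_mul, S.χ_u_mul_u, mul_one]

lemma Choices.fourier_dilation [μ.Regular] (S : Choices K p c) (hμ : μ (𝒪[K] : Set K) = 1) (j : ℤ)
    (f : Lp ℂ 2 μ) :
    S.fourier hμ (dilation S μ j f) = dilation S μ (-j) (S.fourier hμ f) := by
  refine congrFun (Continuous.ext_on (S.dense_integrable hμ)
    ((S.fourier hμ).continuous.comp (continuous_dilation S hμ j))
    ((continuous_dilation S hμ (-j)).comp (S.fourier hμ).continuous) fun f hf => ?_) f
  simp only [Function.comp_apply]
  have hf' : Integrable f μ := hf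
  have hi : Integrable (dilation S μ j f) μ := by
    refine Integrable.congr ?_ (coeFn_dilation S j f).symm
    refine Integrable.const_mul ?_ _
    have h := S.map_zpow_mul μ hμ (-j)
    have h2 : Integrable f ((resCard K : ℝ≥0∞) ^ (-j) • μ) :=
      hf'.smul_measure (resCard_zpow_ne_top (-j))
    rw [← h] at h2
    exact (integrable_map_equiv _ _).1 h2
  refine Lp.ext ?_
  have h1 : S.fourier hμ (dilation S μ j f) =ᵐ[μ]
      Fourier.fourierIntegral S.χ μ (dilation S μ j f) := S.fourier_ae_eq hμ _ hi
  have h2 := ae_comp_mul μ (zpow_ne_zero (-(-j)) S.π_ne_zero) (S.fourier_ae_eq hμ f hf')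
  filter_upwards [h1, h2, coeFn_dilation S (-j) (S.fourier hμ f)] with ξ h1 h2 h3
  rw [h1, h3, h2, Fourier.fourierIntegral_def, Fourier.fourierIntegral_def]
  have h4 : ∀ᵐ x ∂μ, S.χ (-(x * ξ)) • dilation S μ j f x =
      (((resCard K : ℝ) ^ ((j : ℝ) / 2) : ℝ) : ℂ) *
        (fun y => S.χ (-(y * ((S.π : K) ^ (-(-j)) * ξ))) • f y) ((S.π : K) ^ (-j) * x) := by
    filter_upwards [coeFn_dilation S j f] with x hx
    rw [hx]
    have h5 : (S.π : K) ^ (-j) * x * ((S.π : K) ^ (-(-j)) * ξ) = x * ξ := by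
      have : (S.π : K) ^ (-j) * x * ((S.π : K) ^ (-(-j)) * ξ) =
        ((S.π : K) ^ (-j) * (S.π : K) ^ (-(-j))) * (x * ξ) := by ring
      rw [this, ← zpow_add₀ S.π_ne_zero]
      simp
    simp only [h5, Circle.smul_def, smul_eq_mul]
    ring
  rw [integral_congr_ae h4, integral_const_mul]
  refine (congrArg (HMul.hMul _) (S.integral_zpow_mul μ hμ (-j)
    (fun y => S.χ (-(y * ((S.π : K) ^ (-(-j)) * ξ))) • f y))).trans ?_
  rw [← mul_assoc, rpow_half_mul_zpow]

/-- The Fourier transform of the element `D^j T_k ψ` of the affine system. -/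
lemma Choices.fourier_affine [μ.Regular] (S : Choices K p c) (hμ : μ (𝒪[K] : Set K) = 1) (j : ℤ)
    (k : ℕ) (ψ : Lp ℂ 2 μ) :
    S.fourier hμ (dilation S μ j (translation S μ k ψ)) =ᵐ[μ] fun ξ =>
      (((resCard K : ℝ) ^ (((-j : ℤ) : ℝ) / 2) : ℝ) : ℂ) *
        ((S.χ (-((S.π : K) ^ j * S.u k * ξ)) : ℂ) * S.fourier hμ ψ ((S.π : K) ^ j * ξ)) := by
  rw [S.fourier_dilation]
  filter_upwards [coeFn_dilation S (-j) (S.fourier hμ (translation S μ k ψ)),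
    ae_comp_mul μ (zpow_ne_zero (-(-j)) S.π_ne_zero) (S.fourier_translation hμ k ψ)] with ξ h1 h2
  rw [h1, h2, neg_neg]
  congr 4
  ring

/-! ### Parseval and Bessel relations for functions supported on a ball -/

/-- The functions `χ(u k ·)` are an orthonormal basis on each translate of `𝒪`. -/
lemma Choices.tsum_χ_cell_zero (S : Choices K p c) (hμ : μ (𝒪[K] : Set K) = 1) (l : ℕ)
    {h : K → ℂ} (hh : MemLp h 2 μ) (hs : ∀ x, x ∉ S.cell 0 l → h x = 0) :
    ∑' k, ‖∫ x, (S.χ (S.u k * x) : ℂ) * h x ∂μ‖ₑ ^ 2 = ∫⁻ x, ‖h x‖ₑ ^ 2 ∂μ := by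
  have h1 := tsum_enorm_inner_sq (S.gaborBasis hμ) (hh.toLp h)
  have hae := hh.coeFn_toLp
  have h2 : ∫⁻ x, ‖h x‖ₑ ^ 2 ∂μ = ‖hh.toLp h‖ₑ ^ 2 := by
    rw [enorm_sq_eq_lintegral]
    refine lintegral_congr_ae ?_
    filter_upwards [hae] with x hx
    rw [hx]
  rw [h2, ← h1, ENNReal.tsum_prod', ← Equiv.tsum_eq S.negIdx]
  refine tsum_congr fun k => ?_
  have h3 : ∀ l', inner ℂ (S.gaborBasis hμ (k, l')) (hh.toLp h) =
      ∫ x in S.cell 0 l', (S.χ (-(S.u k * x)) : ℂ) * h x ∂μ := by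
    intro l'
    rw [S.gaborBasis_apply, S.inner_gabor]
    refine integral_congr_ae (ae_restrict_of_ae ?_)
    filter_upwards [hae] with x hx
    rw [hx]
  rw [tsum_eq_single l]
  · rw [h3]
    congr 2
    rw [setIntegral_eq_integral_of_forall_compl_eq_zero]
    · simp
    · intro x hx
      rw [hs x hx, mul_zero]
  · intro l' hl'
    rw [h3, setIntegral_congr_fun (g := fun _ => 0) (S.measurableSet_cell _ _)]
    · simp
    · intro x hx
      simp only
      rw [hs x (Set.disjoint_left.1 (S.pairwise_disjoint_cell 0 hl') hx), mul_zero]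

/-- Rescaling by `𝔭ⁿ` of the Parseval relation on translates of `𝒪`. -/
lemma Choices.tsum_χ_cell [μ.Regular] (S : Choices K p c) (hμ : μ (𝒪[K] : Set K) = 1) (n : ℤ)
    (l : ℕ) {h : K → ℂ} (hh : MemLp h 2 μ) (hs : ∀ x, x ∉ S.cell n l → h x = 0) :
    ∑' k, ‖∫ x, (S.χ ((S.π : K) ^ (-n) * S.u k * x) : ℂ) * h x ∂μ‖ₑ ^ 2 =
      (resCard K : ℝ≥0∞) ^ (-n) * ∫⁻ x, ‖h x‖ₑ ^ 2 ∂μ := by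
  have hπ := S.π_ne_zero
  have h1 := S.tsum_χ_cell_zero hμ l (memLp_comp_mul μ (zpow_ne_zero n hπ) hh) (by
    intro x hx
    refine hs _ fun hx' => hx ?_
    rw [S.mem_cell] at hx' ⊢
    rwa [← mul_assoc, ← zpow_add₀ hπ, neg_add_cancel] at hx')
  rw [S.lintegral_zpow_mul μ hμ n (fun x => ‖h x‖ₑ ^ 2)] at h1
  have h2 : ∀ k, ∫ x, (S.χ (S.u k * x) : ℂ) * h ((S.π : K) ^ n * x) ∂μ =
      (resCard K : ℂ) ^ n * ∫ x, (S.χ ((S.π : K) ^ (-n) * S.u k * x) : ℂ) * h x ∂μ := by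
    intro k
    rw [← S.integral_zpow_mul μ hμ]
    refine integral_congr_ae (Filter.Eventually.of_forall fun x => ?_)
    simp only
    congr 3
    rw [zpow_neg]
    field_simp
  simp only [h2, enorm_mul, mul_pow] at h1
  rw [ENNReal.tsum_mul_left] at h1
  have h3 : ‖(resCard K : ℂ) ^ n‖ₑ = (resCard K : ℝ≥0∞) ^ n := by
    rw [← ofReal_norm, norm_zpow, Complex.norm_natCast, ofReal_resCard_zpow]
  rw [h3] at h1
  set A := ∑' k, ‖∫ x, (S.χ ((S.π : K) ^ (-n) * S.u k * x) : ℂ) * h x ∂μ‖ₑ ^ 2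
  set B := ∫⁻ x, ‖h x‖ₑ ^ 2 ∂μ
  set q := (resCard K : ℝ≥0∞)
  have h4 : q ^ (-n) * q ^ n = 1 := by simpa using resCard_zpow_mul_zpow_neg (K := K) (-n)
  calc A = (q ^ (-n) * q ^ n) ^ 2 * A := by rw [h4]; simp
    _ = (q ^ (-n)) ^ 2 * ((q ^ n) ^ 2 * A) := by ring
    _ = (q ^ (-n)) ^ 2 * (q ^ n * B) := by rw [h1]
    _ = (q ^ (-n) * q ^ n) * (q ^ (-n) * B) := by ring
    _ = q ^ (-n) * B := by rw [h4, one_mul]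

/-- For a coarser scale the frequencies `𝔭ʲ u k` are among the `𝔭⁻ⁿ u k`, and Parseval's relation
becomes Bessel's inequality. -/
lemma Choices.tsum_χ_cell_le [μ.Regular] (S : Choices K p c) (hμ : μ (𝒪[K] : Set K) = 1)
    {n j : ℤ} (hj : j ≤ -n)
    (l : ℕ) {h : K → ℂ} (hh : MemLp h 2 μ) (hs : ∀ x, x ∉ S.cell n l → h x = 0) :
    ∑' k, ‖∫ x, (S.χ ((S.π : K) ^ j * S.u k * x) : ℂ) * h x ∂μ‖ₑ ^ 2 ≤
      (resCard K : ℝ≥0∞) ^ (-n) * ∫⁻ x, ‖h x‖ₑ ^ 2 ∂μ := by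
  rw [← S.tsum_χ_cell hμ n l hh hs]
  obtain ⟨m, hm⟩ := Int.le.dest hj
  have h1 : ∀ k, (S.π : K) ^ j * S.u k = (S.π : K) ^ (-n) * S.u (resCard K ^ m * k) := by
    intro k
    rw [S.u_pow_mul, ← mul_assoc, ← hm, zpow_add₀ S.π_ne_zero, inv_pow, zpow_natCast,
      mul_assoc (_ ^ j), mul_inv_cancel₀ (pow_ne_zero _ S.π_ne_zero), mul_one]
  simp only [h1]
  refine ENNReal.tsum_comp_le_tsum_of_injective (f := fun k : ℕ => resCard K ^ m * k) ?_
    (fun k => ‖∫ x, (S.χ ((S.π : K) ^ (-n) * S.u k * x) : ℂ) * h x ∂μ‖ₑ ^ 2)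
  intro a b hab
  exact Nat.eq_of_mul_eq_mul_left (pow_pos resCard_pos m) hab

end Operators

/-! ### The affine system -/

section Affine

variable {K : Type*} [Field K] [ValuativeRel K] [TopologicalSpace K]
  [IsNonarchimedeanLocalField K] {p c : ℕ} [MeasurableSpace K] [BorelSpace K]
  {μ : Measure K} [μ.IsAddHaarMeasure] [μ.Regular]

/-- The element `D^j T_k ψ` of the affine system of `ψ`. -/
def affine (S : Choices K p c) (j : ℤ) (k : ℕ) (ψ : Lp ℂ 2 μ) : Lp ℂ 2 μ :=
  dilation S μ j (translation S μ k ψ)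

section Spaces

variable (S : Choices K p c) {L : ℕ} {Ψ : Fin L → Lp ℂ 2 μ}

omit [μ.Regular] in
lemma translation_mem_waveletSpace (l : Fin L) (k : ℕ) :
    translation S μ k (Ψ l) ∈ waveletSpace S μ Ψ :=
  Submodule.le_topologicalClosure _ (Submodule.subset_span ⟨l, k, rfl⟩)

lemma affine_mem_map (l : Fin L) (j : ℤ) (k : ℕ) :
    affine S j k (Ψ l) ∈ (waveletSpace S μ Ψ).map (dilation S μ j) :=
  Submodule.mem_map_of_mem (translation_mem_waveletSpace S l k)

lemma affine_mem_negDilateSpace (l : Fin L) {j : ℤ} (hj : j < 0) (k : ℕ) :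
    affine S j k (Ψ l) ∈ negDilateSpace S μ Ψ :=
  Submodule.le_topologicalClosure _
    (Submodule.mem_iSup_of_mem j (Submodule.mem_iSup_of_mem hj (affine_mem_map S l j k)))

variable {S}

lemma IsSemiOrthogonal.negDilateSpace_le (h : IsSemiOrthogonal S μ Ψ) {j : ℤ} (hj : 0 ≤ j) :
    negDilateSpace S μ Ψ ≤ ((waveletSpace S μ Ψ).map (dilation S μ j))ᗮ := by
  refine Submodule.topologicalClosure_minimal _ ?_ (Submodule.isClosed_orthogonal _)
  exact iSup₂_le fun i hi => h i j (by omega)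

lemma IsSemiOrthogonal.inner_affine_eq_zero (h : IsSemiOrthogonal S μ Ψ) (l : Fin L) {j : ℤ}
    (hj : 0 ≤ j) (k : ℕ) {f : Lp ℂ 2 μ} (hf : f ∈ negDilateSpace S μ Ψ) :
    inner ℂ (affine S j k (Ψ l)) f = 0 :=
  (Submodule.mem_orthogonal _ _).1 (h.negDilateSpace_le hj hf) _ (affine_mem_map S l j k)

lemma IsParsevalMultiwavelet.tsum_eq (h : IsParsevalMultiwavelet S μ Ψ) (f : Lp ℂ 2 μ) :
    ∑ l, ∑' j, ∑' k, ‖inner ℂ (affine S j k (Ψ l)) f‖ₑ ^ 2 = ‖f‖ₑ ^ 2 := by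
  rw [← tsum_enorm_sq_of_hasSum (h f), ENNReal.tsum_prod', tsum_fintype]
  exact Finset.sum_congr rfl fun l _ => (ENNReal.tsum_prod' (f := fun i : ℤ × ℕ =>
    ‖inner ℂ (affine S i.1 i.2 (Ψ l)) f‖ₑ ^ 2)).symm

/-- If `f` is orthogonal to the elements of negative scale of the affine system, then its norm is
computed by the elements of nonnegative scale. -/
lemma IsParsevalMultiwavelet.tsum_nonneg_eq (h : IsParsevalMultiwavelet S μ Ψ) {f : Lp ℂ 2 μ}
    (hf : ∀ l, ∀ j : ℤ, j < 0 → ∀ k, inner ℂ (affine S j k (Ψ l)) f = 0) :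
    ∑ l, ∑' j : ℕ, ∑' k, ‖inner ℂ (affine S j k (Ψ l)) f‖ₑ ^ 2 = ‖f‖ₑ ^ 2 := by
  rw [← h.tsum_eq f]
  refine Finset.sum_congr rfl fun l _ => ?_
  refine Function.Injective.tsum_eq (f := fun j : ℤ => ∑' k,
    ‖inner ℂ (affine S j k (Ψ l)) f‖ₑ ^ 2) Nat.cast_injective ?_
  intro j hj
  by_contra hne
  have hj0 : j < 0 := by
    by_contra h0
    exact hne ⟨j.toNat, by simp; omega⟩
  exact hj (by simp [hf l j hj0])

/-- The orthogonal complement of the space of negative dilates is spanned by the elements of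
nonnegative scale of the affine system: the part of `f` orthogonal to the space of negative dilates
is annihilated by the whole system. -/
lemma IsParsevalMultiwavelet.mem_negDilateSpace_iff (h : IsParsevalMultiwavelet S μ Ψ)
    (h' : IsSemiOrthogonal S μ Ψ) {f : Lp ℂ 2 μ} :
    f ∈ negDilateSpace S μ Ψ ↔
      ∀ l, ∀ j k : ℕ, inner ℂ (affine S j k (Ψ l)) f = 0 := by
  constructor
  · exact fun hf l j k => h'.inner_affine_eq_zero l (by omega) k hf
  · intro hf
    have hcl : IsClosed (negDilateSpace S μ Ψ : Set (Lp ℂ 2 μ)) :=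
      Submodule.isClosed_topologicalClosure _
    have : CompleteSpace (negDilateSpace S μ Ψ) := hcl.completeSpace_coe
    set w := (negDilateSpace S μ Ψ).starProjection f with hw
    have hwV : w ∈ negDilateSpace S μ Ψ := Submodule.starProjection_apply_mem _ f
    have hfw : f - w ∈ (negDilateSpace S μ Ψ)ᗮ := Submodule.sub_starProjection_mem_orthogonal f
    have h0 := h.tsum_nonneg_eq (f := f - w) fun l j hj k =>
      (Submodule.mem_orthogonal _ _).1 hfw _ (affine_mem_negDilateSpace S l hj k)
    have h1 : ∀ l, ∀ j k : ℕ, inner ℂ (affine S j k (Ψ l)) (f - w) = 0 := fun l j k => by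
      rw [inner_sub_right, hf, h'.inner_affine_eq_zero l (by omega) k hwV, sub_zero]
    simp only [h1] at h0
    have h2 : f - w = 0 := by simpa using h0.symm
    rw [sub_eq_zero.1 h2]
    exact hwV

/-- The Parseval property determines the distance to the space of negative dilates. -/
lemma IsParsevalMultiwavelet.enorm_sub_sq (h : IsParsevalMultiwavelet S μ Ψ)
    (h' : IsSemiOrthogonal S μ Ψ) {f w : Lp ℂ 2 μ} (hw : w ∈ negDilateSpace S μ Ψ)
    (hfw : f - w ∈ (negDilateSpace S μ Ψ)ᗮ) :
    ‖f - w‖ₑ ^ 2 = ∑ l, ∑' j : ℕ, ∑' k, ‖inner ℂ (affine S j k (Ψ l)) f‖ₑ ^ 2 := by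
  rw [← h.tsum_nonneg_eq (f := f - w) fun l j hj k =>
      (Submodule.mem_orthogonal _ _).1 hfw _ (affine_mem_negDilateSpace S l hj k)]
  refine Finset.sum_congr rfl fun l _ => tsum_congr fun j => tsum_congr fun k => ?_
  rw [inner_sub_right, h'.inner_affine_eq_zero l (by omega) k hw, sub_zero]

end Spaces

variable [Fact p.Prime] [CharP K p]

lemma Choices.inner_affine (S : Choices K p c) (hμ : μ (𝒪[K] : Set K) = 1) (j : ℤ) (k : ℕ)
    (ψ f : Lp ℂ 2 μ) :
    inner ℂ (affine S j k ψ) f = ∫ ξ, (S.χ ((S.π : K) ^ j * S.u k * ξ) : ℂ) *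
      ((((resCard K : ℝ) ^ (((-j : ℤ) : ℝ) / 2) : ℝ) : ℂ) *
        ((starRingEnd ℂ) (S.fourier hμ ψ ((S.π : K) ^ j * ξ)) * S.fourier hμ f ξ)) ∂μ := by
  rw [← (S.fourier hμ).inner_map_map, L2.inner_def]
  refine integral_congr_ae ?_
  filter_upwards [S.fourier_affine hμ j k ψ] with ξ hξ
  rw [affine, hξ, RCLike.inner_apply, map_mul, map_mul, S.conj_χ, Complex.conj_ofReal, neg_neg]
  ring

omit [Fact p.Prime] [CharP K p] in
/-- Integrability of the function whose Fourier coefficients are the coefficients of a function with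
Fourier transform `1_E` in the affine system. -/
lemma Choices.memLp_test (S : Choices K p c) {E : Set K}
    (hE : MeasurableSet E) (j : ℤ) (a : ℂ) (g : Lp ℂ 2 μ) :
    MemLp (E.indicator fun ξ => a * (starRingEnd ℂ) (g ((S.π : K) ^ j * ξ))) 2 μ := by
  have h := memLp_comp_mul μ (zpow_ne_zero j S.π_ne_zero) (Lp.memLp g)
  refine (MemLp.const_mul ?_ a).indicator hE
  exact h.of_le (Complex.continuous_conj.comp_aestronglyMeasurable h.1)
    (Filter.Eventually.of_forall fun x => by simp)

lemma Choices.inner_affine_test (S : Choices K p c) (hμ : μ (𝒪[K] : Set K) = 1) {E : Set K}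
    {f : Lp ℂ 2 μ} (hf : S.fourier hμ f =ᵐ[μ] E.indicator 1)
    (j : ℤ) (k : ℕ) (ψ : Lp ℂ 2 μ) :
    inner ℂ (affine S j k ψ) f = ∫ ξ, (S.χ ((S.π : K) ^ j * S.u k * ξ) : ℂ) *
      E.indicator (fun ξ => (((resCard K : ℝ) ^ (((-j : ℤ) : ℝ) / 2) : ℝ) : ℂ) *
        (starRingEnd ℂ) (S.fourier hμ ψ ((S.π : K) ^ j * ξ))) ξ ∂μ := by
  rw [S.inner_affine hμ]
  refine integral_congr_ae ?_
  filter_upwards [hf] with ξ hξ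
  rw [hξ]
  by_cases h : ξ ∈ E <;> simp [h]

omit [BorelSpace K] [μ.IsAddHaarMeasure] [μ.Regular] [Fact p.Prime] [CharP K p] in
lemma Choices.lintegral_test (S : Choices K p c) {E : Set K}
    (hE : MeasurableSet E) (j : ℤ) (g : K → ℂ) :
    ∫⁻ ξ, ‖E.indicator (fun ξ => (((resCard K : ℝ) ^ (((-j : ℤ) : ℝ) / 2) : ℝ) : ℂ) *
        (starRingEnd ℂ) (g ((S.π : K) ^ j * ξ))) ξ‖ₑ ^ 2 ∂μ =
      (resCard K : ℝ≥0∞) ^ (-j) * ∫⁻ ξ in E, ‖g ((S.π : K) ^ j * ξ)‖ₑ ^ 2 ∂μ := by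
  rw [← lintegral_const_mul' _ _ (resCard_zpow_ne_top _), ← lintegral_indicator hE]
  refine lintegral_congr fun ξ => ?_
  by_cases h : ξ ∈ E
  · simp only [Set.indicator_of_mem h]
    rw [enorm_mul, mul_pow, enorm_rpow_half_sq]
    congr 2
    exact RCLike.enorm_conj _
  · simp [h]

/-- Coefficients of scale `j`, for a set which is contained in a ball of radius `qʲ`. -/
lemma Choices.tsum_inner_affine (S : Choices K p c) (hμ : μ (𝒪[K] : Set K) = 1) {E : Set K}
    (hE : MeasurableSet E) {f : Lp ℂ 2 μ} (hf : S.fourier hμ f =ᵐ[μ] E.indicator 1)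
    (j : ℤ) {i : ℕ} (hi : E ⊆ S.cell (-j) i) (ψ : Lp ℂ 2 μ) :
    ∑' k, ‖inner ℂ (affine S j k ψ) f‖ₑ ^ 2 =
      ∫⁻ ξ in E, ‖S.fourier hμ ψ ((S.π : K) ^ j * ξ)‖ₑ ^ 2 ∂μ := by
  have h := S.tsum_χ_cell hμ (-j) i (S.memLp_test hE j
    (((resCard K : ℝ) ^ (((-j : ℤ) : ℝ) / 2) : ℝ) : ℂ) (S.fourier hμ ψ))
    (fun x hx => Set.indicator_of_notMem (Set.notMem_subset hi hx) _)
  simp only [neg_neg] at h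
  simp only [S.inner_affine_test hμ hf]
  rw [h, S.lintegral_test hE j, ← mul_assoc, resCard_zpow_mul_zpow_neg, one_mul]

/-- Coefficients of scale `j`, for a set which is contained in a larger ball. -/
lemma Choices.tsum_inner_affine_le (S : Choices K p c) (hμ : μ (𝒪[K] : Set K) = 1) {E : Set K}
    (hE : MeasurableSet E) {f : Lp ℂ 2 μ} (hf : S.fourier hμ f =ᵐ[μ] E.indicator 1)
    {j n : ℤ} (hj : j ≤ -n) {i : ℕ} (hi : E ⊆ S.cell n i) (ψ : Lp ℂ 2 μ) :
    ∑' k, ‖inner ℂ (affine S j k ψ) f‖ₑ ^ 2 ≤ (resCard K : ℝ≥0∞) ^ (-n) *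
      ((resCard K : ℝ≥0∞) ^ (-j) *
        ∫⁻ ξ in E, ‖S.fourier hμ ψ ((S.π : K) ^ j * ξ)‖ₑ ^ 2 ∂μ) := by
  have h := S.tsum_χ_cell_le hμ hj i (S.memLp_test hE j
    (((resCard K : ℝ) ^ (((-j : ℤ) : ℝ) / 2) : ℝ) : ℂ) (S.fourier hμ ψ))
    (fun x hx => Set.indicator_of_notMem (Set.notMem_subset hi hx) _)
  simp only [S.inner_affine_test hμ hf]
  rwa [S.lintegral_test hE j] at h

omit [μ.Regular] in
/-- The function whose Fourier transform is the indicator function of a set. -/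
lemma Choices.exists_fourier_eq_indicator (S : Choices K p c) (hμ : μ (𝒪[K] : Set K) = 1)
    {E : Set K} (hE : MeasurableSet E) (hfin : μ E ≠ ∞) :
    ∃ f : Lp ℂ 2 μ, S.fourier hμ f =ᵐ[μ] E.indicator 1 ∧ ‖f‖ₑ ^ 2 = μ E := by
  have hm : MemLp (E.indicator (1 : K → ℂ)) 2 μ :=
    memLp_indicator_const 2 hE (1 : ℂ) (Or.inr hfin)
  have h1 : S.fourier hμ ((S.fourier hμ).symm (hm.toLp _)) =ᵐ[μ] E.indicator 1 := by
    rw [LinearIsometryEquiv.apply_symm_apply]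
    exact hm.coeFn_toLp
  refine ⟨(S.fourier hμ).symm (hm.toLp _), h1, ?_⟩
  rw [enorm_map, enorm_sq_eq_lintegral, ← lintegral_indicator_one hE]
  refine lintegral_congr_ae ?_
  filter_upwards [hm.coeFn_toLp] with x hx
  rw [hx]
  by_cases h : x ∈ E <;> simp [h]

/-- The elements of nonnegative scale of the affine system are permuted by the translations. -/
lemma Choices.translation_affine (S : Choices K p c) (hμ : μ (𝒪[K] : Set K) = 1) (j k m : ℕ)
    (ψ : Lp ℂ 2 μ) :
    translation S μ m (affine S j k ψ) = affine S j (S.addIdx (resCard K ^ j * m) k) ψ := by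
  refine (S.fourier hμ).injective (Lp.ext ?_)
  filter_upwards [S.fourier_translation hμ m (affine S j k ψ), S.fourier_affine hμ j k ψ,
    S.fourier_affine hμ j (S.addIdx (resCard K ^ j * m) k) ψ] with ξ h1 h2 h3
  rw [h1, affine, h2, affine, h3, mul_left_comm]
  congr 1
  rw [← mul_assoc, ← Circle.coe_mul, ← AddChar.map_add_eq_mul, S.u_addIdx, S.u_pow_mul]
  congr 3
  have := S.π_ne_zero
  simp only [zpow_natCast, inv_pow]
  field_simp
  ring

end Affine

/-! ### Projections in a Hilbert space -/

section Hilbert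

variable {H : Type*} [NormedAddCommGroup H] [InnerProductSpace ℂ H]

/-- One step of the Gram–Schmidt process, in terms of projections. -/
lemma starProjection_eq_of_eq_sup (M N : Submodule ℂ H) [M.HasOrthogonalProjection]
    [N.HasOrthogonalProjection] (v b : H) (h : N = M ⊔ Submodule.span ℂ {v}) :
    N.starProjection b = M.starProjection b +
      (inner ℂ (v - M.starProjection v) b / (‖v - M.starProjection v‖ : ℂ) ^ 2) •
        (v - M.starProjection v) := by
  set r := v - M.starProjection v with hr
  have hrM : ∀ m ∈ M, inner ℂ r m = 0 := fun m hm =>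
    (Submodule.mem_orthogonal' M _).1 (Submodule.sub_starProjection_mem_orthogonal v) m hm
  have hMN : M ≤ N := h ▸ le_sup_left
  have hvN : v ∈ N := h ▸ Submodule.mem_sup_right (Submodule.mem_span_singleton_self v)
  refine Submodule.eq_starProjection_of_mem_of_inner_eq_zero ?_ ?_
  · exact add_mem (hMN (M.starProjection_apply_mem _))
      (N.smul_mem _ (sub_mem hvN (hMN (M.starProjection_apply_mem _))))
  · intro w hw
    have hbM : ∀ m ∈ M, inner ℂ (b - M.starProjection b) m = 0 := fun m hm =>
      (Submodule.mem_orthogonal' _ _).1 (Submodule.sub_starProjection_mem_orthogonal b) m hm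
    have key : ∀ m ∈ M, inner ℂ (b - (M.starProjection b +
        (inner ℂ r b / (‖r‖ : ℂ) ^ 2) • r)) m = 0 := by
      intro m hm
      rw [← sub_sub, inner_sub_left, hbM m hm, inner_smul_left, hrM m hm]
      simp
    have keyr : inner ℂ (b - (M.starProjection b + (inner ℂ r b / (‖r‖ : ℂ) ^ 2) • r)) r = 0 := by
      have h1 : inner ℂ (M.starProjection b) r = 0 := by
        rw [← inner_conj_symm, hrM _ (M.starProjection_apply_mem _), map_zero]
      rw [← sub_sub, inner_sub_left, inner_sub_left, h1, inner_smul_left, sub_zero, map_div₀,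
        inner_conj_symm, inner_self_eq_norm_sq_to_K]
      by_cases h0 : r = 0
      · simp [h0]
      · have : (‖r‖ : ℂ) ≠ 0 := by simpa using h0
        simp [this]
    rw [h] at hw
    obtain ⟨m, hm, z, hz, rfl⟩ := Submodule.mem_sup.1 hw
    obtain ⟨a, rfl⟩ := Submodule.mem_span_singleton.1 hz
    have hv : v = r + M.starProjection v := by simp [hr]
    rw [inner_add_right, key m hm, inner_smul_right]
    have hv' : inner ℂ (b - (M.starProjection b + (inner ℂ r b / (‖r‖ : ℂ) ^ 2) • r))
        (r + M.starProjection v) = 0 := by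
      rw [inner_add_right, keyr, key _ (M.starProjection_apply_mem _), add_zero]
    rw [← hv] at hv'
    rw [hv', mul_zero, add_zero]

/-- The projection onto the closed span of a sequence of measurable functions is measurable. -/
lemma stronglyMeasurable_starProjection [CompleteSpace H] {X : Type*} [MeasurableSpace X]
    {v : ℕ → X → H} (hv : ∀ n, StronglyMeasurable (v n)) (b : H) :
    StronglyMeasurable fun x =>
      (Submodule.span ℂ (Set.range fun n => v n x)).topologicalClosure.starProjection b := by
  classical
  let M : ℕ → X → Submodule ℂ H := fun n x =>
    Submodule.span ℂ ((Finset.range n).image (fun i => v i x) : Set H)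
  have hfin : ∀ n x, FiniteDimensional ℂ (M n x) := fun n x => inferInstance
  have hstep : ∀ n x, M (n + 1) x = M n x ⊔ Submodule.span ℂ {v n x} := by
    intro n x
    simp only [M]
    rw [Finset.range_add_one, Finset.image_insert, Finset.coe_insert, Submodule.span_insert,
      sup_comm]
  have hmeas : ∀ n, ∀ b : X → H, StronglyMeasurable b →
      StronglyMeasurable fun x => (M n x).starProjection (b x) := by
    intro n
    induction n with
    | zero =>
      intro b _
      have : ∀ x, (M 0 x).starProjection (b x) = 0 := by
        intro x
        have : M 0 x = ⊥ := by simp [M]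
        simp [this]
      simp only [this]
      exact stronglyMeasurable_const
    | succ n ih =>
      intro b hb
      simp only [fun x => starProjection_eq_of_eq_sup (M n x) (M (n + 1) x) (v n x) (b x) (hstep n x)]
      have hr : StronglyMeasurable fun x => v n x - (M n x).starProjection (v n x) :=
        (hv n).sub (ih _ (hv n))
      refine (ih b hb).add (StronglyMeasurable.smul ?_ hr)
      exact ((hr.inner hb).measurable.div
        ((Complex.measurable_ofReal.comp hr.norm.measurable).pow_const 2)).stronglyMeasurable
  refine stronglyMeasurable_of_tendsto Filter.atTop
    (fun n => hmeas n (fun _ => b) stronglyMeasurable_const)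
    (tendsto_pi_nhds.2 fun x => ?_)
  have hmono : Monotone fun n => M n x := fun m n hmn =>
    Submodule.span_mono (Finset.coe_subset.2 (Finset.image_subset_image (Finset.range_mono hmn)))
  have hsup : ⨆ n, M n x = Submodule.span ℂ (Set.range fun n => v n x) := by
    refine le_antisymm (iSup_le fun n => Submodule.span_mono ?_) (Submodule.span_le.2 ?_)
    · intro y hy
      obtain ⟨i, -, rfl⟩ := Finset.mem_image.1 hy
      exact ⟨i, rfl⟩
    · rintro _ ⟨n, rfl⟩
      refine Submodule.mem_iSup_of_mem (n + 1) (Submodule.subset_span ?_)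
      exact Finset.mem_image.2 ⟨n, by simp, rfl⟩
  have := Submodule.starProjection_tendsto_closure_iSup (fun n => M n x) hmono b
  simp only [hsup] at this
  exact this

/-- The rank of a closed subspace of a Hilbert space is the trace of its projection. -/
lemma toENat_rank_eq_tsum [CompleteSpace H] {ι : Type*} (e : HilbertBasis ι ℂ H)
    (M : Submodule ℂ H) [CompleteSpace M] :
    ((Cardinal.toENat (Module.rank ℂ M) : ℕ∞) : ℝ≥0∞) = ∑' i, ‖M.starProjection (e i)‖ₑ ^ 2 := by
  obtain ⟨w, b, hb⟩ := exists_hilbertBasis ℂ M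
  have h1 : ∑' i, ‖M.starProjection (e i)‖ₑ ^ 2 = ∑' _ : w, (1 : ℝ≥0∞) := by
    have h2 : ∀ i, ‖M.starProjection (e i)‖ₑ ^ 2 = ∑' j : w, ‖inner ℂ (e i) (b j : H)‖ₑ ^ 2 := by
      intro i
      rw [Submodule.starProjection_apply]
      have := tsum_enorm_inner_sq b (M.orthogonalProjectionOnto (e i))
      rw [show ‖(M.orthogonalProjectionOnto (e i) : H)‖ₑ = ‖M.orthogonalProjectionOnto (e i)‖ₑ
        from rfl, ← this]
      refine tsum_congr fun j => ?_
      rw [Submodule.inner_orthogonalProjectionOnto_eq_of_mem_left, ← inner_conj_symm,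
        RCLike.enorm_conj]
    simp only [h2]
    rw [ENNReal.tsum_comm]
    refine tsum_congr fun j => ?_
    rw [tsum_enorm_inner_sq e]
    have h3 : ‖(b j : H)‖ = 1 := b.orthonormal.1 j
    rw [← ofReal_norm, h3]
    simp
  rw [h1, ENNReal.tsum_const, mul_one]
  rcases finite_or_infinite w with hf | hi
  · have := Fintype.ofFinite w
    have hr : Module.rank ℂ M = Fintype.card w :=
      rank_eq_card_basis (b.toOrthonormalBasis.toBasis)
    rw [hr]
    simp [ENat.card_eq_coe_fintype_card]
  · have h3 : Cardinal.aleph0 ≤ Module.rank ℂ M :=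
      (Cardinal.aleph0_le_mk w).trans b.orthonormal.linearIndependent.cardinal_le_rank
    rw [Cardinal.toENat_eq_top.2 h3, ENat.card_eq_top_of_infinite]

end Hilbert

/-! ### Fibers -/

section Fibers

lemma memℓp_two_iff {a : ℕ → ℂ} : Memℓp a 2 ↔ ∑' k, ‖a k‖ₑ ^ 2 ≠ ∞ := by
  rw [memℓp_gen_iff (by norm_num)]
  have h : ∀ k, ‖a k‖ₑ ^ 2 = ((‖a k‖₊ ^ 2 : NNReal) : ℝ≥0∞) := fun k => by
    rw [ENNReal.coe_pow]; rfl
  simp only [h]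
  rw [ENNReal.tsum_coe_ne_top_iff_summable, ← NNReal.summable_coe]
  simp

/-- Strong measurability of an `ℓ²`-valued function can be checked on its coordinates. -/
lemma stronglyMeasurable_of_apply {X : Type*} [MeasurableSpace X] {v : X → EllTwo}
    (h : ∀ k, Measurable fun x => v x k) : StronglyMeasurable v := by
  refine stronglyMeasurable_of_tendsto Filter.atTop
    (f := fun n x => ∑ k ∈ Finset.range n, v x k • lp.single 2 k (1 : ℂ)) (fun n => ?_)
    (tendsto_pi_nhds.2 fun x => ?_)
  · exact Finset.stronglyMeasurable_fun_sum _ fun k _ =>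
      (h k).stronglyMeasurable.smul_const _
  · have := (lp.hasSum_single (p := 2) (by norm_num) (v x)).tendsto_sum_nat
    refine this.congr fun n => Finset.sum_congr rfl fun k _ => ?_
    rw [← lp.single_smul]
    simp

lemma integrable_conj_mul {α : Type*} [MeasurableSpace α] {ν : Measure α} (f g : Lp ℂ 2 ν) :
    Integrable (fun x => (starRingEnd ℂ) (f x) * g x) ν := by
  have := L2.integrable_inner (𝕜 := ℂ) f g
  simpa only [RCLike.inner_apply, mul_comm] using this

variable {K : Type*} [Field K] [ValuativeRel K] [TopologicalSpace K]
  [IsNonarchimedeanLocalField K] {p c : ℕ}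

open Classical in
/-- The fiber `(g(ξ + u k))ₖ` of a function `g` at `ξ`, or `0` if it is not square summable. -/
def Choices.fiber (S : Choices K p c) (g : K → ℂ) (ξ : K) : EllTwo :=
  if h : Memℓp (fun k => g (ξ + S.u k)) 2 then ⟨_, h⟩ else 0

lemma Choices.fiber_apply (S : Choices K p c) {g : K → ℂ} {ξ : K}
    (h : Memℓp (fun k => g (ξ + S.u k)) 2) (k : ℕ) : S.fiber g ξ k = g (ξ + S.u k) := by
  rw [Choices.fiber, dif_pos h]

variable [MeasurableSpace K] [BorelSpace K] {μ : Measure K} [μ.IsAddHaarMeasure]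

lemma Choices.ae_memℓp (S : Choices K p c) (f : Lp ℂ 2 μ) :
    ∀ᵐ ξ ∂μ.restrict (𝒪[K] : Set K), Memℓp (fun k => f (ξ + S.u k)) 2 := by
  have hm : Measurable fun x => ‖f x‖ₑ ^ 2 := (Lp.stronglyMeasurable f).measurable.enorm.pow_const 2
  have h := S.lintegral_eq_setLIntegral_tsum μ hm
  rw [← enorm_sq_eq_lintegral] at h
  have hfin : ∫⁻ x in (𝒪[K] : Set K), ∑' k, ‖f (x + S.u k)‖ₑ ^ 2 ∂μ ≠ ∞ := by
    rw [← h]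
    exact ENNReal.pow_ne_top enorm_ne_top
  have hm' : Measurable fun x => ∑' k, ‖f (x + S.u k)‖ₑ ^ 2 :=
    Measurable.tsum fun k => hm.comp (measurable_id.add_const _)
  filter_upwards [ae_lt_top hm' hfin] with ξ hξ
  exact memℓp_two_iff.2 hξ.ne

omit [μ.IsAddHaarMeasure] in
lemma Choices.stronglyMeasurable_fiber (S : Choices K p c) {g : K → ℂ} (hg : Measurable g) :
    StronglyMeasurable (S.fiber g) := by
  classical
  have hm : ∀ k, Measurable fun ξ => g (ξ + S.u k) := fun k => hg.comp (measurable_id.add_const _)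
  refine stronglyMeasurable_of_apply fun k => ?_
  have : (fun ξ => S.fiber g ξ k) =
      {ξ | ∑' k, ‖g (ξ + S.u k)‖ₑ ^ 2 ≠ ∞}.indicator fun ξ => g (ξ + S.u k) := by
    ext ξ
    by_cases h : Memℓp (fun k => g (ξ + S.u k)) 2
    · rw [S.fiber_apply h, Set.indicator_of_mem (memℓp_two_iff.1 h)]
    · rw [Choices.fiber, dif_neg h, Set.indicator_of_notMem (fun h' => h (memℓp_two_iff.2 h'))]
      rfl
  rw [this]
  refine (hm k).indicator ?_
  exact (measurableSet_eq_fun (Measurable.tsum fun k => (hm k).enorm.pow_const 2)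
    measurable_const).compl

omit [MeasurableSpace K] [BorelSpace K] in
/-- The bracket product of `f` and `g` at `ξ`. -/
lemma Choices.inner_fiber (S : Choices K p c) {f g : K → ℂ} {ξ : K}
    (hf : Memℓp (fun k => f (ξ + S.u k)) 2) (hg : Memℓp (fun k => g (ξ + S.u k)) 2) :
    inner ℂ (S.fiber f ξ) (S.fiber g ξ) =
      ∑' k, (starRingEnd ℂ) (f (ξ + S.u k)) * g (ξ + S.u k) := by
  rw [lp.inner_eq_tsum]
  simp only [S.fiber_apply hf, S.fiber_apply hg, RCLike.inner_apply, mul_comm]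

lemma Choices.ae_inner_fiber (S : Choices K p c) (f g : Lp ℂ 2 μ) :
    ∀ᵐ ξ ∂μ.restrict (𝒪[K] : Set K), inner ℂ (S.fiber f ξ) (S.fiber g ξ) =
      ∑' k, (starRingEnd ℂ) (f (ξ + S.u k)) * g (ξ + S.u k) := by
  filter_upwards [S.ae_memℓp f, S.ae_memℓp g] with ξ h1 h2
  exact S.inner_fiber h1 h2

/-- The inner product of `L²(K)` in terms of fibers. -/
lemma Choices.inner_eq_setIntegral (S : Choices K p c) (f g : Lp ℂ 2 μ) :
    inner ℂ f g = ∫ ξ in (𝒪[K] : Set K), inner ℂ (S.fiber f ξ) (S.fiber g ξ) ∂μ := by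
  rw [integral_congr_ae (S.ae_inner_fiber f g),
    ← S.integral_eq_setIntegral_tsum (integrable_conj_mul f g), L2.inner_def]
  simp only [RCLike.inner_apply, mul_comm]

variable [Fact p.Prime] [CharP K p]

/-- `f` is orthogonal to all translates of `φ` if and only if the fibers of the Fourier transforms
of `f` and `φ` are orthogonal almost everywhere. -/
lemma Choices.ae_inner_fiber_eq_zero (S : Choices K p c) (hμ : μ (𝒪[K] : Set K) = 1)
    {f φ : Lp ℂ 2 μ} (h : ∀ m, inner ℂ (translation S μ m φ) f = 0) :
    ∀ᵐ ξ ∂μ.restrict (𝒪[K] : Set K),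
      inner ℂ (S.fiber (S.fourier hμ φ) ξ) (S.fiber (S.fourier hμ f) ξ) = 0 := by
  have hi := integrable_conj_mul (S.fourier hμ φ) (S.fourier hμ f)
  have h1 := S.ae_eq_zero_of_forall_setIntegral (S.integrableOn_tsum hi) fun m => ?_
  · filter_upwards [S.ae_inner_fiber (S.fourier hμ φ) (S.fourier hμ f), h1] with ξ h2 h3
    rw [h2, h3]
  · rw [← h m, ← (S.fourier hμ).inner_map_map, L2.inner_def]
    have h2 : ∫ ξ, inner ℂ (S.fourier hμ (translation S μ m φ) ξ) (S.fourier hμ f ξ) ∂μ =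
        ∫ ξ, (S.χ (S.u m * ξ) : ℂ) *
          ((starRingEnd ℂ) (S.fourier hμ φ ξ) * S.fourier hμ f ξ) ∂μ := by
      refine integral_congr_ae ?_
      filter_upwards [S.fourier_translation hμ m φ] with ξ hξ
      rw [hξ, RCLike.inner_apply, map_mul, S.conj_χ, neg_neg]
      ring
    rw [h2, S.integral_eq_setIntegral_tsum (S.integrable_χ_mul (S.u m) hi)]
    refine integral_congr_ae (Filter.Eventually.of_forall fun ξ => ?_)
    simp only [mul_add, AddChar.map_add_eq_mul, S.χ_u_mul_u, mul_one]
    rw [tsum_mul_left]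

/-! ### Existence of the range function -/

variable [μ.Regular] {L : ℕ} {Ψ : Fin L → Lp ℂ 2 μ}

/-- An enumeration of the elements of nonnegative scale of the affine system, padded by zeros. -/
def affineSeq (S : Choices K p c) (Ψ : Fin L → Lp ℂ 2 μ) (n : ℕ) : Lp ℂ 2 μ :=
  match Encodable.decode (α := Fin L × ℕ × ℕ) n with
  | some i => affine S i.2.1 i.2.2 (Ψ i.1)
  | none => 0

omit [Fact p.Prime] [CharP K p] in
lemma affineSeq_encode (S : Choices K p c) (l : Fin L) (j k : ℕ) :
    affineSeq S Ψ (Encodable.encode (l, j, k)) = affine S j k (Ψ l) := by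
  simp [affineSeq]

omit [Fact p.Prime] [CharP K p] in
lemma forall_affineSeq (S : Choices K p c) {P : Lp ℂ 2 μ → Prop} (h0 : P 0)
    (h : ∀ l, ∀ j k : ℕ, P (affine S j k (Ψ l))) (n : ℕ) : P (affineSeq S Ψ n) := by
  rw [affineSeq]
  split
  · exact h _ _ _
  · exact h0

/-- The orthogonal complement of the fibers of the affine system of nonnegative scales. As a
function of `ξ` it is a range function of the space of negative dilates. -/
def Choices.range (S : Choices K p c) (hμ : μ (𝒪[K] : Set K) = 1) (Ψ : Fin L → Lp ℂ 2 μ) (ξ : K) :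
    ClosedSubmodule ℂ EllTwo :=
  ⟨(Submodule.span ℂ (Set.range fun n =>
    S.fiber (S.fourier hμ (affineSeq S Ψ n)) ξ))ᗮ, Submodule.isClosed_orthogonal _⟩

lemma Choices.mem_range_iff (S : Choices K p c) (hμ : μ (𝒪[K] : Set K) = 1) {ξ : K}
    {v : EllTwo} : v ∈ S.range hμ Ψ ξ ↔
      ∀ n, inner ℂ (S.fiber (S.fourier hμ (affineSeq S Ψ n)) ξ) v = 0 := by
  change v ∈ (Submodule.span ℂ _)ᗮ ↔ _
  rw [Submodule.mem_orthogonal]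
  constructor
  · exact fun h n => h _ (Submodule.subset_span ⟨n, rfl⟩)
  · intro h w hw
    induction hw using Submodule.span_induction with
    | mem w hw =>
      obtain ⟨n, rfl⟩ := hw
      exact h n
    | zero => simp
    | add x y _ _ hx hy => rw [inner_add_left, hx, hy, add_zero]
    | smul a x _ hx => rw [inner_smul_left, hx, mul_zero]

/-- The space of negative dilates is invariant under translations and has a range function. -/
lemma IsParsevalMultiwavelet.isRangeFunction (S : Choices K p c) (hμ : μ (𝒪[K] : Set K) = 1)
    (h : IsParsevalMultiwavelet S μ Ψ) (h' : IsSemiOrthogonal S μ Ψ) :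
    IsRangeFunction S μ (negDilateSpace S μ Ψ) fun ξ => S.range hμ Ψ ξ := by
  constructor
  · intro a b
    have h1 := stronglyMeasurable_starProjection
      (fun n => S.stronglyMeasurable_fiber
        (Lp.stronglyMeasurable (S.fourier hμ (affineSeq S Ψ n))).measurable) b
    have h2 : Measurable fun ξ : K => inner ℂ a (b - (Submodule.span ℂ (Set.range fun n =>
        S.fiber (S.fourier hμ (affineSeq S Ψ n)) ξ)).topologicalClosure.starProjection b) :=
      (stronglyMeasurable_const.inner (stronglyMeasurable_const.sub h1)).measurable
    convert h2.comp measurable_subtype_coe using 2 with ξ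
    simp only [Function.comp_apply]
    congr 1
    refine Submodule.eq_starProjection_of_mem_orthogonal ?_ ?_
    · change _ ∈ (Submodule.span ℂ _)ᗮ
      rw [← Submodule.orthogonal_closure]
      exact Submodule.sub_starProjection_mem_orthogonal b
    · rw [sub_sub_cancel]
      change _ ∈ (Submodule.span ℂ _)ᗮᗮ
      have h3 := (Submodule.span ℂ (Set.range fun n =>
        S.fiber (S.fourier hμ (affineSeq S Ψ n)) ξ)).topologicalClosure.starProjection_apply_mem b
      have h4 := Submodule.le_orthogonal_orthogonal _ h3
      rwa [Submodule.orthogonal_closure] at h4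
  · intro f
    rw [S.fourierL2_eq hμ, h.mem_negDilateSpace_iff h']
    constructor
    · intro hf
      have h1 : ∀ n m, inner ℂ (translation S μ m (affineSeq S Ψ n)) f = 0 := fun n =>
        forall_affineSeq S (P := fun φ => ∀ m, inner ℂ (translation S μ m φ) f = 0) (by simp)
          (fun l j k m => by rw [S.translation_affine hμ, hf]) n
      have h2 := ae_all_iff.2 fun n => S.ae_inner_fiber_eq_zero hμ (h1 n)
      filter_upwards [(ae_restrict_iff' measurableSet_integers).1 h2,
        (ae_restrict_iff' measurableSet_integers).1 (S.ae_memℓp (S.fourier hμ f))] with ξ h3 h4 hξ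
      exact ⟨S.fiber (S.fourier hμ f) ξ, (S.mem_range_iff hμ).2 (h3 hξ), S.fiber_apply (h4 hξ)⟩
    · intro hf l j k
      rw [← (S.fourier hμ).inner_map_map, S.inner_eq_setIntegral, ← affineSeq_encode]
      refine integral_eq_zero_of_ae ?_
      rw [Filter.EventuallyEq, ae_restrict_iff' measurableSet_integers]
      filter_upwards [hf] with ξ h1 hξ
      obtain ⟨v, hv, hvf⟩ := h1 hξ
      have h2 : v = S.fiber (S.fourier hμ f) ξ := by
        have h3 : Memℓp (fun k => S.fourier hμ f (ξ + S.u k)) 2 := by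
          have := lp.memℓp v
          rwa [show (v : ℕ → ℂ) = fun k => S.fourier hμ f (ξ + S.u k) from funext hvf] at this
        ext k
        rw [hvf, S.fiber_apply h3]
      rw [← h2]
      exact (S.mem_range_iff hμ).1 hv _

end Fibers

/-! ### The spectral function -/

section Spectral

/-- The standard basis of `ℓ²`. -/
def stdBasis : HilbertBasis ℕ ℂ EllTwo := HilbertBasis.ofRepr (LinearIsometryEquiv.refl ℂ EllTwo)

lemma inner_stdBasis (k : ℕ) (v : EllTwo) : inner ℂ (stdBasis k) v = v k := by
  rw [← stdBasis.repr_apply_apply]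
  rfl

lemma stdBasis_apply (k i : ℕ) : stdBasis k i = if i = k then 1 else 0 := by
  rw [← inner_stdBasis, orthonormal_iff_ite.1 stdBasis.orthonormal]

lemma enorm_sq_ellTwo (v : EllTwo) : ‖v‖ₑ ^ 2 = ∑' k, ‖v k‖ₑ ^ 2 := by
  rw [← tsum_enorm_inner_sq stdBasis v]
  simp only [inner_stdBasis]

variable {K : Type*} [Field K] [ValuativeRel K] [TopologicalSpace K]
  [IsNonarchimedeanLocalField K] {p c : ℕ}

/-- The projection of the basis vector of index `k` to the space `J ξ`. -/
def projBasis (J : 𝒪[K] → ClosedSubmodule ℂ EllTwo) (k : ℕ) (ξ : 𝒪[K]) : EllTwo :=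
  (J ξ).toSubmodule.starProjection (stdBasis k)

/-- The spectral function of a range function `J`: at `ξ + u k` with `ξ ∈ 𝒪`, it is the squared
norm of the projection of the basis vector of index `k` to `J ξ`. -/
def Choices.spectral (S : Choices K p c) (J : 𝒪[K] → ClosedSubmodule ℂ EllTwo) (x : K) : ℝ≥0∞ :=
  ‖projBasis J (S.idx x) (S.frac x)‖ₑ ^ 2

lemma Choices.spectral_add_u (S : Choices K p c) (J : 𝒪[K] → ClosedSubmodule ℂ EllTwo) {ξ : K}
    (hξ : ξ ∈ 𝒪[K]) (k : ℕ) :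
    S.spectral J (ξ + S.u k) = ‖projBasis J k ⟨ξ, hξ⟩‖ₑ ^ 2 := by
  rw [Choices.spectral, S.idx_add_u hξ, S.frac_of_add_u hξ]

lemma measurable_comp_index {X Y Z : Type*} [MeasurableSpace X] [MeasurableSpace Y]
    [MeasurableSpace Z] {F : ℕ → Y → Z} (hF : ∀ k, Measurable (F k)) {n : X → ℕ} (hn : Measurable n)
    {y : X → Y} (hy : Measurable y) : Measurable fun x => F (n x) (y x) := by
  have h : Measurable (Function.uncurry F) := measurable_from_prod_countable_right hF
  exact h.comp (hn.prodMk hy)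

variable [MeasurableSpace K] [BorelSpace K]

lemma Choices.measurable_idx (S : Choices K p c) : Measurable S.idx := by
  refine measurable_to_countable' fun k => ?_
  have : S.idx ⁻¹' {k} = S.cell 0 k := by
    ext x
    simp [S.mem_cell_iff]
  rw [this]
  exact S.measurableSet_cell 0 k

lemma Choices.measurable_frac (S : Choices K p c) : Measurable S.frac := by
  refine Measurable.subtype_mk (f := fun x => x - S.u (S.idx x)) ?_
  have := S.secondCountable
  exact measurable_id.sub ((measurable_of_countable S.u).comp S.measurable_idx)

variable {μ : Measure K} {V : Submodule ℂ (Lp ℂ 2 μ)} {S : Choices K p c}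
  {J : 𝒪[K] → ClosedSubmodule ℂ EllTwo}

omit [BorelSpace K] in
lemma IsRangeFunction.measurable_projBasis_apply (hJ : IsRangeFunction S μ V J) (k i : ℕ) :
    Measurable fun ξ => projBasis J k ξ i := by
  have h := hJ.measurable (stdBasis i) (stdBasis k)
  simp only [inner_stdBasis] at h
  exact h

omit [BorelSpace K] in
lemma IsRangeFunction.measurable_enorm_projBasis (hJ : IsRangeFunction S μ V J) (k : ℕ) :
    Measurable fun ξ => ‖projBasis J k ξ‖ₑ ^ 2 := by
  simp only [enorm_sq_ellTwo]
  exact Measurable.tsum fun i => (hJ.measurable_projBasis_apply k i).enorm.pow_const 2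

lemma IsRangeFunction.measurable_spectral (hJ : IsRangeFunction S μ V J) :
    Measurable (S.spectral J) := by
  exact measurable_comp_index (F := fun k ξ => ‖projBasis J k ξ‖ₑ ^ 2)
    hJ.measurable_enorm_projBasis S.measurable_idx S.measurable_frac

variable [μ.IsAddHaarMeasure]

open Classical in
/-- The Fourier transform of the projection to `V` of the function with Fourier transform `1_E`, for
a subset `E` of `u k + 𝒪`. -/
def Choices.projFun (S : Choices K p c) (J : 𝒪[K] → ClosedSubmodule ℂ EllTwo) (E : Set K) (k : ℕ)
    (x : K) : ℂ :=
  if (S.frac x : K) + S.u k ∈ E then projBasis J k (S.frac x) (S.idx x) else 0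

open Classical in
omit [MeasurableSpace K] [BorelSpace K] in
lemma Choices.projFun_add_u (S : Choices K p c) (J : 𝒪[K] → ClosedSubmodule ℂ EllTwo) (E : Set K)
    (k i : ℕ) {ξ : K} (hξ : ξ ∈ 𝒪[K]) :
    S.projFun J E k (ξ + S.u i) =
      ((if ξ + S.u k ∈ E then (1 : ℂ) else 0) • projBasis J k ⟨ξ, hξ⟩ : EllTwo) i := by
  rw [Choices.projFun, S.idx_add_u hξ, S.frac_of_add_u hξ]
  split_ifs <;> simp

omit [μ.IsAddHaarMeasure] in
lemma IsRangeFunction.measurable_projFun (hJ : IsRangeFunction S μ V J) {E : Set K}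
    (hE : MeasurableSet E) (k : ℕ) : Measurable (S.projFun J E k) := by
  have h := measurable_comp_index (F := fun i ξ => projBasis J k ξ i)
    (hJ.measurable_projBasis_apply k) S.measurable_idx S.measurable_frac
  refine Measurable.ite ?_ h measurable_const
  exact hE.preimage ((measurable_subtype_coe.comp S.measurable_frac).add_const _)

lemma IsRangeFunction.lintegral_projFun (hJ : IsRangeFunction S μ V J) {E : Set K}
    (hE : MeasurableSet E) {k : ℕ} (hk : E ⊆ S.cell 0 k) :
    ∫⁻ x, ‖S.projFun J E k x‖ₑ ^ 2 ∂μ = ∫⁻ x in E, S.spectral J x ∂μ := by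
  classical
  have h1 : ∫⁻ x in E, S.spectral J x ∂μ =
      ∫⁻ x in S.cell 0 k, E.indicator (S.spectral J) x ∂μ := by
    rw [setLIntegral_indicator hE, Set.inter_eq_left.2 hk]
  rw [h1, S.lintegral_eq_setLIntegral_tsum μ ((hJ.measurable_projFun hE k).enorm.pow_const 2),
    S.setLIntegral_cell μ]
  refine setLIntegral_congr_fun measurableSet_integers fun ξ hξ => ?_
  simp only [S.projFun_add_u J E k _ hξ, ← enorm_sq_ellTwo]
  by_cases h : ξ + S.u k ∈ E
  · rw [Set.indicator_of_mem h, S.spectral_add_u J hξ, if_pos h, one_smul]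
  · rw [Set.indicator_of_notMem h, if_neg h]
    simp

omit [TopologicalSpace K] [IsNonarchimedeanLocalField K] [MeasurableSpace K] [BorelSpace K] in
lemma enorm_projBasis_le (k : ℕ) (ξ : 𝒪[K]) : ‖projBasis J k ξ‖ₑ ^ 2 ≤ 1 := by
  have h1 : ‖projBasis J k ξ‖ ≤ 1 := by
    refine (Submodule.norm_starProjection_apply_le _ _).trans ?_
    exact (stdBasis.orthonormal.1 k).le
  refine pow_le_one' ?_ 2
  rw [← ofReal_norm]
  exact ENNReal.ofReal_le_one.2 h1

lemma IsRangeFunction.memLp_projFun (hJ : IsRangeFunction S μ V J) (hμ : μ (𝒪[K] : Set K) = 1)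
    {E : Set K} (hE : MeasurableSet E) {k : ℕ} (hk : E ⊆ S.cell 0 k) :
    MemLp (S.projFun J E k) 2 μ := by
  refine ⟨(hJ.measurable_projFun hE k).aestronglyMeasurable, ?_⟩
  have h1 := eLpNorm_nnreal_pow_eq_lintegral (f := S.projFun J E k) (μ := μ) (p := 2) two_ne_zero
  have h2 : ∫⁻ x, ‖S.projFun J E k x‖ₑ ^ 2 ∂μ ≤ 1 := by
    rw [hJ.lintegral_projFun hE hk, ← S.measure_cell_zero μ hμ k]
    refine (lintegral_mono fun x => enorm_projBasis_le _ _).trans ?_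
    rw [setLIntegral_one]
    exact measure_mono hk
  have h3 : eLpNorm (S.projFun J E k) 2 μ ^ 2 ≤ 1 := by
    refine le_trans (le_of_eq ?_) h2
    simpa using h1
  by_contra h
  rw [not_lt, top_le_iff] at h
  simp [h] at h3

variable [μ.Regular] [Fact p.Prime] [CharP K p] {L : ℕ} {Ψ : Fin L → Lp ℂ 2 μ}

/-- The density `∑ₗ |ψ̂ₗ|²` of the generators. -/
def Choices.density (S : Choices K p c) (hμ : μ (𝒪[K] : Set K) = 1) (Ψ : Fin L → Lp ℂ 2 μ)
    (x : K) : ℝ≥0∞ :=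
  ∑ l, ‖S.fourier hμ (Ψ l) x‖ₑ ^ 2

omit [μ.Regular] in
lemma Choices.measurable_density (S : Choices K p c) (hμ : μ (𝒪[K] : Set K) = 1) :
    Measurable (S.density hμ Ψ) :=
  Finset.measurable_fun_sum _ fun l _ =>
    (Lp.stronglyMeasurable (S.fourier hμ (Ψ l))).measurable.enorm.pow_const 2

lemma measurable_mul_left (a : K) : Measurable fun x : K => a * x :=
  (continuous_const.mul continuous_id).measurable

/-- The spectral function of the space of negative dilates is complementary to the sum of the
squares of the Fourier transforms of the generators over the nonnegative scales. For a function `f`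
with Fourier transform `1_E`, where `E ⊆ u k + 𝒪`, the projection `w` of `f` to the space is computed
fiberwise by the range function, and `‖f - w‖²` by the elements of nonnegative scale of the affine
system; then `‖f‖² = ‖w‖² + ‖f - w‖²` is the integrated form over `E` of the identity. -/
lemma IsRangeFunction.spectral_add_tsum (hμ : μ (𝒪[K] : Set K) = 1)
    (hJ : IsRangeFunction S μ (negDilateSpace S μ Ψ) J) (h : IsParsevalMultiwavelet S μ Ψ)
    (h' : IsSemiOrthogonal S μ Ψ) :
    ∀ᵐ x ∂μ, S.spectral J x + ∑' j : ℕ, S.density hμ Ψ ((S.π : K) ^ (j : ℤ) * x) = 1 := by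
  classical
  set V := negDilateSpace S μ Ψ with hV
  have hdm : ∀ j : ℤ, Measurable fun x => S.density hμ Ψ ((S.π : K) ^ j * x) := fun j =>
    (S.measurable_density hμ).comp (measurable_mul_left _)
  refine S.ae_of_ae_cell μ fun k => ?_
  have hfin : IsFiniteMeasure (μ.restrict (S.cell 0 k)) :=
    isFiniteMeasure_restrict.2 (by simp [S.measure_cell_zero μ hμ])
  refine ae_eq_of_forall_setLIntegral_eq_of_sigmaFinite
    (hJ.measurable_spectral.add (Measurable.tsum fun j : ℕ => hdm j))
    measurable_const fun E hE _ => ?_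
  rw [Measure.restrict_restrict hE]
  have hE' : MeasurableSet (E ∩ S.cell 0 k) := hE.inter (S.measurableSet_cell 0 k)
  have hk : E ∩ S.cell 0 k ⊆ S.cell 0 k := Set.inter_subset_right
  generalize E ∩ S.cell 0 k = E at hE' hk
  have hEfin : μ E ≠ ∞ := ne_top_of_le_ne_top (by simp [S.measure_cell_zero μ hμ]) (measure_mono hk)
  obtain ⟨f, hf, hfn⟩ := S.exists_fourier_eq_indicator hμ hE' hEfin
  have hm := hJ.memLp_projFun hμ hE' hk
  set w := (S.fourier hμ).symm (hm.toLp _) with hw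
  have hFw : S.fourier hμ w =ᵐ[μ] S.projFun J E k := by
    rw [hw, LinearIsometryEquiv.apply_symm_apply]
    exact hm.coeFn_toLp
  have hwV : w ∈ V := by
    rw [hJ.mem_iff, S.fourierL2_eq hμ]
    filter_upwards [S.ae_add_u μ hFw] with ξ hξ hξO
    refine ⟨(if ξ + S.u k ∈ E then (1 : ℂ) else 0) • projBasis J k ⟨ξ, hξO⟩, ?_, fun i => ?_⟩
    · exact (J ⟨ξ, hξO⟩).toSubmodule.smul_mem _ (Submodule.starProjection_apply_mem _ _)
    · rw [hξ i, S.projFun_add_u J E k i hξO]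
  have hfw : f - w ∈ Vᗮ := by
    rw [Submodule.mem_orthogonal]
    intro v hv
    rw [← (S.fourier hμ).inner_map_map, S.inner_eq_setIntegral]
    refine integral_eq_zero_of_ae ?_
    rw [hJ.mem_iff, S.fourierL2_eq hμ] at hv
    have hsub : S.fourier hμ (f - w) =ᵐ[μ] fun x => E.indicator 1 x - S.projFun J E k x := by
      rw [map_sub]
      filter_upwards [Lp.coeFn_sub (S.fourier hμ f) (S.fourier hμ w), hf, hFw] with x h1 h2 h3
      rw [h1, Pi.sub_apply, h2, h3]
    rw [Filter.EventuallyEq, ae_restrict_iff' measurableSet_integers]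
    filter_upwards [hv, S.ae_add_u μ hsub] with ξ h1 h2 hξO
    obtain ⟨y, hy, hyv⟩ := h1 hξO
    have h3 : S.fiber (S.fourier hμ v) ξ = y := by
      have h4 : Memℓp (fun k => S.fourier hμ v (ξ + S.u k)) 2 := by
        have := lp.memℓp y
        rwa [show (y : ℕ → ℂ) = fun k => S.fourier hμ v (ξ + S.u k) from funext hyv] at this
      ext i
      rw [hyv, S.fiber_apply h4]
    set z : EllTwo := (if ξ + S.u k ∈ E then (1 : ℂ) else 0) •
      (stdBasis k - projBasis J k ⟨ξ, hξO⟩) with hz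
    have hzi : ∀ i, z i = S.fourier hμ (f - w) (ξ + S.u i) := by
      intro i
      rw [h2 i, S.projFun_add_u J E k i hξO, hz, smul_sub, lp.coeFn_sub, Pi.sub_apply]
      congr 1
      rw [lp.coeFn_smul, Pi.smul_apply, smul_eq_mul, stdBasis_apply]
      by_cases hik : i = k
      · subst hik
        simp [Set.indicator_apply]
      · have : ξ + S.u i ∉ E := fun h5 => by
          have := (S.mem_cell_iff.1 (hk h5))
          simp only [neg_zero, zpow_zero, one_mul, S.idx_add_u hξO] at this
          exact hik this
        simp [hik, this]
    have h5 : S.fiber (S.fourier hμ (f - w)) ξ = z := by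
      have h4 : Memℓp (fun k => S.fourier hμ (f - w) (ξ + S.u k)) 2 := by
        have := lp.memℓp z
        rwa [show (z : ℕ → ℂ) = fun k => S.fourier hμ (f - w) (ξ + S.u k) from funext hzi] at this
      ext i
      rw [hzi, S.fiber_apply h4]
    rw [h3, h5, hz, inner_smul_right]
    have h6 : inner ℂ y (stdBasis k - projBasis J k ⟨ξ, hξO⟩) = 0 :=
      (Submodule.mem_orthogonal _ _).1 (Submodule.sub_starProjection_mem_orthogonal (stdBasis k)) y hy
    rw [h6, mul_zero]
    rfl
  have hpyth : ‖f‖ₑ ^ 2 = ‖w‖ₑ ^ 2 + ‖f - w‖ₑ ^ 2 := by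
    have h1 := norm_add_sq_eq_norm_sq_add_norm_sq_of_inner_eq_zero w (f - w)
      ((Submodule.mem_orthogonal _ _).1 hfw w hwV)
    rw [add_sub_cancel] at h1
    simp only [enorm_sq_eq_ofReal]
    rw [← ENNReal.ofReal_add (by positivity) (by positivity)]
    congr 1
    simpa [sq] using h1
  have hwn : ‖w‖ₑ ^ 2 = ∫⁻ x in E, S.spectral J x ∂μ := by
    rw [← hJ.lintegral_projFun hE' hk, ← enorm_map (S.fourier hμ) w, enorm_sq_eq_lintegral]
    refine lintegral_congr_ae ?_
    filter_upwards [hFw] with x hx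
    rw [hx]
  have hfwn : ‖f - w‖ₑ ^ 2 =
      ∫⁻ x in E, ∑' j : ℕ, S.density hμ Ψ ((S.π : K) ^ (j : ℤ) * x) ∂μ := by
    rw [h.enorm_sub_sq h' hwV hfw, lintegral_tsum fun j : ℕ => (hdm j).aemeasurable,
      ← Summable.tsum_finsetSum fun _ _ => ENNReal.summable]
    refine tsum_congr fun j => ?_
    simp only [Choices.density]
    rw [lintegral_finsetSum]
    · refine Finset.sum_congr rfl fun l _ => ?_
      refine S.tsum_inner_affine hμ hE' hf j (i := S.idx ((S.π : K) ^ (j : ℤ) * S.u k)) ?_ (Ψ l)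
      refine hk.trans (S.cell_subset (by omega) (x := S.u k) ?_ ?_)
      · simp [S.mem_cell, zero_mem]
      · simpa using S.mem_cell_idx (-(j : ℤ)) (S.u k)
    · exact fun l _ => ((Lp.stronglyMeasurable (S.fourier hμ (Ψ l))).measurable.comp
        (measurable_mul_left _)).enorm.pow_const 2
  rw [lintegral_add_left hJ.measurable_spectral, ← hwn, ← hfwn, ← hpyth, hfn, setLIntegral_one]

end Spectral

/-! ### The Calderón identity -/

section Calderon

variable {K : Type*} [Field K] [ValuativeRel K] [TopologicalSpace K]
  [IsNonarchimedeanLocalField K] {p c : ℕ}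

/-- The set of elements of `K` of valuation `n`. -/
def Choices.shell (S : Choices K p c) (n : ℤ) : Set K := S.ball n \ S.ball (n + 1)

lemma Choices.zpow_mul_mem_shell (S : Choices K p c) {n j : ℤ} {x : K} :
    (S.π : K) ^ j * x ∈ S.shell n ↔ x ∈ S.shell (n - j) := by
  rw [shell, shell, Set.mem_sdiff, Set.mem_sdiff, SetLike.mem_coe, SetLike.mem_coe,
    SetLike.mem_coe, SetLike.mem_coe, S.zpow_mul_mem_ball, S.zpow_mul_mem_ball,
    show n + 1 - j = n - j + 1 by ring]

lemma Choices.pairwise_disjoint_shell (S : Choices K p c) :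
    Pairwise (Function.onFun Disjoint S.shell) := by
  have h : ∀ m n : ℤ, m < n → Disjoint (S.shell m) (S.shell n) := fun m n hmn =>
    Set.disjoint_left.2 fun x hm hn => hm.2 (S.ball_anti (show m + 1 ≤ n by omega) hn.1)
  intro m n hmn
  rcases lt_or_gt_of_ne hmn with h1 | h1
  · exact h m n h1
  · exact (h n m h1).symm

lemma Choices.exists_mem_shell (S : Choices K p c) {x : K} (hx : x ≠ 0) : ∃ n, x ∈ S.shell n := by
  obtain ⟨a, ha⟩ := S.exists_pow_mul_mem x
  have ha' : x ∈ S.ball (-(a : ℤ)) := by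
    rw [S.mem_ball, neg_neg, zpow_natCast]
    exact ha
  obtain ⟨b, hb⟩ := S.exists_pow_mul_mem x⁻¹
  have hb' : x ∉ S.ball (b + 1) := fun h => by
    refine S.inv_notMem ?_
    have h2 : _ * _ ∈ 𝒪[K] := mul_mem (S.mem_ball.1 h) hb
    have h3 : (S.π : K) ^ (-((b : ℤ) + 1)) * x * ((S.π : K) ^ b * x⁻¹) = (S.π : K)⁻¹ := by
      rw [neg_add, zpow_add₀ S.π_ne_zero, zpow_neg, zpow_natCast, zpow_neg_one]
      have := S.π_ne_zero
      field_simp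
    rwa [h3] at h2
  obtain ⟨n, hn, hmax⟩ := Int.exists_greatest_of_bdd (P := fun n => x ∈ S.ball n)
    ⟨b + 1, fun z hz => by
      by_contra h
      exact hb' (S.ball_anti (le_of_not_ge h) hz)⟩ ⟨_, ha'⟩
  exact ⟨n, hn, fun h => by have := hmax _ h; omega⟩

variable [MeasurableSpace K] [BorelSpace K]

lemma Choices.measurableSet_shell (S : Choices K p c) (n : ℤ) : MeasurableSet (S.shell n) :=
  (S.isOpen_ball n).measurableSet.diff (S.isOpen_ball (n + 1)).measurableSet

variable {μ : Measure K}

lemma Choices.setLIntegral_eq_tsum_inter_cell (S : Choices K p c) {A : Set K} (hA : MeasurableSet A)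
    (n : ℤ) (f : K → ℝ≥0∞) : ∫⁻ x in A, f x ∂μ = ∑' k, ∫⁻ x in A ∩ S.cell n k, f x ∂μ := by
  rw [← lintegral_iUnion (fun k => hA.inter (S.measurableSet_cell n k))
    (fun i j hij => (S.pairwise_disjoint_cell n hij).mono Set.inter_subset_right
      Set.inter_subset_right), ← Set.inter_iUnion, S.iUnion_cell, Set.inter_univ]

variable [μ.IsAddHaarMeasure] [μ.Regular]

lemma Choices.measure_singleton_zero (S : Choices K p c) (hμ : μ (𝒪[K] : Set K) = 1) :
    μ {0} = 0 := by
  have h1 : ∀ n : ℕ, μ {0} ≤ ((resCard K : ℝ≥0∞)⁻¹) ^ n := fun n => by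
    rw [← ENNReal.inv_pow, ← zpow_natCast, ← ENNReal.zpow_neg, ← S.measure_cell μ hμ n 0]
    refine measure_mono (Set.singleton_subset_iff.2 ?_)
    simp [S.mem_cell, S.u_zero, zero_mem]
  exact nonpos_iff_eq_zero.1 (ge_of_tendsto' (ENNReal.tendsto_pow_atTop_nhds_zero_of_lt_one
    (ENNReal.inv_lt_one.2 (by exact_mod_cast one_lt_resCard))) h1)

/-- The sets `{π ^ j * x | x ∈ shell 0}`, for `j ∈ ℤ`, are disjoint. -/
lemma Choices.tsum_shell_le (S : Choices K p c) (hμ : μ (𝒪[K] : Set K) = 1) (f : K → ℝ≥0∞) :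
    ∑' j : ℤ, (resCard K : ℝ≥0∞) ^ (-j) * ∫⁻ x in S.shell 0, f ((S.π : K) ^ j * x) ∂μ ≤
      ∫⁻ x, f x ∂μ := by
  have h1 : ∀ j : ℤ, (resCard K : ℝ≥0∞) ^ (-j) * ∫⁻ x in S.shell 0, f ((S.π : K) ^ j * x) ∂μ =
      ∫⁻ x in S.shell j, f x ∂μ := fun j => by
    have h2 := S.lintegral_zpow_mul μ hμ j ((S.shell j).indicator f)
    have h3 : ∀ x, (S.shell j).indicator f ((S.π : K) ^ j * x) =
        (S.shell 0).indicator (fun x => f ((S.π : K) ^ j * x)) x := fun x => by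
      classical
      exact if_congr (by rw [S.zpow_mul_mem_shell, sub_self]) rfl rfl
    simp only [h3] at h2
    rw [lintegral_indicator (S.measurableSet_shell 0), lintegral_indicator (S.measurableSet_shell j)]
      at h2
    rw [h2, ← mul_assoc, mul_comm ((resCard K : ℝ≥0∞) ^ (-j)), resCard_zpow_mul_zpow_neg, one_mul]
  simp only [h1]
  rw [← lintegral_iUnion S.measurableSet_shell S.pairwise_disjoint_shell]
  exact setLIntegral_le_lintegral _ _

variable [Fact p.Prime] [CharP K p] {S : Choices K p c} {L : ℕ} {Ψ : Fin L → Lp ℂ 2 μ}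

omit [μ.Regular] in
lemma Choices.measurable_density_mul (S : Choices K p c) (hμ : μ (𝒪[K] : Set K) = 1) (a : K) :
    Measurable fun x => S.density hμ Ψ (a * x) :=
  (S.measurable_density hμ).comp (measurable_mul_left _)

omit [μ.Regular] in
lemma Choices.lintegral_density (S : Choices K p c) (hμ : μ (𝒪[K] : Set K) = 1) :
    ∫⁻ x, S.density hμ Ψ x ∂μ = ∑ l, ‖Ψ l‖ₑ ^ 2 := by
  simp only [Choices.density]
  rw [lintegral_finsetSum _ fun l _ =>
    (Lp.stronglyMeasurable (S.fourier hμ (Ψ l))).measurable.enorm.pow_const 2]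
  refine Finset.sum_congr rfl fun l _ => ?_
  rw [← enorm_sq_eq_lintegral, enorm_map]

omit [μ.Regular] in
lemma Choices.setLIntegral_density_mul (S : Choices K p c) (hμ : μ (𝒪[K] : Set K) = 1) (E : Set K)
    (a : K) : ∫⁻ x in E, S.density hμ Ψ (a * x) ∂μ =
      ∑ l, ∫⁻ x in E, ‖S.fourier hμ (Ψ l) (a * x)‖ₑ ^ 2 ∂μ := by
  simp only [Choices.density]
  exact lintegral_finsetSum _ fun l _ => ((Lp.stronglyMeasurable (S.fourier hμ
    (Ψ l))).measurable.comp (measurable_mul_left _)).enorm.pow_const 2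

/-- The Parseval identity for a function whose Fourier transform is the indicator function of a
subset `E` of a ball of radius `q ^ (-n)`. The scales `j ≥ -n` contribute the first sum; the other
scales are bounded by the second one. -/
lemma IsParsevalMultiwavelet.measure_le (hμ : μ (𝒪[K] : Set K) = 1)
    (h : IsParsevalMultiwavelet S μ Ψ) {E : Set K} (hE : MeasurableSet E) {n : ℤ} {i : ℕ}
    (hi : E ⊆ S.cell n i) :
    μ E ≤ ∑' j : ℤ, ∫⁻ x in E, S.density hμ Ψ ((S.π : K) ^ j * x) ∂μ +
      (resCard K : ℝ≥0∞) ^ (-n) * ∑' j : ℤ, (resCard K : ℝ≥0∞) ^ (-j) *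
        ∫⁻ x in E, S.density hμ Ψ ((S.π : K) ^ j * x) ∂μ := by
  have hEfin : μ E ≠ ∞ :=
    ne_top_of_le_ne_top (by rw [S.measure_cell μ hμ]; exact resCard_zpow_ne_top _)
      (measure_mono hi)
  obtain ⟨f, hf, hfn⟩ := S.exists_fourier_eq_indicator hμ hE hEfin
  rw [← hfn, ← h.tsum_eq f, ← ENNReal.tsum_mul_left, ← ENNReal.tsum_add,
    ← Summable.tsum_finsetSum fun _ _ => ENNReal.summable]
  refine ENNReal.tsum_le_tsum fun j => ?_
  rw [S.setLIntegral_density_mul hμ, Finset.mul_sum, Finset.mul_sum, ← Finset.sum_add_distrib]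
  refine Finset.sum_le_sum fun l _ => ?_
  rcases le_total j (-n) with hj | hj
  · exact (S.tsum_inner_affine_le hμ hE hf hj hi (Ψ l)).trans le_add_self
  · have hx : E ⊆ S.cell (-j) (S.idx ((S.π : K) ^ j * ((S.π : K) ^ n * S.u i))) := by
      refine hi.trans (S.cell_subset (by omega) (x := (S.π : K) ^ n * S.u i) ?_ ?_)
      · rw [S.mem_cell_iff_sub, sub_self]
        exact zero_mem _
      · simpa using S.mem_cell_idx (-j) ((S.π : K) ^ n * S.u i)
    exact (S.tsum_inner_affine hμ hE hf j hx (Ψ l)).le.trans le_self_add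

/-- The lower bound in the Calderón identity, integrated over the units: cut the shell into balls
of radius `q ^ (-n)`, and let `n` tend to infinity. -/
lemma IsParsevalMultiwavelet.measure_shell_le (hμ : μ (𝒪[K] : Set K) = 1)
    (h : IsParsevalMultiwavelet S μ Ψ) :
    μ (S.shell 0) ≤ ∫⁻ x in S.shell 0, ∑' j : ℤ, S.density hμ Ψ ((S.π : K) ^ j * x) ∂μ := by
  set C := ∑ l, ‖Ψ l‖ₑ ^ 2
  have hC : C ≠ ∞ := ENNReal.sum_ne_top.2 fun l _ => ENNReal.pow_ne_top enorm_ne_top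
  have h1 : ∀ n : ℕ, μ (S.shell 0) ≤
      ∫⁻ x in S.shell 0, ∑' j : ℤ, S.density hμ Ψ ((S.π : K) ^ j * x) ∂μ +
        ((resCard K : ℝ≥0∞)⁻¹) ^ n * C := by
    intro n
    rw [← setLIntegral_one, S.setLIntegral_eq_tsum_inter_cell (S.measurableSet_shell 0) n]
    simp only [setLIntegral_one]
    refine (ENNReal.tsum_le_tsum fun k => h.measure_le hμ
      ((S.measurableSet_shell 0).inter (S.measurableSet_cell n k)) Set.inter_subset_right).trans ?_
    rw [ENNReal.tsum_add, ENNReal.tsum_comm, ENNReal.tsum_mul_left,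
      lintegral_tsum fun j => (S.measurable_density_mul hμ _).aemeasurable]
    simp only [← S.setLIntegral_eq_tsum_inter_cell (S.measurableSet_shell 0) n]
    refine add_le_add le_rfl ?_
    rw [ENNReal.tsum_comm]
    simp only [ENNReal.tsum_mul_left,
      ← S.setLIntegral_eq_tsum_inter_cell (S.measurableSet_shell 0) n]
    rw [ENNReal.zpow_neg, zpow_natCast, ENNReal.inv_pow]
    refine mul_le_mul_right ?_ _
    exact (S.tsum_shell_le hμ _).trans (S.lintegral_density hμ).le
  have h2 : Filter.Tendsto (fun n : ℕ =>
      ∫⁻ x in S.shell 0, ∑' j : ℤ, S.density hμ Ψ ((S.π : K) ^ j * x) ∂μ +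
        ((resCard K : ℝ≥0∞)⁻¹) ^ n * C) Filter.atTop (nhds
      (∫⁻ x in S.shell 0, ∑' j : ℤ, S.density hμ Ψ ((S.π : K) ^ j * x) ∂μ + 0 * C)) := by
    refine Filter.Tendsto.const_add _ (ENNReal.Tendsto.mul_const ?_ (Or.inr hC))
    refine ENNReal.tendsto_pow_atTop_nhds_zero_of_lt_one ?_
    exact ENNReal.inv_lt_one.2 (by exact_mod_cast one_lt_resCard)
  simpa using ge_of_tendsto' h2 h1

/-- The upper bound in the Calderón identity: the sum over `j ≥ 0` is at most `1` by
`IsRangeFunction.spectral_add_tsum`, hence so is the sum over `j ≥ -n` for each `n`, by dilation. -/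
lemma IsRangeFunction.tsum_density_le {J : 𝒪[K] → ClosedSubmodule ℂ EllTwo}
    (hμ : μ (𝒪[K] : Set K) = 1)
    (hJ : IsRangeFunction S μ (negDilateSpace S μ Ψ) J) (h : IsParsevalMultiwavelet S μ Ψ)
    (h' : IsSemiOrthogonal S μ Ψ) :
    ∀ᵐ x ∂μ, ∑' j : ℤ, S.density hμ Ψ ((S.π : K) ^ j * x) ≤ 1 := by
  have h1 : ∀ᵐ x ∂μ, ∀ n : ℕ, ∑' j : ℕ,
      S.density hμ Ψ ((S.π : K) ^ (j : ℤ) * ((S.π : K) ^ (-(n : ℤ)) * x)) ≤ 1 := by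
    refine ae_all_iff.2 fun n => ae_comp_mul μ (zpow_ne_zero _ S.π_ne_zero)
      (P := fun x => ∑' j : ℕ, S.density hμ Ψ ((S.π : K) ^ (j : ℤ) * x) ≤ 1) ?_
    filter_upwards [hJ.spectral_add_tsum hμ h h'] with x hx
    rw [← hx]
    exact le_add_self
  filter_upwards [h1] with x hx
  rw [ENNReal.tsum_eq_iSup_sum]
  refine iSup_le fun s => ?_
  obtain ⟨m, hm⟩ := s.bddBelow
  have hm' : ∀ j ∈ s, -(m.natAbs : ℤ) ≤ j := fun j hj => by
    have := hm hj
    omega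
  refine le_trans (le_of_eq ?_) ((ENNReal.sum_le_tsum
    (s.image fun j : ℤ => (j + m.natAbs).toNat)).trans (hx m.natAbs))
  rw [Finset.sum_image]
  · refine Finset.sum_congr rfl fun j hj => ?_
    have := hm' j hj
    rw [← mul_assoc, ← zpow_add₀ S.π_ne_zero, Int.toNat_of_nonneg (by omega)]
    ring_nf
  · intro i hi j hj hij
    have h1 := hm' i hi
    have h2 := hm' j hj
    simp only at hij
    omega

/-- The Calderón identity for a semi-orthogonal Parseval multiwavelet. It holds on the units by
comparison of the integrals, and everywhere because the sum is invariant under dilation. -/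
lemma IsRangeFunction.tsum_density_eq_one {J : 𝒪[K] → ClosedSubmodule ℂ EllTwo}
    (hμ : μ (𝒪[K] : Set K) = 1)
    (hJ : IsRangeFunction S μ (negDilateSpace S μ Ψ) J) (h : IsParsevalMultiwavelet S μ Ψ)
    (h' : IsSemiOrthogonal S μ Ψ) :
    ∀ᵐ x ∂μ, ∑' j : ℤ, S.density hμ Ψ ((S.π : K) ^ j * x) = 1 := by
  set T : K → ℝ≥0∞ := fun x => ∑' j : ℤ, S.density hμ Ψ ((S.π : K) ^ j * x) with hT
  have hTm : Measurable T := Measurable.tsum fun j => S.measurable_density_mul hμ _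
  have hle : ∀ᵐ x ∂μ, T x ≤ 1 := hJ.tsum_density_le hμ h h'
  have hfin : μ (S.shell 0) ≠ ∞ := by
    refine ne_top_of_le_ne_top (b := 1) (by simp) (hμ ▸ measure_mono fun x hx => ?_)
    exact S.mem_ball_zero.1 hx.1
  have h0 : ∀ᵐ x ∂μ, x ∈ S.shell 0 → T x = 1 := by
    rw [← ae_restrict_iff' (S.measurableSet_shell 0)]
    refine ae_eq_of_ae_le_of_lintegral_le (ae_restrict_of_ae hle) ?_ aemeasurable_const ?_
    · refine ne_top_of_le_ne_top hfin ?_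
      rw [← setLIntegral_one]
      exact lintegral_mono_ae (ae_restrict_of_ae hle)
    · simpa using h.measure_shell_le hμ
  have h1 : ∀ᵐ x ∂μ, ∀ n : ℤ, (S.π : K) ^ (-n) * x ∈ S.shell 0 → T ((S.π : K) ^ (-n) * x) = 1 :=
    ae_all_iff.2 fun n => ae_comp_mul μ (zpow_ne_zero _ S.π_ne_zero) h0
  have h2 : ∀ᵐ x ∂μ, x ≠ 0 := by
    rw [ae_iff]
    simpa using S.measure_singleton_zero hμ
  filter_upwards [h1, h2] with x hx hx0
  obtain ⟨n, hn⟩ := S.exists_mem_shell hx0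
  have h3 := hx n (S.zpow_mul_mem_shell.2 (by simpa using hn))
  rw [← h3, hT]
  simp only [← mul_assoc, ← zpow_add₀ S.π_ne_zero]
  exact ((Equiv.addRight (-n)).tsum_eq fun j : ℤ => S.density hμ Ψ ((S.π : K) ^ j * x)).symm

end Calderon

/-! ### Bessel's inequality for the translates of a generator -/

section Bessel

variable {K : Type*} [Field K] [ValuativeRel K] [TopologicalSpace K]
  [IsNonarchimedeanLocalField K] {p c : ℕ}

/-- The bracket product of `g` with itself, `ξ ↦ ∑ₖ |g(ξ + u k)|²`. -/
def Choices.bracket (S : Choices K p c) (g : K → ℂ) (ξ : K) : ℝ≥0∞ := ∑' k, ‖g (ξ + S.u k)‖ₑ ^ 2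

lemma Choices.tsum_add_u [Fact p.Prime] [CharP K p] (S : Choices K p c) (F : K → ℝ≥0∞) (ξ : K)
    (m : ℕ) : ∑' k, F (ξ + S.u m + S.u k) = ∑' k, F (ξ + S.u k) := by
  rw [← (S.addIdx m).tsum_eq fun k => F (ξ + S.u k)]
  simp only [S.u_addIdx, add_assoc, add_comm (S.u m)]

lemma Choices.tsum_conj_mul (S : Choices K p c) (g : K → ℂ) (ξ : K) :
    ∑' k, (starRingEnd ℂ) (g (ξ + S.u k)) * g (ξ + S.u k) = ((S.bracket g ξ).toReal : ℂ) := by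
  rw [Choices.bracket, ENNReal.tsum_toReal_eq fun k => ENNReal.pow_ne_top enorm_ne_top,
    Complex.ofReal_tsum]
  refine tsum_congr fun k => ?_
  rw [RCLike.conj_mul, ENNReal.toReal_pow, toReal_enorm]
  simp

variable [MeasurableSpace K] [BorelSpace K] {μ : Measure K} [μ.IsAddHaarMeasure]

omit [μ.IsAddHaarMeasure] in
lemma Choices.measurable_bracket (S : Choices K p c) (g : Lp ℂ 2 μ) : Measurable (S.bracket g) :=
  Measurable.tsum fun _ => ((Lp.stronglyMeasurable g).measurable.comp
    (measurable_id.add_const _)).enorm.pow_const 2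

variable [μ.Regular] {S : Choices K p c} {L : ℕ} {Ψ : Fin L → Lp ℂ 2 μ}

lemma IsParsevalMultiwavelet.tsum_inner_translation_le (h : IsParsevalMultiwavelet S μ Ψ)
    (l : Fin L) (f : Lp ℂ 2 μ) :
    ∑' k, ‖inner ℂ (affine S 0 k (Ψ l)) f‖ₑ ^ 2 ≤ ‖f‖ₑ ^ 2 := by
  rw [← h.tsum_eq f]
  exact (ENNReal.le_tsum (f := fun j : ℤ => ∑' k, ‖inner ℂ (affine S j k (Ψ l)) f‖ₑ ^ 2) 0).trans
    (Finset.single_le_sum (f := fun l => ∑' j : ℤ, ∑' k, ‖inner ℂ (affine S j k (Ψ l)) f‖ₑ ^ 2)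
      (fun _ _ => zero_le) (Finset.mem_univ l))

variable [Fact p.Prime] [CharP K p]

/-- The coefficients with respect to the translates of `ψ` of a function `f` whose Fourier transform
is the product of that of `ψ` and the indicator function of a periodic set `E`. -/
lemma Choices.inner_affine_periodic (S : Choices K p c) (hμ : μ (𝒪[K] : Set K) = 1)
    {ψ f : Lp ℂ 2 μ} {E : Set K} (hE : MeasurableSet E) (hper : ∀ ξ k, ξ + S.u k ∈ E ↔ ξ ∈ E)
    (hf : S.fourier hμ f =ᵐ[μ] E.indicator (S.fourier hμ ψ)) (m : ℕ) :
    inner ℂ (affine S 0 m ψ) f = ∫ ξ, (S.χ (S.u m * ξ) : ℂ) *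
      ((𝒪[K] : Set K) ∩ E).indicator
        (fun ξ => ((S.bracket (S.fourier hμ ψ) ξ).toReal : ℂ)) ξ ∂μ := by
  set g := S.fourier hμ ψ
  have hint : Integrable (E.indicator fun ξ => (starRingEnd ℂ) (g ξ) * g ξ) μ :=
    (integrable_conj_mul g g).indicator hE
  have h1 : inner ℂ (affine S 0 m ψ) f = ∫ ξ, (S.χ (S.u m * ξ) : ℂ) *
      E.indicator (fun ξ => (starRingEnd ℂ) (g ξ) * g ξ) ξ ∂μ := by
    rw [S.inner_affine hμ]
    refine integral_congr_ae ?_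
    filter_upwards [hf] with ξ hξ
    rw [hξ]
    by_cases h : ξ ∈ E <;> simp [h, g]
  rw [h1, S.integral_eq_setIntegral_tsum (S.integrable_χ_mul (S.u m) hint),
    ← integral_indicator measurableSet_integers]
  refine integral_congr_ae (Filter.Eventually.of_forall fun ξ => ?_)
  beta_reduce
  by_cases hO : ξ ∈ (𝒪[K] : Set K)
  · rw [Set.indicator_of_mem hO]
    simp only [mul_add, AddChar.map_add_eq_mul, S.χ_u_mul_u, mul_one]
    rw [tsum_mul_left]
    congr 1
    by_cases h : ξ ∈ E
    · rw [Set.indicator_of_mem (Set.mem_inter hO h), ← S.tsum_conj_mul]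
      refine tsum_congr fun k => ?_
      rw [Set.indicator_of_mem ((hper ξ k).2 h)]
    · rw [Set.indicator_of_notMem fun h' => h h'.2]
      simp [hper, h]
  · rw [Set.indicator_of_notMem hO, Set.indicator_of_notMem fun h' => hO h'.1, mul_zero]

/-- The translates of a generator satisfy Bessel's inequality, hence the periodization `Φ` of the
square of its Fourier transform is at most `1`. Bessel's inequality for the function whose Fourier
transform is that of the generator, restricted to a periodic set where `Φ` is bounded, reads
`∫ Φ² ≤ ∫ Φ`; so this set is null if `Φ > 1` on it. -/
lemma IsParsevalMultiwavelet.bracket_le_one (hμ : μ (𝒪[K] : Set K) = 1)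
    (h : IsParsevalMultiwavelet S μ Ψ) (l : Fin L) :
    ∀ᵐ ξ ∂μ, S.bracket (S.fourier hμ (Ψ l)) ξ ≤ 1 := by
  set g := S.fourier hμ (Ψ l) with hg
  set Φ := S.bracket g with hΦ
  have hΦm : Measurable Φ := S.measurable_bracket g
  have hΦper : ∀ ξ k, Φ (ξ + S.u k) = Φ ξ := fun ξ k => S.tsum_add_u (fun x => ‖g x‖ₑ ^ 2) ξ k
  -- The bound `C` makes `Φ` square integrable on the set.
  have key : ∀ C : ℕ, ∀ᵐ ξ ∂μ, ξ ∈ (𝒪[K] : Set K) → ¬ (1 < Φ ξ ∧ Φ ξ ≤ C) := by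
    intro C
    set E := {ξ | 1 < Φ ξ ∧ Φ ξ ≤ C} with hE
    have hEm : MeasurableSet E :=
      (measurableSet_lt measurable_const hΦm).inter (measurableSet_le hΦm measurable_const)
    set B := (𝒪[K] : Set K) ∩ E with hB
    have hBm : MeasurableSet B := measurableSet_integers.inter hEm
    have hBfin : μ B ≤ 1 := hμ ▸ measure_mono Set.inter_subset_left
    have hper : ∀ ξ k, ξ + S.u k ∈ E ↔ ξ ∈ E := fun ξ k => by
      simp only [hE, Set.mem_ofPred_eq, hΦper]
    have hm : MemLp (E.indicator g) 2 μ := (Lp.memLp g).indicator hEm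
    set f := (S.fourier hμ).symm (hm.toLp _) with hfdef
    have hf : S.fourier hμ f =ᵐ[μ] E.indicator g := by
      rw [hfdef, LinearIsometryEquiv.apply_symm_apply]
      exact hm.coeFn_toLp
    have hfn : ‖f‖ₑ ^ 2 = ∫⁻ ξ in B, Φ ξ ∂μ := by
      rw [← enorm_map (S.fourier hμ) f, enorm_sq_eq_lintegral, hB, Set.inter_comm,
        ← setLIntegral_indicator hEm]
      have h1 : ∫⁻ x, ‖S.fourier hμ f x‖ₑ ^ 2 ∂μ = ∫⁻ x, ‖E.indicator g x‖ₑ ^ 2 ∂μ := by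
        refine lintegral_congr_ae ?_
        filter_upwards [hf] with x hx
        rw [hx]
      rw [h1, S.lintegral_eq_setLIntegral_tsum μ
        (((Lp.stronglyMeasurable g).measurable.indicator hEm).enorm.pow_const 2)]
      refine lintegral_congr fun ξ => ?_
      by_cases hξ : ξ ∈ E
      · rw [Set.indicator_of_mem hξ]
        refine tsum_congr fun k => ?_
        rw [Set.indicator_of_mem ((hper ξ k).2 hξ)]
      · rw [Set.indicator_of_notMem hξ]
        simp [hper, hξ]
    set H : K → ℂ := B.indicator fun ξ => ((Φ ξ).toReal : ℂ) with hH
    have hHe : ∀ ξ, ‖H ξ‖ₑ ^ 2 = B.indicator (fun ξ => Φ ξ ^ 2) ξ := by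
      intro ξ
      by_cases hξ : ξ ∈ B
      · rw [hH, Set.indicator_of_mem hξ, Set.indicator_of_mem hξ, ← ofReal_norm, Complex.norm_real,
          Real.norm_of_nonneg ENNReal.toReal_nonneg, ENNReal.ofReal_toReal]
        exact ne_top_of_le_ne_top (ENNReal.natCast_ne_top C) hξ.2.2
      · simp [hH, hξ]
    have hHm : Measurable H := (Complex.measurable_ofReal.comp hΦm.ennreal_toReal).indicator hBm
    have hHmem : MemLp H 2 μ := by
      have hfin : IsFiniteMeasure (μ.restrict B) :=
        isFiniteMeasure_restrict.2 (ne_top_of_le_ne_top (by simp) hBfin)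
      rw [hH, memLp_indicator_iff_restrict hBm]
      refine MemLp.of_bound
        (Complex.measurable_ofReal.comp hΦm.ennreal_toReal).aestronglyMeasurable C ?_
      rw [ae_restrict_iff' hBm]
      refine Filter.Eventually.of_forall fun ξ hξ => ?_
      rw [Complex.norm_real, Real.norm_of_nonneg ENNReal.toReal_nonneg]
      simpa using ENNReal.toReal_mono (ENNReal.natCast_ne_top C) hξ.2.2
    have hle : ∫⁻ ξ in B, Φ ξ ^ 2 ∂μ ≤ ∫⁻ ξ in B, Φ ξ ∂μ := by
      rw [← hfn, ← lintegral_indicator hBm]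
      simp only [← hHe]
      rw [← S.tsum_χ_cell_zero hμ 0 hHmem fun x hx => by
        rw [S.cell_zero_zero] at hx
        exact Set.indicator_of_notMem (fun h' => hx h'.1) _]
      refine le_trans (le_of_eq (tsum_congr fun m => ?_)) (h.tsum_inner_translation_le l f)
      rw [S.inner_affine_periodic hμ hEm hper hf m]
    have hfin : ∫⁻ ξ in B, Φ ξ ∂μ ≠ ∞ := by
      rw [← hfn]
      exact ENNReal.pow_ne_top enorm_ne_top
    have heq := ae_eq_of_ae_le_of_lintegral_le (μ := μ.restrict B) (f := Φ) (g := fun ξ => Φ ξ ^ 2)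
      (by
        rw [Filter.EventuallyLE, ae_restrict_iff' hBm]
        exact Filter.Eventually.of_forall fun ξ hξ => le_self_pow₀ hξ.2.1.le two_ne_zero)
      hfin (hΦm.pow_const 2).aemeasurable hle
    rw [Filter.EventuallyEq, ae_restrict_iff' hBm] at heq
    filter_upwards [heq] with ξ hξ hO hξE
    have h1 := hξ ⟨hO, hξE⟩
    have h2 : Φ ξ ≠ ∞ := ne_top_of_le_ne_top (ENNReal.natCast_ne_top C) hξE.2
    have h3 := ENNReal.mul_lt_mul_left (zero_lt_one.trans hξE.1).ne' h2 hξE.1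
    rw [one_mul, ← sq, ← h1] at h3
    exact lt_irrefl _ h3
  refine S.ae_of_ae_cell μ fun k => (S.ae_cell_iff μ k).2 ?_
  simp only [hΦper]
  filter_upwards [S.ae_memℓp g, (ae_restrict_iff' measurableSet_integers).2 (ae_all_iff.2 key |>.mono
    fun ξ hξ hO C => hξ C hO)] with ξ h1 h2
  by_contra hlt
  obtain ⟨C, hC⟩ := ENNReal.exists_nat_gt (memℓp_two_iff.1 h1)
  exact h2 C ⟨not_le.1 hlt, hC.le⟩

end Bessel

/-! ### The multiplicity function -/

section Multiplicity

variable {K : Type*} [Field K] [ValuativeRel K] [TopologicalSpace K]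
  [IsNonarchimedeanLocalField K] {p c : ℕ} [Fact p.Prime] [CharP K p]

lemma Choices.frac_periodic (S : Choices K p c) (ξ : K) (k : ℕ) :
    S.frac (ξ + S.u k) = S.frac ξ := by
  have h : ξ + S.u k = S.frac ξ + S.u (S.addIdx k (S.idx ξ)) := by
    rw [S.u_addIdx, ← add_assoc, S.frac_add_u]
  rw [h, S.frac_of_add_u (S.frac ξ).2]

variable [MeasurableSpace K] [BorelSpace K] {μ : Measure K} {S : Choices K p c} {L : ℕ}

omit [BorelSpace K] in
lemma IsRangeFunction.exists_isMultiplicityFunction {V : Submodule ℂ (Lp ℂ 2 μ)}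
    {J : 𝒪[K] → ClosedSubmodule ℂ EllTwo} (hJ : IsRangeFunction S μ V J) :
    ∃ m, IsMultiplicityFunction S μ V m := by
  refine ⟨fun ξ => Cardinal.toENat (Module.rank ℂ (J (S.frac ξ)).toSubmodule),
    ⟨J, hJ, fun ξ => ?_⟩, fun ξ k => by beta_reduce; rw [S.frac_periodic]⟩
  have h := S.frac_of_add_u ξ.2 0
  rw [S.u_zero, add_zero] at h
  beta_reduce
  rw [h]

omit [MeasurableSpace K] [BorelSpace K] in
/-- The multiplicity function is the periodization of the spectral function. -/
lemma Choices.multiplicity_eq (S : Choices K p c) {J : 𝒪[K] → ClosedSubmodule ℂ EllTwo}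
    {m : K → ℕ∞}
    (hm : ∀ ξ : 𝒪[K], m (ξ : K) = Cardinal.toENat (Module.rank ℂ (J ξ).toSubmodule))
    (hper : ∀ (ξ : K) (k : ℕ), m (ξ + S.u k) = m ξ) (ξ : K) :
    (m ξ : ℝ≥0∞) = ∑' k, S.spectral J (ξ + S.u k) := by
  have h : (m (S.frac ξ : K) : ℝ≥0∞) = ∑' k, S.spectral J (S.frac ξ + S.u k) := by
    have : CompleteSpace (J (S.frac ξ)).toSubmodule :=
      (J (S.frac ξ)).isClosed.completeSpace_coe
    rw [hm, toENat_rank_eq_tsum stdBasis]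
    exact tsum_congr fun k => (S.spectral_add_u J (S.frac ξ).2 k).symm
  have h2 := hper (S.frac ξ) (S.idx ξ)
  have h3 := S.tsum_add_u (S.spectral J) (S.frac ξ) (S.idx ξ)
  rw [S.frac_add_u] at h2 h3
  rw [h2, h3, h]

variable [μ.IsAddHaarMeasure] [μ.Regular] {Ψ : Fin L → Lp ℂ 2 μ}
  {J : 𝒪[K] → ClosedSubmodule ℂ EllTwo}

/-- The spectral function of the space of negative dilates: the difference of the Calderón identity
and `IsRangeFunction.spectral_add_tsum`. -/
lemma IsRangeFunction.spectral_eq (hμ : μ (𝒪[K] : Set K) = 1)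
    (hJ : IsRangeFunction S μ (negDilateSpace S μ Ψ) J) (h : IsParsevalMultiwavelet S μ Ψ)
    (h' : IsSemiOrthogonal S μ Ψ) :
    ∀ᵐ x ∂μ, S.spectral J x = ∑' j : ℕ, S.density hμ Ψ ((S.π : K) ^ (-((j : ℤ) + 1)) * x) := by
  filter_upwards [hJ.spectral_add_tsum hμ h h', hJ.tsum_density_eq_one hμ h h'] with x h1 h2
  rw [tsum_of_nat_of_neg_add_one ENNReal.summable ENNReal.summable, ← h1, add_comm] at h2
  refine ((ENNReal.add_left_inj ?_).1 h2).symm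
  exact ne_top_of_le_ne_top ENNReal.one_ne_top (h1 ▸ le_add_self)

lemma IsParsevalMultiwavelet.enorm_le_one (hμ : μ (𝒪[K] : Set K) = 1)
    (h : IsParsevalMultiwavelet S μ Ψ) (l : Fin L) : ‖Ψ l‖ₑ ^ 2 ≤ 1 := by
  have h1 : affine S 0 0 (Ψ l) = Ψ l := by
    refine (S.fourier hμ).injective (Lp.ext ?_)
    filter_upwards [S.fourier_affine hμ 0 0 (Ψ l)] with ξ hξ
    rw [affine, hξ]
    simp [S.u_zero]
  have h2 := (ENNReal.le_tsum (f := fun k => ‖inner ℂ (affine S 0 k (Ψ l)) (Ψ l)‖ₑ ^ 2) 0).trans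
    (h.tsum_inner_translation_le l (Ψ l))
  simp only [h1] at h2
  have h3 : ‖inner ℂ (Ψ l) (Ψ l)‖ₑ = ‖Ψ l‖ₑ ^ 2 := by
    rw [← ofReal_norm, inner_self_eq_norm_sq_to_K, enorm_sq_eq_ofReal]
    simp
  rw [h3] at h2
  by_contra hlt
  rw [not_le] at hlt
  have h4 := ENNReal.mul_lt_mul_left (zero_lt_one.trans hlt).ne'
    (ENNReal.pow_ne_top enorm_ne_top) hlt
  rw [one_mul, ← sq] at h4
  exact h4.not_ge h2

omit [MeasurableSpace K] [BorelSpace K] in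
lemma inv_resCard_mul_geometric :
    (resCard K : ℝ≥0∞)⁻¹ * (1 - (resCard K : ℝ≥0∞)⁻¹)⁻¹ = ((resCard K : ℝ≥0∞) - 1)⁻¹ := by
  have hq : (resCard K : ℝ≥0∞) ≠ 0 := resCard_cast_ne_zero
  have hq' : (resCard K : ℝ≥0∞) ≠ ∞ := ENNReal.natCast_ne_top _
  rw [← ENNReal.mul_inv (Or.inl hq) (Or.inl hq'), ENNReal.mul_sub fun _ _ => hq', mul_one,
    ENNReal.mul_inv_cancel hq hq']

lemma IsRangeFunction.lintegral_spectral_le (hμ : μ (𝒪[K] : Set K) = 1)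
    (hJ : IsRangeFunction S μ (negDilateSpace S μ Ψ) J) (h : IsParsevalMultiwavelet S μ Ψ)
    (h' : IsSemiOrthogonal S μ Ψ) :
    ∫⁻ x, S.spectral J x ∂μ ≤ (L : ℝ≥0∞) / ((resCard K : ℝ≥0∞) - 1) := by
  rw [lintegral_congr_ae (hJ.spectral_eq hμ h h'),
    lintegral_tsum fun j => (S.measurable_density_mul hμ _).aemeasurable]
  have h1 : ∀ j : ℕ, ∫⁻ x, S.density hμ Ψ ((S.π : K) ^ (-((j : ℤ) + 1)) * x) ∂μ =
      ((resCard K : ℝ≥0∞)⁻¹) ^ j * ((resCard K : ℝ≥0∞)⁻¹ * ∑ l, ‖Ψ l‖ₑ ^ 2) := fun j => by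
    rw [S.lintegral_zpow_mul μ hμ, S.lintegral_density hμ, ← mul_assoc, ENNReal.zpow_neg,
      ← Nat.cast_add_one, zpow_natCast, ← pow_succ, ENNReal.inv_pow]
  simp only [h1]
  rw [ENNReal.tsum_mul_right, ENNReal.tsum_geometric, ← mul_assoc,
    mul_comm _ (resCard K : ℝ≥0∞)⁻¹, inv_resCard_mul_geometric, div_eq_mul_inv, mul_comm]
  refine mul_le_mul_left ?_ _
  refine (Finset.sum_le_sum fun l _ => h.enorm_le_one hμ l).trans ?_
  simp

lemma IsRangeFunction.tsum_spectral_eq (hμ : μ (𝒪[K] : Set K) = 1)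
    (hJ : IsRangeFunction S μ (negDilateSpace S μ Ψ) J) (h : IsParsevalMultiwavelet S μ Ψ)
    (h' : IsSemiOrthogonal S μ Ψ) :
    ∀ᵐ ξ ∂μ, ∑' k, S.spectral J (ξ + S.u k) = ∑ l : Fin L, ∑' j : ℕ+, ∑' k : ℕ,
        ‖S.fourier hμ (Ψ l) (((S.π : K)⁻¹) ^ (j : ℕ) * (ξ + S.u k))‖ₑ ^ 2 := by
  filter_upwards [S.ae_add_u μ (hJ.spectral_eq hμ h h')] with ξ hξ
  simp only [hξ, Choices.density]
  rw [ENNReal.tsum_comm, ← Summable.tsum_finsetSum fun _ _ => ENNReal.summable,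
    tsum_pnat_eq_tsum_succ (f := fun j => ∑ l : Fin L, ∑' k : ℕ,
        ‖S.fourier hμ (Ψ l) (((S.π : K)⁻¹) ^ j * (ξ + S.u k))‖ₑ ^ 2)]
  refine tsum_congr fun j => ?_
  rw [← Summable.tsum_finsetSum fun _ _ => ENNReal.summable]
  refine tsum_congr fun k => Finset.sum_congr rfl fun l _ => ?_
  rw [zpow_neg, ← Nat.cast_add_one, zpow_natCast, inv_pow]

/-- The refinement relation of the spectral function. -/
lemma IsRangeFunction.spectral_π_mul (hμ : μ (𝒪[K] : Set K) = 1)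
    (hJ : IsRangeFunction S μ (negDilateSpace S μ Ψ) J) (h : IsParsevalMultiwavelet S μ Ψ)
    (h' : IsSemiOrthogonal S μ Ψ) :
    ∀ᵐ x ∂μ, S.spectral J ((S.π : K) * x) = S.spectral J x + S.density hμ Ψ x := by
  filter_upwards [hJ.spectral_eq hμ h h',
    ae_comp_mul μ S.π_ne_zero (hJ.spectral_eq hμ h h')] with x h1 h2
  rw [h2, h1, tsum_eq_zero_add' ENNReal.summable, add_comm]
  have h3 : ∀ j : ℤ, (S.π : K) ^ (-(j + 1)) * ((S.π : K) * x) = (S.π : K) ^ (-j) * x := fun j => by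
    rw [← mul_assoc, ← zpow_add_one₀ S.π_ne_zero]
    ring_nf
  simp only [h3]
  simp

omit [Fact p.Prime] [CharP K p] [MeasurableSpace K] [BorelSpace K] in
/-- The elements `𝔭(ξ + u d) + u k` with `d < q` are the elements `𝔭(ξ + u k')`, where
`k' = d + q k`. -/
lemma Choices.sum_tsum_π_mul (S : Choices K p c) (F : K → ℝ≥0∞) (ξ : K) :
    ∑ d ∈ Finset.range (resCard K), ∑' k, F ((S.π : K) * (ξ + S.u d) + S.u k) =
      ∑' k, F ((S.π : K) * (ξ + S.u k)) := by
  rw [← (digitEquiv K).tsum_eq, ENNReal.tsum_prod', tsum_fintype, Finset.sum_range]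
  refine Finset.sum_congr rfl fun d _ => tsum_congr fun k => ?_
  congr 1
  change _ = (S.π : K) * (ξ + S.u (d + resCard K * k))
  rw [S.u_add_mul d.2, ← S.u_digit d.2]
  have := S.π_ne_zero
  field_simp
  ring

lemma IsRangeFunction.sum_tsum_spectral_le (hμ : μ (𝒪[K] : Set K) = 1)
    (hJ : IsRangeFunction S μ (negDilateSpace S μ Ψ) J) (h : IsParsevalMultiwavelet S μ Ψ)
    (h' : IsSemiOrthogonal S μ Ψ) :
    ∀ᵐ ξ ∂μ, ∑ d ∈ Finset.range (resCard K),
      ∑' k, S.spectral J ((S.π : K) * (ξ + S.u d) + S.u k) ≤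
        ∑' k, S.spectral J (ξ + S.u k) + L := by
  filter_upwards [S.ae_add_u μ (hJ.spectral_π_mul hμ h h'),
    ae_all_iff.2 fun l => h.bracket_le_one hμ l] with ξ h1 h2
  rw [S.sum_tsum_π_mul]
  simp only [h1]
  rw [ENNReal.tsum_add]
  refine add_le_add le_rfl ?_
  simp only [Choices.density]
  rw [Summable.tsum_finsetSum fun _ _ => ENNReal.summable]
  refine (Finset.sum_le_sum fun l _ => h2 l).trans ?_
  simp

end Multiplicity

end LFWavelet

end

theorem proposition3p3p2 {K : Type*} [Field K] [ValuativeRel K] [TopologicalSpace K]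
    [IsNonarchimedeanLocalField K] [MeasurableSpace K] [BorelSpace K]
    {p c : ℕ} [Fact p.Prime] [CharP K p] (S : LFWavelet.Choices K p c)
    (μ : Measure K) [μ.IsAddHaarMeasure] [μ.Regular] (hμ : μ (𝒪[K] : Set K) = 1)
    {L : ℕ} (Ψ : Fin L → Lp ℂ 2 μ)
    (hΨ : LFWavelet.IsParsevalMultiwavelet S μ Ψ)
    (hΨ' : LFWavelet.IsSemiOrthogonal S μ Ψ) :
    (∃ m : K → ℕ∞,
      LFWavelet.IsMultiplicityFunction S μ (LFWavelet.negDilateSpace S μ Ψ) m) ∧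
    ∀ m : K → ℕ∞,
      LFWavelet.IsMultiplicityFunction S μ (LFWavelet.negDilateSpace S μ Ψ) m →
      (∀ᵐ ξ ∂μ, (m ξ : ℝ≥0∞) = ∑ l : Fin L, ∑' j : ℕ+, ∑' k : ℕ,
        ‖LFWavelet.fourierL2 S μ (Ψ l) (((S.π : K)⁻¹) ^ (j : ℕ) * (ξ + S.u k))‖ₑ ^ 2) ∧
      (∫⁻ ξ in (𝒪[K] : Set K), (m ξ : ℝ≥0∞) ∂μ) ≤
        (L : ℝ≥0∞) / ((LFWavelet.resCard K : ℝ≥0∞) - 1) ∧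
      (∀ᵐ ξ ∂μ, ∑ d ∈ Finset.range (LFWavelet.resCard K), m ((S.π : K) * (ξ + S.u d)) ≤
        m ξ + (L : ℕ∞)) := by
  refine ⟨(hΨ.isRangeFunction S hμ hΨ').exists_isMultiplicityFunction, ?_⟩
  rintro m ⟨⟨J, hJ, hm⟩, hper⟩
  have hmult := S.multiplicity_eq hm hper
  refine ⟨?_, ?_, ?_⟩
  · filter_upwards [hJ.tsum_spectral_eq hμ hΨ hΨ'] with ξ hξ
    rw [hmult, hξ]
    simp only [S.fourierL2_eq hμ]
  · simp only [hmult]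
    rw [← S.lintegral_eq_setLIntegral_tsum μ hJ.measurable_spectral]
    exact hJ.lintegral_spectral_le hμ hΨ hΨ'
  · filter_upwards [hJ.sum_tsum_spectral_le hμ hΨ hΨ'] with ξ hξ
    rw [← ENat.toENNReal_le, ENat.toENNReal_add, ENat.toENNReal_coe, hmult ξ]
    refine le_trans (le_of_eq ?_) hξ
    rw [show ((∑ d ∈ Finset.range (LFWavelet.resCard K), m ((S.π : K) * (ξ + S.u d)) : ℕ∞) : ℝ≥0∞) =
      ∑ d ∈ Finset.range (LFWavelet.resCard K), (m ((S.π : K) * (ξ + S.u d)) : ℝ≥0∞) from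
        map_sum ENat.toENNRealRingHom _ _]
    exact Finset.sum_congr rfl fun d _ => hmult _
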